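/- All graphs are finite and simple; a graph is 2-connected if it has at least three vertices, is connected and has no cut vertex. **Fork-type graphs.** The *dot* is an isolated vertex; the *subfork* is two vertices joined by an edge; the *star fork* is $K_{1,3}$; the *fork* has vertices $x,y,z,a,b$ and edges $zx,zy,zb,ba$; the *p-fork* has vertices $\ell,x,y,a,b,p,q,z$ and edges $ap,px,xb,bq,qy,ya,za,zb,z\ell$. For $j\ge 1$, a *$j$-big-fork* $B$ with connecting set $C(B)$ is obtained from $B'$ and a disjoint star fork $T$ by joining two leaves of $T$ to two distinct vertices of $B'$ (one each), each of degree at most two in $B'$ and, if of degree two, not in $C(B')$. Here $B'$ is the fork, with $C(B')$ the set of its three leaves, if $j=1$, and a $(j-1)$-big-fork if $j\ge2$; $C(B)=C(B')\cup\{v\}$ with $v$ the remaining leaf of $T$. The fork-collection consists of all these graphs. **Bold graphs.** A *bold* $L$ is $L$ together with half-edges, and possibly extra edges, as follows: two or three half-edges at the dot; one half-edge at each leaf of the subfork, star fork or fork; one half-edge at each of $\ell,x,y$ for the p-fork; for a $j$-big-fork, one half-edge at each vertex of $C(L)$ and a (possibly empty) set of pairwise disjoint further edges (between non-adjacent vertices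 of $L$) and half-edges, such that all degrees, counting half-edges, are at most 3. **Fork graphs.** A cubic graph $G$ is a *fork graph* with *building sequence* $G_0,\dots,G_n$ if all $G_i$ are 2-connected, $G_0$ is a triangle, $G_n=G$, and for each $1\le i\le n$ the graph $G_i$ is obtained from $G_{i-1}$ either by *addition of a bold $L_i$* for a member $L_i$ of the fork-collection disjoint from $G_{i-1}$ (each half-edge is connected to a vertex of degree 2 of $G_{i-1}$, different half-edges to different vertices), or by a Y-$\Delta$ or $\Delta$-Y transformation (a vertex is replaced by a triangle on new vertices, the edges at the vertex being redirected to pairwise distinct vertices of the triangle; or the inverse). The fork is added at most once. **Mixed graphs and safe reductions.** A *mixed graph* $(V,E,A)$ has vertex set $V$, edges $E$ and arcs $A$ (no loops) such that every vertex has degree two or three in $(V,E)$, and every vertex of degree two is the tail of exactly one arc and the head of exactly one arc. A cubic graph is a mixed graph with $A=\emptyset$. Let $S\subseteq V$. Let $A_S$ be the set of arcs incident to $S$ and let $A'$ consist of two opposite arcs for each edge incident to $S$. Call a directed path (without repeated vertices) with both ends in $V\setminus S$ and all inner vertices in $S$, or a directed cycle (without repeated vertices) with all vertices in $S$, *safe*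 if it has at most one arc from $A_S$ and is not a 2-cycle composed of arcs of $A'$ only. A mixed graph is obtained from $(V,E,A)$ by a *safe reduction of $S$* if it arises by partitioning $A_S\cup A'$ into safe directed paths and safe directed cycles, replacing each of these paths by an arc from its first to its last vertex, and deleting $S$. The set $S$ *can be safely reduced* if some mixed graph is obtained in this way. **Cut-obstacles.** Let $E_S$ and $A_S^\ast$ be the sets of edges and arcs with exactly one end in $S$. Then $S$ is a *cut-obstacle* if there is no set $P$ of pairs of distinct elements of $E_S\cup A_S^\ast$ such that each edge of $E_S$ is in exactly two pairs of $P$, each arc of $A_S^\ast$ is in exactly one pair of $P$, and no pair of $P$ contains two arcs. **Theorem.** Let $G$ be a fork graph with building sequence $G_0,\dots,G_n$. Let $1\le i\le n$ be such that $G_i$ is obtained from $G_{i-1}$ by addition of a bold $L_i$ and $G_i$ is an induced subgraph of $G$ (which is automatic if no later step is a transformation). Suppose that $V(G)\setminus V(G_i)$ can be safely reduced in $G$ and let $G_i'$ be any mixed graph so obtained. Then: 1. If $L_i$ is not a $j$-big-fork for any $j\ge1$, then $V(L_i)$ can be safely reduced in $G_i'$. 2. If $L_i$ is a $j$-big-fork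 for some $j\ge1$ and $V(L_i)$ is not a cut-obstacle in $G_i'$, then $V(L_i)$ can be safely reduced in $G_i'$. -/

import Mathlib

/-! ### Finite simple graphs on a common ground type -/

/-- A simple graph whose vertex set is a subset of the ground type `V`. -/
abbrev PGraph (V : Type*) := (⊤ : SimpleGraph V).Subgraph

/-- The degree of `v` in `G`. -/
noncomputable def PGraph.deg {V : Type*} (G : PGraph V) (v : V) : ℕ := (G.neighborSet v).ncard

/-- The leaves of `G`. -/
def PGraph.leaves {V : Type*} (G : PGraph V) : Set V := {v | v ∈ G.verts ∧ G.deg v = 1}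

/-- Every vertex has degree three. -/
def PGraph.IsCubic {V : Type*} (G : PGraph V) : Prop := ∀ v ∈ G.verts, G.deg v = 3

/-- Finite, with at least three vertices, connected, and without a cut vertex
(`Set.ncard` of an infinite set is `0`). -/
def PGraph.IsTwoConnected {V : Type*} (G : PGraph V) : Prop :=
  3 ≤ G.verts.ncard ∧ G.Connected ∧ ∀ v ∈ G.verts, (G.deleteVerts {v}).Connected

/-- `H` is an induced subgraph of `G`. -/
def PGraph.IsInducedIn {V : Type*} (H G : PGraph V) : Prop :=
  H.verts ⊆ G.verts ∧ ∀ u ∈ H.verts, ∀ v ∈ H.verts, (H.Adj u v ↔ G.Adj u v)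

/-- `G` has exactly the (pairwise distinct) vertices `vs` and exactly the edges `es`. -/
def PGraph.HasShape {V : Type*} (G : PGraph V) (vs : List V) (es : List (V × V)) : Prop :=
  vs.Nodup ∧ G.verts = {v | v ∈ vs} ∧ ∀ u v, G.Adj u v ↔ (u, v) ∈ es ∨ (v, u) ∈ es

/-! ### The fork-collection -/

def PGraph.IsTriangle {V : Type*} (L : PGraph V) : Prop :=
  ∃ a b c, L.HasShape [a, b, c] [(a, b), (b, c), (c, a)]

/-- The dot: an isolated vertex. -/
def PGraph.IsDot {V : Type*} (L : PGraph V) : Prop := ∃ v, L.HasShape [v] []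

/-- The subfork: two vertices joined by an edge. -/
def PGraph.IsSubfork {V : Type*} (L : PGraph V) : Prop := ∃ u v, L.HasShape [u, v] [(u, v)]

/-- The star fork with centre `z` and leaves `x`, `y`, `b`. -/
def PGraph.IsStarForkOn {V : Type*} (L : PGraph V) (z x y b : V) : Prop :=
  L.HasShape [z, x, y, b] [(z, x), (z, y), (z, b)]

def PGraph.IsStarFork {V : Type*} (L : PGraph V) : Prop := ∃ z x y b, L.IsStarForkOn z x y b

/-- The fork: the star with centre `z` and leaves `x`, `y`, `b`, and one more vertex `a`
hanging at `b`. -/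
def PGraph.IsFork {V : Type*} (L : PGraph V) : Prop :=
  ∃ x y z a b, L.HasShape [x, y, z, a, b] [(z, x), (z, y), (z, b), (b, a)]

/-- The p-fork with leaf `l` and distinguished vertices `x`, `y`: the 6-cycle
`a, p, x, b, q, y` and a vertex `z` adjacent to `a`, `b` and `l`. It is the Petersen graph
minus two non-adjacent vertices, one of which has the neighbours `l`, `x`, `y` and the other
the neighbours `l`, `p`, `q`. -/
def PGraph.IsPForkOn {V : Type*} (L : PGraph V) (l x y : V) : Prop :=
  ∃ a b p q z, L.HasShape [l, x, y, a, b, p, q, z]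
    [(a, p), (p, x), (x, b), (b, q), (q, y), (y, a), (z, a), (z, b), (z, l)]

/-- `B` is obtained from `B'` and a star fork disjoint from it by connecting two leaves of the star
fork to two vertices of `B'` of degree at most two, where a vertex of degree two must not belong to
`C`. The vertex `c` is the remaining leaf. -/
def PGraph.IsStarExtension {V : Type*} (B' : PGraph V) (C : Set V) (B : PGraph V) (c : V) : Prop :=
  ∃ (T : PGraph V) (z x y u w : V), T.IsStarForkOn z x y c ∧ Disjoint B'.verts T.verts ∧
    u ≠ w ∧ (∀ t ∈ [u, w], t ∈ B'.verts ∧ (B'.deg t ≤ 1 ∨ (B'.deg t = 2 ∧ t ∉ C))) ∧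
    B.verts = B'.verts ∪ T.verts ∧
    ∀ s t, B.Adj s t ↔ B'.Adj s t ∨ T.Adj s t ∨ s(s, t) = s(x, u) ∨ s(s, t) = s(y, w)

/-- `B` is a `j`-big-fork (`j ≥ 1`) with connecting set `C`. A `1`-big-fork arises from the fork,
whose three leaves form its connecting set. -/
inductive PGraph.IsBigForkWith {V : Type*} : ℕ → PGraph V → Set V → Prop
  | one (F B : PGraph V) (c : V) (hF : F.IsFork) (hB : F.IsStarExtension F.leaves B c) :
      PGraph.IsBigForkWith 1 B (insert c F.leaves)
  | succ (j : ℕ) (B' B : PGraph V) (C : Set V) (c : V) (hB' : PGraph.IsBigForkWith j B' C)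
      (hB : B'.IsStarExtension C B c) : PGraph.IsBigForkWith (j + 1) B (insert c C)

def PGraph.IsBigFork {V : Type*} (j : ℕ) (B : PGraph V) : Prop := ∃ C, PGraph.IsBigForkWith j B C

/-! ### Bold members of the fork-collection, and fork graphs -/

/-- A bold `L`: the graph `B` is `L` together with the extra edges, and `h v` is the number of
half-edges added at the vertex `v`. -/
inductive PGraph.IsBold {V : Type*} (L B : PGraph V) (h : V → ℕ) : Prop
  | dot (hL : L.IsDot) (hB : B = L) (hh : ∀ v ∈ L.verts, h v = 2 ∨ h v = 3)
  | tree (hL : L.IsSubfork ∨ L.IsStarFork ∨ L.IsFork) (hB : B = L)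
      (hh : ∀ v ∈ L.verts, h v = L.leaves.indicator 1 v)
  | pfork (l x y : V) (hL : L.IsPForkOn l x y) (hB : B = L)
      (hh : ∀ v ∈ L.verts, h v = ({l, x, y} : Set V).indicator 1 v)
  | bigFork (j : ℕ) (C : Set V) (hL : PGraph.IsBigForkWith j L C)
      (D : SimpleGraph V) (X : Set V)
      (hD : ∀ u v, D.Adj u v → u ∈ L.verts ∧ v ∈ L.verts ∧ ¬ L.Adj u v)
      (hDD : ∀ u v w, D.Adj u v → D.Adj u w → v = w) (hDX : ∀ u v, D.Adj u v → u ∉ X)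
      (hBv : B.verts = L.verts) (hBa : ∀ u v, B.Adj u v ↔ L.Adj u v ∨ D.Adj u v)
      (hh : ∀ v ∈ L.verts, h v = C.indicator 1 v + X.indicator 1 v)
      (hdeg : ∀ v ∈ L.verts, B.deg v + h v ≤ 3)

/-- `G'` is obtained from `G` by addition of a bold `L`: the half-edges become edges (the pairs in
`J`) to pairwise distinct vertices of degree two of `G`. -/
def PGraph.IsAddition {V : Type*} (G L G' : PGraph V) : Prop :=
  ∃ (B : PGraph V) (h : V → ℕ) (J : Set (V × V)), L.IsBold B h ∧ Disjoint G.verts L.verts ∧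
    (∀ p ∈ J, p.1 ∈ L.verts ∧ p.2 ∈ G.verts ∧ G.deg p.2 = 2) ∧
    (∀ v ∈ L.verts, {t | (v, t) ∈ J}.encard = h v) ∧
    (∀ p ∈ J, ∀ q ∈ J, p.2 = q.2 → p = q) ∧
    G'.verts = G.verts ∪ L.verts ∧
    ∀ u v, G'.Adj u v ↔ G.Adj u v ∨ B.Adj u v ∨ (u, v) ∈ J ∨ (v, u) ∈ J

/-- `G'` is obtained from `G` by replacing a vertex `v` by a triangle on new vertices `a`, `b`, `c`:
the edges at `v` are redirected, by `f`, to pairwise distinct vertices of the triangle. -/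
def PGraph.IsYDelta {V : Type*} (G G' : PGraph V) : Prop :=
  ∃ (v a b c : V) (f : V → V), v ∈ G.verts ∧ [a, b, c].Nodup ∧ (∀ t ∈ [a, b, c], t ∉ G.verts) ∧
    (∀ u, G.Adj v u → f u ∈ [a, b, c]) ∧ (∀ u w, G.Adj v u → G.Adj v w → f u = f w → u = w) ∧
    G'.verts = (G.verts \ {v}) ∪ {t | t ∈ [a, b, c]} ∧
    ∀ s t, G'.Adj s t ↔ (G.Adj s t ∧ s ≠ v ∧ t ≠ v) ∨
      (s ∈ [a, b, c] ∧ t ∈ [a, b, c] ∧ s ≠ t) ∨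
      (G.Adj v t ∧ s = f t) ∨ (G.Adj v s ∧ t = f s)

/-- `G 0, …, G n` is a building sequence. The `i`-th step (`1 ≤ i ≤ n`) is the addition of a bold
`K` if `L i = some K`, and a Y-Δ or Δ-Y transformation if `L i = none`. -/
structure IsBuildingSequence {V : Type*} (n : ℕ) (G : ℕ → PGraph V) (L : ℕ → Option (PGraph V)) :
    Prop where
  start : (G 0).IsTriangle
  twoConnected : ∀ i ≤ n, (G i).IsTwoConnected
  addition : ∀ i < n, ∀ K, L (i + 1) = some K → (G i).IsAddition K (G (i + 1))
  transformation : ∀ i < n, L (i + 1) = none →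
    (G i).IsYDelta (G (i + 1)) ∨ (G (i + 1)).IsYDelta (G i)
  fork_once : ∀ i j, 1 ≤ i → i ≤ n → 1 ≤ j → j ≤ n → ∀ K K', L i = some K → L j = some K' →
    K.IsFork → K'.IsFork → i = j

/-! ### Mixed graphs and safe reductions -/

/-- A mixed graph; `E` carries the vertex set and the edges, `arcs` is the set of directed edges. -/
structure MixedGraph (V : Type*) where
  E : PGraph V
  arcs : Set (V × V)
  arcs_mem : ∀ a ∈ arcs, a.1 ∈ E.verts ∧ a.2 ∈ E.verts
  arcs_ne : ∀ a ∈ arcs, a.1 ≠ a.2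
  deg_two_or_three : ∀ v ∈ E.verts, E.deg v = 2 ∨ E.deg v = 3
  deg_two : ∀ v ∈ E.verts, E.deg v = 2 → (∃! u, (v, u) ∈ arcs) ∧ ∃! u, (u, v) ∈ arcs

/-- A cubic graph, as a mixed graph without arcs. -/
def MixedGraph.ofCubic {V : Type*} (G : PGraph V) (hG : G.IsCubic) : MixedGraph V where
  E := G
  arcs := ∅
  arcs_mem := by simp
  arcs_ne := by simp
  deg_two_or_three v hv := Or.inr (hG v hv)
  deg_two v hv h := by have := hG v hv; omega

/-- A directed edge; `isArc` tells the arcs of the mixed graph from the arcs that replace edges. -/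
structure Piece (V : Type*) where
  src : V
  tgt : V
  isArc : Bool

/-- The set `A_S ∪ A'`: the arcs incident to `S`, and two opposite arcs for each edge incident
to `S`. -/
def MixedGraph.pieces {V : Type*} (M : MixedGraph V) (S : Set V) : Set (Piece V) :=
  {p | (p.src ∈ S ∨ p.tgt ∈ S) ∧
    ((p.isArc = true ∧ (p.src, p.tgt) ∈ M.arcs) ∨ (p.isArc = false ∧ M.E.Adj p.src p.tgt))}

/-- The directed edges in the list `l` form, in this order, a walk from `u` to `v`. -/
def IsPieceWalk {V : Type*} : V → List (Piece V) → V → Prop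
  | u, [], v => u = v
  | u, p :: l, v => p.src = u ∧ IsPieceWalk p.tgt l v

/-- A safe directed path from `u` to `v`: no vertex is repeated, both ends lie outside `S`, it only
passes through vertices of `S`, and at most one of its directed edges is in `A_S`. -/
structure MixedGraph.IsSafePath {V : Type*} (M : MixedGraph V) (S : Set V)
    (u : V) (l : List (Piece V)) (v : V) : Prop where
  mem : ∀ p ∈ l, p ∈ M.pieces S
  walk : IsPieceWalk u l v
  ne_nil : l ≠ []
  nodup : (u :: l.map Piece.tgt).Nodup
  left : u ∉ S
  right : v ∉ S
  inner : ∀ w ∈ (l.map Piece.tgt).dropLast, w ∈ S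
  arc_le_one : l.countP Piece.isArc ≤ 1

/-- A safe directed cycle, listed from some vertex on: no vertex is repeated, it only passes through
vertices of `S`, at most one of its directed edges is in `A_S`, and it is not a 2-cycle
composed of directed edges from `A'` only. -/
structure MixedGraph.IsSafeCycle {V : Type*} (M : MixedGraph V) (S : Set V)
    (l : List (Piece V)) : Prop where
  mem : ∀ p ∈ l, p ∈ M.pieces S
  walk : ∃ u, IsPieceWalk u l u
  ne_nil : l ≠ []
  nodup : (l.map Piece.tgt).Nodup
  inner : ∀ w ∈ l.map Piece.tgt, w ∈ S
  arc_le_one : l.countP Piece.isArc ≤ 1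
  not_two_cycle : ¬ (l.length = 2 ∧ l.countP Piece.isArc = 0)

/-- `M'` is obtained from `M` by a safe reduction of the set `S`: there is a partition of
`A_S ∪ A'` into a set `P` of safe paths and a set `C` of safe cycles, and `M'` arises by replacing
each path in `P` by an arc between its ends and deleting `S`. -/
def MixedGraph.IsSafeReduction {V : Type*} (M : MixedGraph V) (S : Set V) (M' : MixedGraph V) :
    Prop :=
  S ⊆ M.E.verts ∧ ∃ P C : Set (List (Piece V)),
    (∀ l ∈ P, ∃ u v, M.IsSafePath S u l v) ∧ (∀ l ∈ C, M.IsSafeCycle S l) ∧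
    (∀ p ∈ M.pieces S, ∃! l, l ∈ P ∪ C ∧ p ∈ l) ∧
    M'.E = M.E.deleteVerts S ∧
    M'.arcs = {a | a ∈ M.arcs ∧ a.1 ∉ S ∧ a.2 ∉ S} ∪ {a | ∃ l ∈ P, M.IsSafePath S a.1 l a.2}

def MixedGraph.CanBeSafelyReduced {V : Type*} (M : MixedGraph V) (S : Set V) : Prop :=
  ∃ M', M.IsSafeReduction S M'

/-! ### Cut-obstacles -/

/-- The edges with exactly one end in `S`. -/
def MixedGraph.cutEdges {V : Type*} (M : MixedGraph V) (S : Set V) : Set (Sym2 V) :=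
  {e | e ∈ M.E.edgeSet ∧ ∃ u ∈ S, ∃ v ∉ S, e = s(u, v)}

/-- The arcs with exactly one end in `S`. -/
def MixedGraph.cutArcs {V : Type*} (M : MixedGraph V) (S : Set V) : Set (V × V) :=
  {a | a ∈ M.arcs ∧ ((a.1 ∈ S ∧ a.2 ∉ S) ∨ (a.1 ∉ S ∧ a.2 ∈ S))}

/-- `S` is a cut-obstacle: there is no set `P` of pairs of distinct elements of `E_S ∪ A_S` such
that each element of `E_S` is in exactly two pairs, each element of `A_S` is in exactly one pair,
and no pair consists of two arcs. -/
def MixedGraph.IsCutObstacle {V : Type*} (M : MixedGraph V) (S : Set V) : Prop :=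
  ¬ ∃ P : Set (Sym2 (Sym2 V ⊕ V × V)),
    (∀ p ∈ P, ¬ p.IsDiag ∧ ∀ x ∈ p, (∃ e ∈ M.cutEdges S, x = Sum.inl e) ∨
      ∃ a ∈ M.cutArcs S, x = Sum.inr a) ∧
    (∀ e ∈ M.cutEdges S, {p ∈ P | Sum.inl e ∈ p}.encard = 2) ∧
    (∀ a ∈ M.cutArcs S, {p ∈ P | Sum.inr a ∈ p}.encard = 1) ∧
    ∀ a b, s(Sum.inr a, Sum.inr b) ∉ P

/-!
Only the edges of `G i`, and the fact that all arcs of the reduced graph `M'` end at vertices of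
degree two of `G i` (`MixedGraph.IsSafeReduction.deg_of_arc`), matter for what follows. So one is
given a member `K` of the fork-collection that is attached by its half-edges to distinct vertices
without arcs, and such that every vertex of `K` of degree two has one incoming and one outgoing arc,
whose other ends are arbitrary. The directed edges at `K` have to be partitioned into safe paths
and cycles (`Reducible`); the mixed graph that results is then determined, and it satisfies the
degree conditions because each joined vertex keeps just one path in either direction
(`Attachment.canBeSafelyReduced`).

*Small members.* Choose at each vertex of `K` in which of the two cyclic ways a walk passes through
it; a vertex of degree two passes walks on to its arcs. These choices cut the directed edges at `K`
into arcless routes between half-edges and arcs, and the arcs join the routes to walks. All is well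
if each arc either closes up a route to a cycle, or has routes on either side that go to the outside
and are disjoint (`Routing.Compatible`). Whether this holds depends only on which ends of the arcs
in `K` are joined to each other, so there are finitely many cases for each graph, and
`Template.check` verifies that in each case one of a few choices works. This settles the dot, the
subfork, the star fork and the p-fork. For the fork it works if all arcs at it lie inside it. That
is always so: before the fork is added, there are at most three vertices of degree two
(`IsBuildingSequence.ncard_twos`), since no addition except that of the fork increases their number,
and a big fork would need four of them; so the fork is joined to all of them.

*Big forks.* A big fork is reducible as soon as some arc joins two of its vertices
(`BigForkData.reducible`). For `1`-big-forks, this is again a finite check. For larger ones, let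
`B` arise from `B'` by attaching a star fork `T`. Reduce `T` first, in such a way that an arc
inside `B'` results; then reduce `B'` by induction and compose. A suitable reduction of `T` exists
by a finite check unless the only arcs inside `B` join the two leaves of `T` that are attached to
`B'`. In that case `T` can be crossed by an arcless path that enters `B'`. Such a path may be
treated as an edge. So join it to an arc that leaves `B'`, which gives an auxiliary arc inside `B'`,
apply the induction hypothesis, and cut the auxiliary arc again (`Host.exists_cut`): since one of
the two parts begins with an edge, no path or cycle gets too many arcs.

*Bold big forks.* Treat the additional edges, and the half-edges outside the connecting set, as
pairs of opposite arcs. A reduction remains one when these arcs are declared to be edges again. If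
there is an additional edge or an arc inside `K`, the previous result applies, and an additional
half-edge is an arc that counts as an edge, so that an auxiliary arc can be used as before. In the
remaining case all arcs leave `K`, and the cut consists of one edge for each vertex of the
connecting set `C` and of two arcs for each vertex of a set `W` with more elements than `C`. Each
arc has to be paired with an edge and each edge can take two arcs, so `K` is a cut-obstacle
(`BoldHost.isCutObstacle`).
-/

/-! ### Partitions of sets of directed edges into safe paths and cycles -/

section Walks
variable {V : Type*}

theorem isPieceWalk_append {u v : V} {l m : List (Piece V)} :
    IsPieceWalk u (l ++ m) v ↔ ∃ w, IsPieceWalk u l w ∧ IsPieceWalk w m v := by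
  induction l generalizing u with
  | nil => simp [IsPieceWalk]
  | cons p l ih => simp [IsPieceWalk, ih, and_assoc]

theorem IsPieceWalk.tgt_eq {u v : V} {l : List (Piece V)} {q : Piece V}
    (h : IsPieceWalk u (l ++ [q]) v) : q.tgt = v := by
  obtain ⟨w, -, h⟩ := isPieceWalk_append.1 h
  exact h.2

theorem IsPieceWalk.unique {u v w : V} {l : List (Piece V)} (h : IsPieceWalk u l v)
    (h' : IsPieceWalk u l w) : v = w := by
  induction l generalizing u with
  | nil => exact h.symm.trans h'
  | cons p l ih => exact ih h.2 h'.2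

theorem IsPieceWalk.start_unique {u u' v v' : V} {l : List (Piece V)} (hl : l ≠ [])
    (h : IsPieceWalk u l v) (h' : IsPieceWalk u' l v') : u = u' := by
  cases l with
  | nil => exact absurd rfl hl
  | cons p l => exact h.1.symm.trans h'.1

/-- The source of a step of a walk is the start or the target of an earlier step. -/
theorem IsPieceWalk.src_mem {u v : V} {a b : List (Piece V)} {p : Piece V}
    (h : IsPieceWalk u (a ++ p :: b) v) :
    (a = [] ∧ p.src = u) ∨ ∃ a' q, a = a' ++ [q] ∧ q.tgt = p.src := by
  rcases List.eq_nil_or_concat a with rfl | ⟨a', q, rfl⟩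
  · exact Or.inl ⟨rfl, h.1⟩
  · right
    obtain ⟨w, h1, h2⟩ := isPieceWalk_append.1 h
    rw [List.concat_eq_append] at h1
    exact ⟨a', q, by simp, h1.tgt_eq.trans h2.1.symm⟩

theorem mem_dropLast_of_append {α : Type*} {a b : List α} {x y : α} :
    x ∈ (a ++ x :: y :: b).dropLast := by
  rw [List.dropLast_append_of_ne_nil (by simp)]
  simp

theorem IsPieceWalk.src_start_or_inner {u v : V} {l : List (Piece V)} {p : Piece V}
    (h : IsPieceWalk u l v) (hp : p ∈ l) :
    (∃ m, l = p :: m ∧ p.src = u) ∨ p.src ∈ (l.map Piece.tgt).dropLast := by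
  obtain ⟨a, b, rfl⟩ := List.append_of_mem hp
  rcases h.src_mem with ⟨rfl, h1⟩ | ⟨a', q, rfl, h1⟩
  · exact Or.inl ⟨b, rfl, h1⟩
  · right
    rw [← h1]
    simp only [List.append_assoc, List.map_append, List.map_cons, List.cons_append,
      List.nil_append]
    exact mem_dropLast_of_append

theorem IsPieceWalk.tgt_end_or_inner {u v : V} {l : List (Piece V)} {p : Piece V}
    (h : IsPieceWalk u l v) (hp : p ∈ l) :
    (∃ m, l = m ++ [p] ∧ p.tgt = v) ∨ p.tgt ∈ (l.map Piece.tgt).dropLast := by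
  obtain ⟨a, b, rfl⟩ := List.append_of_mem hp
  cases b with
  | nil => exact Or.inl ⟨a, rfl, h.tgt_eq⟩
  | cons q b =>
    right
    simp only [List.map_append, List.map_cons]
    exact mem_dropLast_of_append

/-- In a closed walk every source is also a target. -/
theorem IsPieceWalk.src_mem_tgt {u : V} {l : List (Piece V)} {p : Piece V}
    (h : IsPieceWalk u l u) (hp : p ∈ l) : p.src ∈ l.map Piece.tgt := by
  rcases h.src_start_or_inner hp with ⟨m, rfl, h1⟩ | h1
  · rw [h1]
    rcases List.eq_nil_or_concat m with rfl | ⟨m', q, rfl⟩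
    · simp [h.2.symm]
    · have : q.tgt = u := by
        refine IsPieceWalk.tgt_eq (l := p :: m') (u := u) ?_
        simpa using h
      simp [this]
  · exact List.mem_of_mem_dropLast h1

end Walks

section Partitions
variable {V : Type*}

/-- The directed edges that touch `S`, when `E` is the adjacency relation of the edges and `A` is
the relation given by the arcs. -/
def piecesOf (E A : V → V → Prop) (S : Set V) : Set (Piece V) :=
  {p | (p.src ∈ S ∨ p.tgt ∈ S) ∧
    ((p.isArc = true ∧ A p.src p.tgt) ∨ (p.isArc = false ∧ E p.src p.tgt))}

/-- A safe directed path through `S` all of whose steps are taken from `Q`. -/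
structure SafePath (Q : Set (Piece V)) (S : Set V) (u : V) (l : List (Piece V)) (v : V) :
    Prop where
  mem : ∀ p ∈ l, p ∈ Q
  walk : IsPieceWalk u l v
  ne_nil : l ≠ []
  nodup : (u :: l.map Piece.tgt).Nodup
  left : u ∉ S
  right : v ∉ S
  inner : ∀ w ∈ (l.map Piece.tgt).dropLast, w ∈ S
  arc_le_one : l.countP Piece.isArc ≤ 1

/-- A safe directed cycle in `S` all of whose steps are taken from `Q`. -/
structure SafeCycle (Q : Set (Piece V)) (S : Set V) (l : List (Piece V)) : Prop where
  mem : ∀ p ∈ l, p ∈ Q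
  walk : ∃ u, IsPieceWalk u l u
  ne_nil : l ≠ []
  nodup : (l.map Piece.tgt).Nodup
  inner : ∀ w ∈ l.map Piece.tgt, w ∈ S
  arc_le_one : l.countP Piece.isArc ≤ 1
  not_two_cycle : ¬ (l.length = 2 ∧ l.countP Piece.isArc = 0)

/-- `P` and `C` are sets of safe paths and of safe cycles that partition `Q`. -/
structure SafePartition (Q : Set (Piece V)) (S : Set V) (P C : Set (List (Piece V))) : Prop where
  path : ∀ l ∈ P, ∃ u v, SafePath Q S u l v
  cycle : ∀ l ∈ C, SafeCycle Q S l
  cover : ∀ p ∈ Q, ∃ l ∈ P ∪ C, p ∈ l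
  unique : ∀ p, ∀ l ∈ P ∪ C, ∀ l' ∈ P ∪ C, p ∈ l → p ∈ l' → l = l'

theorem SafePath.src_notMem {Q : Set (Piece V)} {S : Set V} {u v : V} {l : List (Piece V)}
    (h : SafePath Q S u l v) {p : Piece V} (hp : p ∈ l) (hS : p.src ∉ S) :
    (∃ m, l = p :: m) ∧ p.src = u := by
  rcases h.walk.src_start_or_inner hp with ⟨m, h1, h2⟩ | h1
  · exact ⟨⟨m, h1⟩, h2⟩
  · exact absurd (h.inner _ h1) hS

theorem SafePath.tgt_notMem {Q : Set (Piece V)} {S : Set V} {u v : V} {l : List (Piece V)}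
    (h : SafePath Q S u l v) {p : Piece V} (hp : p ∈ l) (hS : p.tgt ∉ S) :
    (∃ m, l = m ++ [p]) ∧ p.tgt = v := by
  rcases h.walk.tgt_end_or_inner hp with ⟨m, h1, h2⟩ | h1
  · exact ⟨⟨m, h1⟩, h2⟩
  · exact absurd (h.inner _ h1) hS

theorem SafePath.exists_first {Q : Set (Piece V)} {S : Set V} {u v : V} {l : List (Piece V)}
    (h : SafePath Q S u l v) : ∃ p ∈ l, p.src = u := by
  cases l with
  | nil => exact absurd rfl h.ne_nil
  | cons p l => exact ⟨p, by simp, h.walk.1⟩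

theorem SafePath.exists_last {Q : Set (Piece V)} {S : Set V} {u v : V} {l : List (Piece V)}
    (h : SafePath Q S u l v) : ∃ p ∈ l, p.tgt = v := by
  rcases List.eq_nil_or_concat l with rfl | ⟨m, q, rfl⟩
  · exact absurd rfl h.ne_nil
  · have := h.walk
    rw [List.concat_eq_append] at this
    exact ⟨q, by simp, this.tgt_eq⟩

theorem SafePath.ne {Q : Set (Piece V)} {S : Set V} {u v : V} {l : List (Piece V)}
    (h : SafePath Q S u l v) : u ≠ v := by
  obtain ⟨p, hp, rfl⟩ := h.exists_last
  intro h1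
  exact (List.nodup_cons.1 h.nodup).1 (h1 ▸ List.mem_map_of_mem hp)

variable {Q : Set (Piece V)} {S : Set V} {P C : Set (List (Piece V))}

theorem SafePartition.mem_piece (h : SafePartition Q S P C) {l : List (Piece V)} (hl : l ∈ P ∪ C)
    {p : Piece V} (hp : p ∈ l) : p ∈ Q := by
  rcases hl with hl | hl
  · obtain ⟨u, v, h1⟩ := h.path l hl
    exact h1.mem p hp
  · exact (h.cycle l hl).mem p hp

theorem SafePartition.arc_le_one (h : SafePartition Q S P C) {l : List (Piece V)}
    (hl : l ∈ P ∪ C) : l.countP Piece.isArc ≤ 1 := by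
  rcases hl with hl | hl
  · obtain ⟨u, v, h1⟩ := h.path l hl
    exact h1.arc_le_one
  · exact (h.cycle l hl).arc_le_one

theorem SafePartition.nodup_tgt (h : SafePartition Q S P C) {l : List (Piece V)}
    (hl : l ∈ P ∪ C) : (l.map Piece.tgt).Nodup := by
  rcases hl with hl | hl
  · obtain ⟨u, v, h1⟩ := h.path l hl
    exact (List.nodup_cons.1 h1.nodup).2
  · exact (h.cycle l hl).nodup

theorem SafePartition.exists_path_src (h : SafePartition Q S P C) {p : Piece V} (hp : p ∈ Q)
    (hS : p.src ∉ S) : ∃ l ∈ P, p ∈ l ∧ ∃ v, SafePath Q S p.src l v := by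
  obtain ⟨l, hl | hl, hpl⟩ := h.cover p hp
  · obtain ⟨u, v, h1⟩ := h.path l hl
    obtain ⟨-, h2⟩ := h1.src_notMem hpl hS
    exact ⟨l, hl, hpl, v, h2 ▸ h1⟩
  · obtain ⟨u, h1⟩ := (h.cycle l hl).walk
    exact absurd ((h.cycle l hl).inner _ (h1.src_mem_tgt hpl)) hS

theorem SafePartition.exists_path_tgt (h : SafePartition Q S P C) {p : Piece V} (hp : p ∈ Q)
    (hS : p.tgt ∉ S) : ∃ l ∈ P, p ∈ l ∧ ∃ u, SafePath Q S u l p.tgt := by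
  obtain ⟨l, hl | hl, hpl⟩ := h.cover p hp
  · obtain ⟨u, v, h1⟩ := h.path l hl
    obtain ⟨-, h2⟩ := h1.tgt_notMem hpl hS
    exact ⟨l, hl, hpl, u, h2 ▸ h1⟩
  · exact absurd ((h.cycle l hl).inner _ (List.mem_map_of_mem hpl)) hS

theorem SafePath.end_unique {u v u' v' : V} {l : List (Piece V)} (h : SafePath Q S u l v)
    (h' : SafePath Q S u' l v') : u = u' ∧ v = v' := by
  have h1 := h.walk.start_unique h.ne_nil h'.walk
  subst h1
  exact ⟨rfl, h.walk.unique h'.walk⟩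

theorem countP_isArc_eq_one_of_mem {l : List (Piece V)} {p q : Piece V}
    (hl : l.countP Piece.isArc ≤ 1) (hp : p ∈ l) (hq : q ∈ l) (hpa : p.isArc = true)
    (hqa : q.isArc = true) : p = q := by
  by_contra hne
  obtain ⟨a, b, rfl⟩ := List.append_of_mem hp
  have : q ∈ a ∨ q ∈ b := by
    rcases List.mem_append.1 hq with h | h
    · exact Or.inl h
    · rcases List.mem_cons.1 h with h | h
      · exact absurd h.symm hne
      · exact Or.inr h
  simp only [List.countP_append, List.countP_cons, hpa, if_true] at hl
  rcases this with h | h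
  · have := List.countP_pos_iff.2 ⟨q, h, hqa⟩
    omega
  · have := List.countP_pos_iff.2 ⟨q, h, hqa⟩
    omega

theorem IsPieceWalk.flatMap {φ : Piece V → List (Piece V)} {u v : V} {l : List (Piece V)}
    (h : IsPieceWalk u l v) (hφ : ∀ p ∈ l, IsPieceWalk p.src (φ p) p.tgt) :
    IsPieceWalk u (l.flatMap φ) v := by
  induction l generalizing u with
  | nil => exact h
  | cons p l ih =>
    rw [List.flatMap_cons, isPieceWalk_append]
    refine ⟨p.tgt, ?_, ih h.2 fun q hq => hφ q (by simp [hq])⟩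
    rw [← h.1]
    exact hφ p (by simp)

theorem countP_flatMap_le {φ : Piece V → List (Piece V)} {l : List (Piece V)}
    (hφ : ∀ p ∈ l, (φ p).countP Piece.isArc ≤ if p.isArc then 1 else 0) :
    (l.flatMap φ).countP Piece.isArc ≤ l.countP Piece.isArc := by
  induction l with
  | nil => simp
  | cons p l ih =>
    rw [List.flatMap_cons, List.countP_append, List.countP_cons]
    have h1 := hφ p (by simp)
    have h2 := ih fun q hq => hφ q (by simp [hq])
    omega

/-- Replacing each directed edge `p` of a safe partition by a path `φ p` through a set `R` that is
disjoint from `S`. The lists in `P₀` and `C₀` make up for what lies in no `φ p`. -/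
theorem SafePartition.subst {Q Q' : Set (Piece V)} {S R : Set V} {P C P₀ C₀ : Set (List (Piece V))}
    (h : SafePartition Q S P C) (φ : Piece V → List (Piece V))
    (hSR : Disjoint S R)
    (hout : ∀ p ∈ Q, p.src ∉ R ∧ p.tgt ∉ R)
    (hwalk : ∀ p ∈ Q, IsPieceWalk p.src (φ p) p.tgt)
    (hne : ∀ p ∈ Q, φ p ≠ [])
    (hinner : ∀ p ∈ Q, ∀ w ∈ ((φ p).map Piece.tgt).dropLast, w ∈ R)
    (hnodup : ∀ p ∈ Q, ((φ p).map Piece.tgt).Nodup)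
    (hcount : ∀ p ∈ Q, (φ p).countP Piece.isArc ≤ if p.isArc then 1 else 0)
    (hdisj : ∀ l ∈ P ∪ C, ∀ p ∈ l, ∀ q ∈ l, p ≠ q →
      ∀ w ∈ ((φ p).map Piece.tgt).dropLast, w ∉ ((φ q).map Piece.tgt).dropLast)
    (htwo : ∀ l ∈ C, ¬ ((l.flatMap φ).length = 2 ∧ (l.flatMap φ).countP Piece.isArc = 0))
    (hmem : ∀ p ∈ Q, ∀ q ∈ φ p, q ∈ Q')
    (hP₀ : ∀ l ∈ P₀, ∃ u v, SafePath Q' (S ∪ R) u l v)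
    (hC₀ : ∀ l ∈ C₀, SafeCycle Q' (S ∪ R) l)
    (hcover : ∀ q ∈ Q', (∃ p ∈ Q, q ∈ φ p) ∨ ∃ l ∈ P₀ ∪ C₀, q ∈ l)
    (huniq : ∀ p ∈ Q, ∀ p' ∈ Q, ∀ q, q ∈ φ p → q ∈ φ p' → p = p')
    (huniq₁ : ∀ p ∈ Q, ∀ l ∈ P₀ ∪ C₀, ∀ q ∈ φ p, q ∉ l)
    (huniq₂ : ∀ l ∈ P₀ ∪ C₀, ∀ l' ∈ P₀ ∪ C₀, ∀ q, q ∈ l → q ∈ l' → l = l') :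
    SafePartition Q' (S ∪ R) ((fun l => l.flatMap φ) '' P ∪ P₀)
      ((fun l => l.flatMap φ) '' C ∪ C₀) := by
  have hSR' : ∀ v ∈ S, v ∉ R := fun v h1 h2 => Set.disjoint_left.1 hSR h1 h2
  -- a target of `φ p` is the target of `p` or lies in `R`
  have htgt : ∀ p ∈ Q, ∀ q ∈ φ p, q.tgt = p.tgt ∨ q.tgt ∈ ((φ p).map Piece.tgt).dropLast := by
    intro p hp q hq
    rcases (hwalk p hp).tgt_end_or_inner hq with ⟨m, -, h1⟩ | h1
    · exact Or.inl h1
    · exact Or.inr h1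
  have hnod : ∀ l ∈ P ∪ C, ((l.flatMap φ).map Piece.tgt).Nodup := by
    intro l hl
    have hlQ : ∀ p ∈ l, p ∈ Q := fun p hp => h.mem_piece hl hp
    rw [List.map_flatMap, List.nodup_flatMap]
    refine ⟨fun p hp => hnodup p (hlQ p hp), ?_⟩
    have hpw : l.Pairwise fun p q => p.tgt ≠ q.tgt := List.pairwise_map.1 (h.nodup_tgt hl)
    refine hpw.imp_of_mem fun {p q} hp hq hpq => ?_
    rw [Function.onFun, List.disjoint_left]
    intro w hw1 hw2
    obtain ⟨a, ha, rfl⟩ := List.mem_map.1 hw1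
    obtain ⟨b, hb, hab⟩ := List.mem_map.1 hw2
    have h1 := htgt p (hlQ p hp) a ha
    have h2 := htgt q (hlQ q hq) b hb
    rw [hab] at h2
    rcases h1 with h1 | h1 <;> rcases h2 with h2 | h2
    · exact hpq (h1.symm.trans h2)
    · exact (hout p (hlQ p hp)).2 (h1 ▸ hinner q (hlQ q hq) _ h2)
    · exact (hout q (hlQ q hq)).2 (h2 ▸ hinner p (hlQ p hp) _ h1)
    · exact hdisj l hl p hp q hq (fun h => hpq (h ▸ rfl)) _ h1 h2
  have hdrop : ∀ l : List (Piece V), (∀ p ∈ l, p ∈ Q) →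
      (∀ w ∈ (l.map Piece.tgt).dropLast, w ∈ S) →
      ∀ w ∈ ((l.flatMap φ).map Piece.tgt).dropLast, w ∈ S ∪ R := by
    intro l
    induction l with
    | nil => simp
    | cons p l ih =>
      intro hlQ hS w hw
      have hpQ := hlQ p (by simp)
      rw [List.flatMap_cons, List.map_append] at hw
      rcases eq_or_ne l [] with rfl | hl
      · simp only [List.flatMap_nil, List.map_nil, List.append_nil] at hw
        exact Or.inr (hinner p hpQ w hw)
      · obtain ⟨q, l', rfl⟩ := List.exists_cons_of_ne_nil hl
        have hne' : ((q :: l').flatMap φ).map Piece.tgt ≠ [] := by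
          have := hne q (hlQ q (by simp))
          simp [this]
        rw [List.dropLast_append_of_ne_nil hne'] at hw
        rw [List.map_cons, List.map_cons, List.dropLast_cons_cons] at hS
        rcases List.mem_append.1 hw with hw | hw
        · obtain ⟨a, ha, rfl⟩ := List.mem_map.1 hw
          rcases htgt p hpQ a ha with h1 | h1
          · exact Or.inl (h1 ▸ hS _ (by simp))
          · exact Or.inr (hinner p hpQ _ h1)
        · exact ih (fun p hp => hlQ p (by simp [hp]))
            (fun w hw => hS w (List.mem_cons_of_mem _ (by simpa using hw))) w hw
  have hall : ∀ l ∈ P ∪ C, ∀ q ∈ l.flatMap φ, q ∈ Q' := by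
    intro l hl q hq
    obtain ⟨p, hp, hq⟩ := List.mem_flatMap.1 hq
    exact hmem p (h.mem_piece hl hp) q hq
  have hnil : ∀ l ∈ P ∪ C, l ≠ [] → l.flatMap φ ≠ [] := by
    intro l hl hl' h0
    obtain ⟨p, l', rfl⟩ := List.exists_cons_of_ne_nil hl'
    rw [List.flatMap_cons, List.append_eq_nil_iff] at h0
    exact hne p (h.mem_piece hl (by simp)) h0.1
  have hcnt : ∀ l ∈ P ∪ C, (l.flatMap φ).countP Piece.isArc ≤ 1 := fun l hl =>
    (countP_flatMap_le fun p hp => hcount p (h.mem_piece hl hp)).trans (h.arc_le_one hl)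
  refine ⟨?_, ?_, ?_, ?_⟩
  · rintro _ (⟨l, hl, rfl⟩ | hl)
    · obtain ⟨u, v, hp⟩ := h.path l hl
      have huR : u ∉ R := by
        obtain ⟨p, hp1, hp2⟩ := hp.exists_first
        exact hp2 ▸ (hout p (hp.mem p hp1)).1
      have hvR : v ∉ R := by
        obtain ⟨p, hp1, hp2⟩ := hp.exists_last
        exact hp2 ▸ (hout p (hp.mem p hp1)).2
      refine ⟨u, v, hall l (Or.inl hl),
        hp.walk.flatMap fun p hp1 => hwalk p (hp.mem p hp1), hnil l (Or.inl hl) hp.ne_nil,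
        List.nodup_cons.2 ⟨?_, hnod l (Or.inl hl)⟩, fun h1 => h1.elim hp.left huR,
        fun h1 => h1.elim hp.right hvR, hdrop l hp.mem hp.inner, hcnt l (Or.inl hl)⟩
      intro h1
      obtain ⟨a, ha, hau⟩ := List.mem_map.1 h1
      obtain ⟨p, hpl, ha⟩ := List.mem_flatMap.1 ha
      rcases htgt p (hp.mem p hpl) a ha with h2 | h2
      · exact (List.nodup_cons.1 hp.nodup).1 (hau ▸ h2 ▸ List.mem_map_of_mem hpl)
      · exact huR (hau ▸ hinner p (hp.mem p hpl) _ h2)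
    · exact hP₀ _ hl
  · rintro _ (⟨l, hl, rfl⟩ | hl)
    · have hp := h.cycle l hl
      obtain ⟨u, hu⟩ := hp.walk
      refine ⟨hall l (Or.inr hl), ⟨u, hu.flatMap fun p hp1 => hwalk p (hp.mem p hp1)⟩,
        hnil l (Or.inr hl) hp.ne_nil, hnod l (Or.inr hl), ?_, hcnt l (Or.inr hl), htwo l hl⟩
      intro w hw
      obtain ⟨a, ha, rfl⟩ := List.mem_map.1 hw
      obtain ⟨p, hpl, ha⟩ := List.mem_flatMap.1 ha
      rcases htgt p (hp.mem p hpl) a ha with h2 | h2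
      · exact Or.inl (h2 ▸ hp.inner _ (List.mem_map_of_mem hpl))
      · exact Or.inr (hinner p (hp.mem p hpl) _ h2)
    · exact hC₀ _ hl
  · intro q hq
    rcases hcover q hq with ⟨p, hp, hqp⟩ | ⟨l, hl | hl, hql⟩
    · obtain ⟨l, hl | hl, hpl⟩ := h.cover p hp
      · exact ⟨_, Or.inl (Or.inl ⟨l, hl, rfl⟩), List.mem_flatMap.2 ⟨p, hpl, hqp⟩⟩
      · exact ⟨_, Or.inr (Or.inl ⟨l, hl, rfl⟩), List.mem_flatMap.2 ⟨p, hpl, hqp⟩⟩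
    · exact ⟨l, Or.inl (Or.inr hl), hql⟩
    · exact ⟨l, Or.inr (Or.inr hl), hql⟩
  · have key : ∀ l, l ∈ ((fun l => l.flatMap φ) '' P ∪ P₀) ∪ ((fun l => l.flatMap φ) '' C ∪ C₀) →
        (∃ m ∈ P ∪ C, l = m.flatMap φ) ∨ l ∈ P₀ ∪ C₀ := by
      rintro l ((⟨m, hm, rfl⟩ | hl) | (⟨m, hm, rfl⟩ | hl))
      · exact Or.inl ⟨m, Or.inl hm, rfl⟩
      · exact Or.inr (Or.inl hl)
      · exact Or.inl ⟨m, Or.inr hm, rfl⟩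
      · exact Or.inr (Or.inr hl)
    intro q l hl l' hl' hql hql'
    rcases key l hl with ⟨m, hm, rfl⟩ | h1 <;> rcases key l' hl' with ⟨m', hm', rfl⟩ | h2
    · obtain ⟨p, hp, hqp⟩ := List.mem_flatMap.1 hql
      obtain ⟨p', hp', hqp'⟩ := List.mem_flatMap.1 hql'
      have := huniq p (h.mem_piece hm hp) p' (h.mem_piece hm' hp') q hqp hqp'
      subst this
      rw [h.unique p m hm m' hm' hp hp']
    · obtain ⟨p, hp, hqp⟩ := List.mem_flatMap.1 hql
      exact absurd hql' (huniq₁ p (h.mem_piece hm hp) l' h2 q hqp)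
    · obtain ⟨p, hp, hqp⟩ := List.mem_flatMap.1 hql'
      exact absurd hql (huniq₁ p (h.mem_piece hm' hp) l h1 q hqp)
    · exact huniq₂ l h1 l' h2 q hql hql'

end Partitions

/-! ### Relabelling, composing and cutting partitions -/

section Operations
variable {V : Type*}

/-- Forgetting that some of the directed edges are arcs. -/
theorem SafePartition.relabel {Q Q' : Set (Piece V)} {S : Set V} {P C : Set (List (Piece V))}
    (h : SafePartition Q S P C) (g : Piece V → Piece V) (hsrc : ∀ p, (g p).src = p.src)
    (htgt : ∀ p, (g p).tgt = p.tgt) (harc : ∀ p, (g p).isArc = true → p.isArc = true)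
    (hinj : Set.InjOn g Q) (hQ' : Q' = g '' Q)
    (htwo : ∀ p ∈ Q, ∀ q ∈ Q, p.isArc = true → q.isArc = false → p.src ∈ S → p.tgt ∈ S →
      p.tgt = q.src → q.tgt = p.src → (g p).isArc = true) :
    ∃ P C, SafePartition Q' S P C := by
  have := h.subst (Q' := Q') (R := ∅) (P₀ := ∅) (C₀ := ∅) (fun p => [g p]) (by simp) (by simp)
    (fun p _ => ⟨hsrc p, htgt p⟩) (by simp) (by simp) (by simp)
    (fun p _ => by
      by_cases h1 : (g p).isArc = true
      · simp [h1, harc p h1]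
      · simp [h1]) (by simp) ?_ ?_ (by simp) (by simp) ?_ ?_ (by simp) (by simp)
  · rw [Set.union_empty] at this
    exact ⟨_, _, this⟩
  · intro l hl ⟨h1, h2⟩
    rw [← List.map_eq_flatMap] at h1 h2
    rw [List.length_map] at h1
    obtain ⟨p, q, rfl⟩ := List.length_eq_two.1 h1
    have hc := h.cycle _ hl
    obtain ⟨u, hu⟩ := hc.walk
    have hpQ := hc.mem p (by simp)
    have hqQ := hc.mem q (by simp)
    obtain ⟨h3, h4⟩ : (g p).isArc = false ∧ (g q).isArc = false := by
      simpa using h2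
    have h5 : p.isArc = true ∨ q.isArc = true := by
      by_contra h6
      push Not at h6
      exact hc.not_two_cycle ⟨rfl, by simp [h6]⟩
    have hpair : p.tgt = q.src ∧ q.tgt = p.src := ⟨hu.2.1.symm, hu.2.2.trans hu.1.symm⟩
    have h6 : ∀ r ∈ [p, q], r.tgt ∈ S := fun r hr => hc.inner _ (List.mem_map_of_mem hr)
    have h7 := h6 p (by simp)
    have h8 := h6 q (by simp)
    have h9 : ¬ (p.isArc = true ∧ q.isArc = true) := fun h9 => by
      have := hc.arc_le_one
      simp [h9.1, h9.2] at this
    rcases h5 with h5 | h5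
    · have := htwo p hpQ q hqQ h5 (by simpa [h5] using h9) (hpair.2 ▸ h8) h7 hpair.1 hpair.2
      simp_all
    · have := htwo q hqQ p hpQ h5 (by simpa [h5] using h9) (hpair.1 ▸ h7) h8 hpair.2 hpair.1
      simp_all
  · intro p hp q hq
    rw [List.mem_singleton.1 hq, hQ']
    exact ⟨p, hp, rfl⟩
  · intro q hq
    rw [hQ'] at hq
    obtain ⟨p, hp, rfl⟩ := hq
    exact Or.inl ⟨p, hp, by simp⟩
  · intro p hp p' hp' q hq hq'
    rw [List.mem_singleton] at hq hq'
    exact hinj hp hp' (hq.symm.trans hq')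

/-- Two successive reductions, first of `T` and then of `S`, make up a reduction of `S ∪ T`. The
elements of `Q₁` that are not in `Q` stand for the paths of the first reduction. -/
theorem SafePartition.comp {Q Q₁ : Set (Piece V)} {S T : Set V} {P₁ C₁ P₂ C₂ : Set (List (Piece V))}
    (hST : Disjoint S T)
    (h₂ : SafePartition {q ∈ Q | q.src ∈ T ∨ q.tgt ∈ T} T P₂ C₂) (h₁ : SafePartition Q₁ S P₁ C₁)
    (hold : ∀ q ∈ Q, q.src ∉ T → q.tgt ∉ T → q ∈ Q₁)
    (hnew : ∀ p ∈ Q₁, (p ∈ Q ∧ p.src ∉ T ∧ p.tgt ∉ T) ∨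
      ∃ l ∈ P₂, SafePath {q ∈ Q | q.src ∈ T ∨ q.tgt ∈ T} T p.src l p.tgt ∧
        l.countP Piece.isArc ≤ if p.isArc then 1 else 0)
    (hpath : ∀ l ∈ P₂, ∀ a b, SafePath {q ∈ Q | q.src ∈ T ∨ q.tgt ∈ T} T a l b → a ∈ S ∨ b ∈ S →
      ∃ p ∈ Q₁, ¬ (p ∈ Q ∧ p.src ∉ T ∧ p.tgt ∉ T) ∧ p.src = a ∧ p.tgt = b)
    (huniq₁ : ∀ p ∈ Q₁, ∀ p' ∈ Q₁, ¬ (p ∈ Q ∧ p.src ∉ T ∧ p.tgt ∉ T) →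
      ¬ (p' ∈ Q ∧ p'.src ∉ T ∧ p'.tgt ∉ T) → p.src = p'.src → p.tgt = p'.tgt → p = p')
    (huniq₂ : ∀ l ∈ P₂, ∀ l' ∈ P₂, ∀ a b, a ∈ S ∨ b ∈ S →
      SafePath {q ∈ Q | q.src ∈ T ∨ q.tgt ∈ T} T a l b →
      SafePath {q ∈ Q | q.src ∈ T ∨ q.tgt ∈ T} T a l' b → l = l')
    (hQ₁ : ∀ p ∈ Q₁, p.src ∈ S ∨ p.tgt ∈ S)
    (hdisj : ∀ l ∈ P₁ ∪ C₁, ∀ p ∈ l, ∀ q ∈ l, ¬ (p ∈ Q ∧ p.src ∉ T ∧ p.tgt ∉ T) →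
      ¬ (q ∈ Q ∧ q.src ∉ T ∧ q.tgt ∉ T) → p = q) :
    ∃ P C, SafePartition Q (S ∪ T) P C := by
  classical
  set Q₂ := {q ∈ Q | q.src ∈ T ∨ q.tgt ∈ T} with hQ₂
  set old : Piece V → Prop := fun p => p ∈ Q ∧ p.src ∉ T ∧ p.tgt ∉ T with hold'
  have hex : ∀ p : Piece V, ∃ l, old p ∧ l = [p] ∨ ¬ old p ∧ (p ∈ Q₁ → l ∈ P₂ ∧
      SafePath Q₂ T p.src l p.tgt ∧ l.countP Piece.isArc ≤ if p.isArc then 1 else 0) := by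
    intro p
    by_cases hp : old p
    · exact ⟨[p], Or.inl ⟨hp, rfl⟩⟩
    · by_cases hp1 : p ∈ Q₁
      · rcases hnew p hp1 with h | ⟨l, hl, h⟩
        · exact absurd h hp
        · exact ⟨l, Or.inr ⟨hp, fun _ => ⟨hl, h⟩⟩⟩
      · exact ⟨[], Or.inr ⟨hp, fun h => absurd h hp1⟩⟩
  choose φ hφ using hex
  have hφo : ∀ p, old p → φ p = [p] := fun p hp => by
    rcases hφ p with ⟨-, h⟩ | ⟨h, -⟩
    · exact h
    · exact absurd hp h
  have hφn : ∀ p ∈ Q₁, ¬ old p → φ p ∈ P₂ ∧ SafePath Q₂ T p.src (φ p) p.tgt ∧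
      (φ p).countP Piece.isArc ≤ if p.isArc then 1 else 0 := fun p hp h => by
    rcases hφ p with ⟨h', -⟩ | ⟨-, h'⟩
    · exact absurd h' h
    · exact h' hp
  have hlong : ∀ p ∈ Q₁, ¬ old p → 2 ≤ (φ p).length := by
    intro p hp h
    obtain ⟨-, h1, -⟩ := hφn p hp h
    by_contra h2
    have h3 : (φ p).length = 1 := by
      have := List.length_pos_of_ne_nil h1.ne_nil
      omega
    obtain ⟨q, hq⟩ := List.length_eq_one_iff.1 h3
    rw [hq] at h1
    have h4 := h1.walk
    have h5 := (h1.mem q (by simp)).2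
    rcases h5 with h5 | h5
    · exact h1.left (h4.1 ▸ h5)
    · exact h1.right (h4.2 ▸ h5)
  have hφQ : ∀ p ∈ Q₁, ∀ q ∈ φ p, q ∈ Q ∧ (old q ↔ old p) := by
    intro p hp q hq
    by_cases h : old p
    · rw [hφo p h, List.mem_singleton] at hq
      subst hq
      exact ⟨h.1, Iff.rfl⟩
    · have := (hφn p hp h).2.1.mem q hq
      refine ⟨this.1, fun h1 => ?_, fun h1 => absurd h1 h⟩
      rcases this.2 with h2 | h2
      · exact absurd h2 h1.2.1
      · exact absurd h2 h1.2.2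
  set P₀ : Set (List (Piece V)) := {l ∈ P₂ | ∃ a b, SafePath Q₂ T a l b ∧ a ∉ S ∧ b ∉ S} with hP₀
  have hleft : ∀ l ∈ P₀ ∪ C₂, l ∈ P₂ ∪ C₂ := by
    rintro l (hl | hl)
    · exact Or.inl hl.1
    · exact Or.inr hl
  refine ⟨_, _, h₁.subst (Q' := Q) (R := T) (P₀ := P₀) (C₀ := C₂) φ hST ?_ ?_ ?_ ?_ ?_ ?_ ?_ ?_ ?_
    ?_ ?_ ?_ ?_ ?_ ?_⟩
  · intro p hp
    by_cases h : old p
    · exact h.2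
    · exact ⟨(hφn p hp h).2.1.left, (hφn p hp h).2.1.right⟩
  · intro p hp
    by_cases h : old p
    · rw [hφo p h]
      exact ⟨rfl, rfl⟩
    · exact (hφn p hp h).2.1.walk
  · intro p hp
    by_cases h : old p
    · simp [hφo p h]
    · exact (hφn p hp h).2.1.ne_nil
  · intro p hp
    by_cases h : old p
    · simp [hφo p h]
    · exact (hφn p hp h).2.1.inner
  · intro p hp
    by_cases h : old p
    · simp [hφo p h]
    · exact (List.nodup_cons.1 (hφn p hp h).2.1.nodup).2
  · intro p hp
    by_cases h : old p
    · rw [hφo p h, List.countP_singleton]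
    · exact (hφn p hp h).2.2
  · intro l hl p hp q hq hpq w hw hw'
    by_cases h : old p
    · simp [hφo p h] at hw
    by_cases h' : old q
    · simp [hφo q h'] at hw'
    exact hpq (hdisj l hl p hp q hq h h')
  · rintro l hl ⟨h1, h2⟩
    by_cases hall : ∀ p ∈ l, old p
    · have : l.flatMap φ = l :=
        (List.flatMap_congr fun p hp => hφo p (hall p hp)).trans (List.flatMap_singleton' l)
      rw [this] at h1 h2
      exact (h₁.cycle l hl).not_two_cycle ⟨h1, h2⟩
    · push Not at hall
      obtain ⟨p, hp, hpo⟩ := hall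
      have hpQ := (h₁.cycle l hl).mem p hp
      obtain ⟨a, b, rfl⟩ := List.append_of_mem hp
      rw [List.flatMap_append, List.flatMap_cons, List.length_append, List.length_append] at h1
      have h3 := hlong p hpQ hpo
      have hz : ∀ m : List (Piece V), (∀ q ∈ m, q ∈ Q₁) → (m.flatMap φ).length = 0 → m = [] := by
        intro m hm h4
        cases m with
        | nil => rfl
        | cons q m =>
          have hq := hm q (by simp)
          rw [List.flatMap_cons, List.length_append] at h4
          have : (φ q).length ≠ 0 := by
            by_cases h : old q
            · simp [hφo q h]
            · have := hlong q hq h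
              omega
          omega
      have ha := hz a (fun q hq => (h₁.cycle _ hl).mem q (by simp [hq])) (by omega)
      have hb := hz b (fun q hq => (h₁.cycle _ hl).mem q (by simp [hq])) (by omega)
      subst ha hb
      obtain ⟨u, hu⟩ := (h₁.cycle _ hl).walk
      exact (hφn p hpQ hpo).2.1.ne (hu.1.trans hu.2.symm)
  · exact fun p hp q hq => (hφQ p hp q hq).1
  · rintro l ⟨hl, a, b, h1, ha, hb⟩
    refine ⟨a, b, fun p hp => (h1.mem p hp).1, h1.walk, h1.ne_nil, h1.nodup,
      fun h => h.elim ha h1.left, fun h => h.elim hb h1.right, fun w hw => Or.inr (h1.inner w hw),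
      h1.arc_le_one⟩
  · intro l hl
    have h1 := h₂.cycle l hl
    exact ⟨fun p hp => (h1.mem p hp).1, h1.walk, h1.ne_nil, h1.nodup,
      fun w hw => Or.inr (h1.inner w hw), h1.arc_le_one, h1.not_two_cycle⟩
  · intro q hq
    by_cases h : q.src ∈ T ∨ q.tgt ∈ T
    · obtain ⟨l, hl | hl, hql⟩ := h₂.cover q ⟨hq, h⟩
      · obtain ⟨a, b, hab⟩ := h₂.path l hl
        by_cases hS : a ∈ S ∨ b ∈ S
        · obtain ⟨p, hp, hpo, hpa, hpb⟩ := hpath l hl a b hab hS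
          subst hpa hpb
          left
          refine ⟨p, hp, ?_⟩
          rwa [huniq₂ _ (hφn p hp hpo).1 l hl _ _ hS (hφn p hp hpo).2.1 hab]
        · push Not at hS
          exact Or.inr ⟨l, Or.inl ⟨hl, a, b, hab, hS⟩, hql⟩
      · exact Or.inr ⟨l, Or.inr hl, hql⟩
    · push Not at h
      exact Or.inl ⟨q, hold q hq h.1 h.2, by simp [hφo q ⟨hq, h⟩]⟩
  · intro p hp p' hp' q hq hq'
    have h1 := (hφQ p hp q hq).2
    have h2 := (hφQ p' hp' q hq').2
    by_cases h : old q
    · rw [hφo p (h1.1 h), List.mem_singleton] at hq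
      rw [hφo p' (h2.1 h), List.mem_singleton] at hq'
      exact hq.symm.trans hq'
    · have h3 := hφn p hp fun h' => h (h1.2 h')
      have h4 := hφn p' hp' fun h' => h (h2.2 h')
      have h5 := h₂.unique q _ (Or.inl h3.1) _ (Or.inl h4.1) hq hq'
      obtain ⟨h6, h7⟩ := h3.2.1.end_unique (h5 ▸ h4.2.1)
      exact huniq₁ p hp p' hp' (fun h' => h (h1.2 h')) (fun h' => h (h2.2 h')) h6 h7
  · intro p hp l hl q hq hql
    have h1 := (hφQ p hp q hq).2
    have hq2 := h₂.mem_piece (hleft l hl) hql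
    have hqo : ¬ old q := fun h => hq2.2.elim h.2.1 h.2.2
    have h3 := hφn p hp fun h' => hqo (h1.2 h')
    have h5 := h₂.unique q _ (Or.inl h3.1) _ (hleft l hl) hq hql
    rcases hl with ⟨-, a, b, hab, ha, hb⟩ | hl
    · obtain ⟨h6, h7⟩ := h3.2.1.end_unique (h5 ▸ hab)
      rcases hQ₁ p hp with h8 | h8
      · exact ha (h6 ▸ h8)
      · exact hb (h7 ▸ h8)
    · have h6 := h₂.cycle l hl
      obtain ⟨a, ha, hap⟩ := h3.2.1.exists_last
      exact h3.2.1.right (hap ▸ h6.inner _ (List.mem_map_of_mem (h5 ▸ ha)))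
  · exact fun l hl l' hl' q hq hq' => h₂.unique q l (hleft l hl) l' (hleft l' hl') hq hq'

/-- A safe partition that uses an arc `f` from `s` to `w` inside `S` yields a safe partition for
the situation where `f` is replaced by an arc leaving `S` at `s` and an edge entering `S` at `w`:
a cycle through `f` becomes a path, and a path through `f` falls apart into two paths. -/
theorem SafePartition.cut {Q : Set (Piece V)} {S : Set V} {P C : Set (List (Piece V))}
    {f p₁ p₂ : Piece V} (h : SafePartition (insert f Q) S P C) (hf : f ∉ Q) (hfa : f.isArc = true)
    (hs : f.src ∈ S) (hw : f.tgt ∈ S) (h1s : p₁.src = f.src) (h1t : p₁.tgt ∉ S)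
    (h2t : p₂.tgt = f.tgt) (h2s : p₂.src ∉ S) (hne : p₂.src ≠ p₁.tgt) (h1 : p₁ ∉ Q) (h2 : p₂ ∉ Q)
    (h2a : p₂.isArc = false)
    (hsrc : ∀ q ∈ Q, q.isArc = false → q.src ∉ S → q.src ≠ p₁.tgt)
    (htgt : ∀ q ∈ Q, q.isArc = false → q.tgt ∉ S → q.tgt ≠ p₂.src) :
    ∃ P C, SafePartition (insert p₁ (insert p₂ Q)) S P C ∧
      ∀ l ∈ P ∪ C, p₂ ∈ l → ∀ q ∈ l, q.isArc = true → q = p₁ := by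
  have h12 : p₁ ≠ p₂ := fun h => h2s (by rw [← h, h1s]; exact hs)
  set Q' : Set (Piece V) := insert p₁ (insert p₂ Q) with hQ'
  obtain ⟨l₀, hl₀, hfl⟩ := h.cover f (by simp)
  -- the other lists are untouched
  have hother : ∀ l ∈ P ∪ C, l ≠ l₀ → f ∉ l := fun l hl hne' hfl' =>
    hne' (h.unique f l hl l₀ hl₀ hfl' hfl)
  have hmemQ : ∀ l ∈ P ∪ C, ∀ q ∈ l, q ≠ f → q ∈ Q := fun l hl q hq hqf =>
    (h.mem_piece hl hq).resolve_left hqf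
  have hQQ' : ∀ q ∈ Q, q ∈ Q' := fun q hq => Or.inr (Or.inr hq)
  obtain ⟨a, b, rfl⟩ := List.append_of_mem hfl
  have hnodup := h.nodup_tgt hl₀
  have hcount := h.arc_le_one hl₀
  rw [List.countP_append, List.countP_cons_of_pos (by exact hfa)] at hcount
  have ha0 : a.countP Piece.isArc = 0 := by omega
  have hb0 : b.countP Piece.isArc = 0 := by omega
  rw [List.countP_eq_zero] at ha0 hb0
  have hfa' : f ∉ a := fun h => ha0 f h hfa
  have hfb' : f ∉ b := fun h => hb0 f h hfa
  have haQ : ∀ q ∈ a, q ∈ Q := fun q hq => hmemQ _ hl₀ q (by simp [hq]) fun h => hfa' (h ▸ hq)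
  have hbQ : ∀ q ∈ b, q ∈ Q := fun q hq => hmemQ _ hl₀ q (by simp [hq]) fun h => hfb' (h ▸ hq)
  -- it suffices to partition the members of the list through `f`, together with `p₁` and `p₂`
  suffices hsuff : ∃ P₀ : Set (List (Piece V)), (∀ l ∈ P₀, ∃ u v, SafePath Q' S u l v) ∧
      (∀ l ∈ P₀, ∀ q ∈ l, q ∈ a ∨ q ∈ b ∨ q = p₁ ∨ q = p₂) ∧
      (∀ q, q ∈ a ∨ q ∈ b ∨ q = p₁ ∨ q = p₂ → ∃ l ∈ P₀, q ∈ l) ∧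
      (∀ q, ∀ l ∈ P₀, ∀ l' ∈ P₀, q ∈ l → q ∈ l' → l = l') by
    obtain ⟨P₀, hp1, hp2, hp3, hp4⟩ := hsuff
    have hsplit : ∀ l ∈ ((P \ {a ++ f :: b}) ∪ P₀) ∪ (C \ {a ++ f :: b}),
        (l ∈ P ∪ C ∧ l ≠ a ++ f :: b) ∨ l ∈ P₀ := by
      rintro l ((hl | hl) | hl)
      · exact Or.inl ⟨Or.inl hl.1, hl.2⟩
      · exact Or.inr hl
      · exact Or.inl ⟨Or.inr hl.1, hl.2⟩
    have hsep : ∀ l ∈ P ∪ C, l ≠ a ++ f :: b → ∀ q ∈ l, ¬ (q ∈ a ∨ q ∈ b ∨ q = p₁ ∨ q = p₂) := by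
      intro l hl hne' q hq hq'
      have hqQ : q ∈ Q := hmemQ l hl q hq fun h => hother l hl hne' (h ▸ hq)
      rcases hq' with h3 | h3 | rfl | rfl
      · exact hne' (h.unique q l hl _ hl₀ hq (by simp [h3]))
      · exact hne' (h.unique q l hl _ hl₀ hq (by simp [h3]))
      · exact h1 hqQ
      · exact h2 hqQ
    refine ⟨(P \ {a ++ f :: b}) ∪ P₀, C \ {a ++ f :: b}, ⟨?_, ?_, ?_, ?_⟩, ?_⟩
    · rintro l (⟨hl, hne'⟩ | hl)
      · obtain ⟨u, v, h3⟩ := h.path l hl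
        exact ⟨u, v, fun q hq => hQQ' q (hmemQ l (Or.inl hl) q hq
          fun h => hother l (Or.inl hl) hne' (h ▸ hq)), h3.walk, h3.ne_nil, h3.nodup, h3.left,
          h3.right, h3.inner, h3.arc_le_one⟩
      · exact hp1 l hl
    · rintro l ⟨hl, hne'⟩
      have h3 := h.cycle l hl
      exact ⟨fun q hq => hQQ' q (hmemQ l (Or.inr hl) q hq
        fun h => hother l (Or.inr hl) hne' (h ▸ hq)), h3.walk, h3.ne_nil, h3.nodup, h3.inner,
        h3.arc_le_one, h3.not_two_cycle⟩
    · intro q hq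
      by_cases hq' : q ∈ a ∨ q ∈ b ∨ q = p₁ ∨ q = p₂
      · obtain ⟨l, hl, hql⟩ := hp3 q hq'
        exact ⟨l, Or.inl (Or.inr hl), hql⟩
      · push Not at hq'
        have hqQ : q ∈ Q := (hq.resolve_left hq'.2.2.1).resolve_left hq'.2.2.2
        obtain ⟨l, hl, hql⟩ := h.cover q (Or.inr hqQ)
        have hne' : l ≠ a ++ f :: b := by
          rintro rfl
          rcases List.mem_append.1 hql with h3 | h3
          · exact hq'.1 h3
          · rcases List.mem_cons.1 h3 with rfl | h3
            · exact hf hqQ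
            · exact hq'.2.1 h3
        rcases hl with hl | hl
        · exact ⟨l, Or.inl (Or.inl ⟨hl, hne'⟩), hql⟩
        · exact ⟨l, Or.inr ⟨hl, hne'⟩, hql⟩
    · intro q l hl l' hl' hq hq'
      rcases hsplit l hl with ⟨h3, h4⟩ | h3 <;> rcases hsplit l' hl' with ⟨h5, h6⟩ | h5
      · exact h.unique q l h3 l' h5 hq hq'
      · exact absurd (hp2 l' h5 q hq') (hsep l h3 h4 q hq)
      · exact absurd (hp2 l h3 q hq) (hsep l' h5 h6 q hq')
      · exact hp4 q l h3 l' h5 hq hq'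
    · intro l hl hql q hq hqa
      rcases hsplit l hl with ⟨h3, h4⟩ | h3
      · exact absurd (Or.inr (Or.inr (Or.inr rfl))) (hsep l h3 h4 p₂ hql)
      · rcases hp2 l h3 q hq with h5 | h5 | h5 | h5
        · exact absurd hqa (ha0 q h5)
        · exact absurd hqa (hb0 q h5)
        · exact h5
        · rw [h5, h2a] at hqa
          exact absurd hqa (by simp)
  have hcnta : a.countP Piece.isArc = 0 := List.countP_eq_zero.2 ha0
  have hcntb : b.countP Piece.isArc = 0 := List.countP_eq_zero.2 hb0
  rcases hl₀ with hl₀ | hl₀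
  · obtain ⟨u, v, h3⟩ := h.path _ hl₀
    obtain ⟨s, hwa, hsf, hwb⟩ := isPieceWalk_append.1 h3.walk
    have hnd := h3.nodup
    have hbne : b ≠ [] := by
      rintro rfl
      exact h3.right (h3.walk.tgt_eq ▸ hw)
    have hane : a ≠ [] := by
      rintro rfl
      have : u = s := hwa
      exact h3.left (this ▸ hsf ▸ hs)
    have hu : ∃ q ∈ Q, q.isArc = false ∧ q.src = u := by
      obtain ⟨q, a', rfl⟩ := List.exists_cons_of_ne_nil hane
      exact ⟨q, haQ q (by simp), by simpa using ha0 q (by simp), hwa.1⟩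
    have hv : ∃ q ∈ Q, q.isArc = false ∧ q.tgt = v := by
      rcases List.eq_nil_or_concat b with rfl | ⟨b', q, rfl⟩
      · exact absurd rfl hbne
      · rw [List.concat_eq_append] at hwb hbQ hb0
        exact ⟨q, hbQ q (by simp), by simpa using hb0 q (by simp), hwb.tgt_eq⟩
    obtain ⟨qu, hqu, hqua, rfl⟩ := hu
    obtain ⟨qv, hqv, hqva, rfl⟩ := hv
    have hinner : (∀ w ∈ a.map Piece.tgt, w ∈ S) ∧ ∀ w ∈ (b.map Piece.tgt).dropLast, w ∈ S := by
      have h4 := h3.inner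
      rw [List.map_append, List.map_cons, List.dropLast_append_of_ne_nil (by simp),
        List.dropLast_cons_of_ne_nil (by simpa using hbne)] at h4
      exact ⟨fun w hw => h4 w (List.mem_append_left _ hw),
        fun w hw => h4 w (List.mem_append_right _ (List.mem_cons_of_mem _ hw))⟩
    simp only [List.map_append, List.map_cons] at hnd
    have hnd1 : (qu.src :: a.map Piece.tgt).Nodup :=
      (List.nodup_append.1 (by rw [← List.cons_append] at hnd; exact hnd)).1
    have hnd2 : (f.tgt :: b.map Piece.tgt).Nodup :=
      (List.nodup_append.1 (by rw [← List.cons_append] at hnd; exact hnd)).2.1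
    refine ⟨{a ++ [p₁], p₂ :: b}, ?_, ?_, ?_, ?_⟩
    · rintro l (rfl | rfl)
      · refine ⟨qu.src, p₁.tgt, ?_, ?_, by simp, ?_, h3.left, h1t, ?_, ?_⟩
        · intro q hq
          rcases List.mem_append.1 hq with hq | hq
          · exact hQQ' q (haQ q hq)
          · exact Or.inl (List.mem_singleton.1 hq)
        · exact isPieceWalk_append.2 ⟨s, hwa, h1s.trans hsf, rfl⟩
        · rw [List.map_append, ← List.cons_append, List.nodup_append]
          refine ⟨hnd1, by simp, ?_⟩
          intro x hx y hy
          rw [List.map_cons, List.map_nil, List.mem_singleton] at hy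
          subst hy
          rcases List.mem_cons.1 hx with rfl | hx
          · exact hsrc qu hqu hqua h3.left
          · exact fun h => h1t (h ▸ hinner.1 x hx)
        · simpa using hinner.1
        · rw [List.countP_append, hcnta, zero_add]
          exact List.countP_le_length
      · refine ⟨p₂.src, qv.tgt, ?_, ⟨rfl, h2t ▸ hwb⟩, by simp, ?_, h2s, h3.right, ?_, ?_⟩
        · intro q hq
          rcases List.mem_cons.1 hq with rfl | hq
          · exact Or.inr (Or.inl rfl)
          · exact hQQ' q (hbQ q hq)
        · rw [List.map_cons, h2t, List.nodup_cons]
          refine ⟨fun hx => ?_, hnd2⟩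
          rcases List.mem_cons.1 hx with hx | hx
          · exact h2s (hx ▸ hw)
          · obtain ⟨q, hq, hqx⟩ := List.mem_map.1 hx
            rcases hwb.tgt_end_or_inner hq with ⟨-, -, h4⟩ | h4
            · exact htgt qv hqv hqva h3.right (h4.symm.trans hqx)
            · exact h2s (hqx ▸ hinner.2 _ h4)
        · rw [List.map_cons, List.dropLast_cons_of_ne_nil (by simpa using hbne), h2t]
          intro x hx
          rcases List.mem_cons.1 hx with rfl | hx
          · exact hw
          · exact hinner.2 x hx
        · rw [List.countP_cons_of_neg (by simp [h2a]), hcntb]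
          exact zero_le_one
    · rintro l (rfl | rfl) q hq
      · rcases List.mem_append.1 hq with hq | hq
        · exact Or.inl hq
        · exact Or.inr (Or.inr (Or.inl (List.mem_singleton.1 hq)))
      · rcases List.mem_cons.1 hq with hq | hq
        · exact Or.inr (Or.inr (Or.inr hq))
        · exact Or.inr (Or.inl hq)
    · rintro q (hq | hq | rfl | rfl)
      · exact ⟨_, Or.inl rfl, by simp [hq]⟩
      · exact ⟨_, Or.inr rfl, by simp [hq]⟩
      · exact ⟨_, Or.inl rfl, by simp⟩
      · exact ⟨_, Or.inr rfl, by simp⟩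
    · have hab : ∀ q ∈ a, q ∉ b := by
        intro q hq hq'
        rw [List.map_append, List.map_cons] at hnodup
        exact (List.nodup_append.1 hnodup).2.2 _ (List.mem_map_of_mem hq) _
          (List.mem_cons_of_mem _ (List.mem_map_of_mem hq')) rfl
      have hboth : ∀ q, q ∈ a ++ [p₁] → q ∉ p₂ :: b := by
        intro q hq hq'
        rcases List.mem_append.1 hq with hq | hq <;> rcases List.mem_cons.1 hq' with hq' | hq'
        · exact h2 (hq' ▸ haQ q hq)
        · exact hab q hq hq'
        · exact h12 ((List.mem_singleton.1 hq).symm.trans hq')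
        · exact h1 (List.mem_singleton.1 hq ▸ hbQ q hq')
      rintro q l (rfl | rfl) l' (rfl | rfl) hq hq'
      · rfl
      · exact absurd hq' (hboth q hq)
      · exact absurd hq (hboth q hq')
      · rfl
  · have h3 := h.cycle _ hl₀
    obtain ⟨u, hu⟩ := h3.walk
    obtain ⟨s, hwa, hsf, hwb⟩ := isPieceWalk_append.1 hu
    have hin : ∀ x ∈ (b ++ a).map Piece.tgt, x ∈ S := by
      intro x hx
      apply h3.inner
      simp only [List.map_append, List.mem_append, List.map_cons, List.mem_cons] at hx ⊢
      tauto
    have hnd : (f.tgt :: (b ++ a).map Piece.tgt).Nodup := by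
      have : (((f :: b) ++ a).map Piece.tgt).Nodup := by
        refine (List.Perm.nodup_iff ?_).2 hnodup
        exact List.Perm.map _ List.perm_append_comm
      simpa using this
    refine ⟨{p₂ :: (b ++ a) ++ [p₁]}, ?_, ?_, ?_, ?_⟩
    · rintro l rfl
      refine ⟨p₂.src, p₁.tgt, ?_, ?_, by simp, ?_, h2s, h1t, ?_, ?_⟩
      · intro q hq
        simp only [List.cons_append, List.mem_cons, List.mem_append, List.not_mem_nil,
          or_false] at hq
        rcases hq with rfl | (hq | hq) | rfl
        · exact Or.inr (Or.inl rfl)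
        · exact hQQ' q (hbQ q hq)
        · exact hQQ' q (haQ q hq)
        · exact Or.inl rfl
      · refine isPieceWalk_append.2 ⟨s, ⟨rfl, isPieceWalk_append.2 ⟨u, h2t ▸ hwb, hwa⟩⟩, ?_⟩
        exact ⟨h1s.trans hsf, rfl⟩
      · rw [List.map_append, List.map_cons, ← List.cons_append, List.nodup_append]
        refine ⟨?_, by simp, ?_⟩
        · rw [h2t, List.nodup_cons]
          refine ⟨fun hx => ?_, hnd⟩
          rcases List.mem_cons.1 hx with hx | hx
          · exact h2s (hx ▸ hw)
          · exact h2s (hin _ hx)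
        · intro x hx y hy
          rw [List.map_cons, List.map_nil, List.mem_singleton] at hy
          subst hy
          rcases List.mem_cons.1 hx with rfl | hx
          · exact hne
          · rcases List.mem_cons.1 hx with rfl | hx
            · exact fun h => h1t (h ▸ h2t ▸ hw)
            · exact fun h => h1t (h ▸ hin x hx)
      · rw [List.map_append, List.map_cons, List.map_cons, List.map_nil, List.dropLast_concat]
        intro x hx
        rcases List.mem_cons.1 hx with rfl | hx
        · exact h2t ▸ hw
        · exact hin x hx
      · rw [List.countP_append, List.countP_cons_of_neg (by simp [h2a]), List.countP_append, hcnta,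
          hcntb, zero_add, zero_add]
        exact List.countP_le_length
    · rintro l rfl q hq
      simp only [List.cons_append, List.mem_cons, List.mem_append, List.not_mem_nil,
          or_false] at hq
      tauto
    · intro q hq
      refine ⟨_, rfl, ?_⟩
      simp only [List.cons_append, List.mem_cons, List.mem_append, List.not_mem_nil,
          or_false]
      tauto
    · rintro q l rfl l' rfl - -
      rfl

end Operations

/-! ### Joining routes along edges by arcs -/

section Routing
variable {V : Type*}

/-- The steps, along edges, between consecutive members of a list of vertices. -/
def edgePieces : List V → List (Piece V)
  | a :: b :: l => ⟨a, b, false⟩ :: edgePieces (b :: l)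
  | _ => []

theorem edgePieces_walk {u w : V} {l : List V} (h : (u :: l).getLast? = some w) :
    IsPieceWalk u (edgePieces (u :: l)) w := by
  induction l generalizing u with
  | nil => simpa [edgePieces, IsPieceWalk] using h
  | cons b l ih =>
    refine ⟨rfl, ih ?_⟩
    rwa [List.getLast?_cons_cons] at h

theorem map_tgt_edgePieces (u : V) (l : List V) :
    (edgePieces (u :: l)).map Piece.tgt = l := by
  induction l generalizing u with
  | nil => rfl
  | cons b l ih => simp [edgePieces, ih]

theorem isArc_of_mem_edgePieces {l : List V} {p : Piece V} (h : p ∈ edgePieces l) :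
    p.isArc = false := by
  induction l with
  | nil => simp [edgePieces] at h
  | cons a l ih =>
    cases l with
    | nil => simp [edgePieces] at h
    | cons b l =>
      rcases List.mem_cons.1 h with rfl | h
      · rfl
      · exact ih h

theorem countP_edgePieces (l : List V) : (edgePieces l).countP Piece.isArc = 0 := by
  rw [List.countP_eq_zero]
  intro p hp
  simp [isArc_of_mem_edgePieces hp]

theorem edgePieces_ne_nil {l : List V} (h : 2 ≤ l.length) : edgePieces l ≠ [] := by
  rcases l with _ | ⟨a, _ | ⟨b, l⟩⟩ <;> simp [edgePieces] at h ⊢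

/-- A set `Sg` of routes that use each edge at `S` once in each direction. A route runs through
`S`, and each of its ends is outside `S` or in `W`. -/
structure Routing (E : V → V → Prop) (S W : Set V) (Sg : Set (List V)) : Prop where
  nodup : ∀ l ∈ Sg, l.Nodup
  two_le : ∀ l ∈ Sg, 2 ≤ l.length
  inner : ∀ l ∈ Sg, ∀ v ∈ l.tail.dropLast, v ∈ S
  head : ∀ l ∈ Sg, ∀ v ∈ S, l.head? = some v → v ∈ W
  last : ∀ l ∈ Sg, ∀ v ∈ S, l.getLast? = some v → v ∈ W
  mem : ∀ l ∈ Sg, ∀ p ∈ edgePieces l, (p.src ∈ S ∨ p.tgt ∈ S) ∧ E p.src p.tgt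
  cover : ∀ a b, a ∈ S ∨ b ∈ S → E a b → ∃ l ∈ Sg, ⟨a, b, false⟩ ∈ edgePieces l
  unique : ∀ p, ∀ l ∈ Sg, ∀ l' ∈ Sg, p ∈ edgePieces l → p ∈ edgePieces l' → l = l'

/-- A description of how arcs meet a routing: `arr s` is the route that ends at `s`, and `dep s` is
the one that starts at `s`; both consist of `s` alone if `s` is not in `S`. Following an arc
from `s` to `t`, one comes back to the same route, or one gets from the outside to the outside
without repeating a vertex. -/
structure Routing.Compatible (A : V → V → Prop) (S W : Set V) (Sg : Set (List V))
    (arr dep : V → List V) : Prop where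
  arr_mem : ∀ s ∈ W, arr s ∈ Sg
  arr_last : ∀ s, (s ∈ S → s ∈ W) → (arr s).getLast? = some s
  arr_unique : ∀ s ∈ W, ∀ l ∈ Sg, l.getLast? = some s → l = arr s
  arr_out : ∀ s, s ∉ S → arr s = [s]
  dep_mem : ∀ s ∈ W, dep s ∈ Sg
  dep_head : ∀ s, (s ∈ S → s ∈ W) → (dep s).head? = some s
  dep_unique : ∀ s ∈ W, ∀ l ∈ Sg, l.head? = some s → l = dep s
  dep_out : ∀ s, s ∉ S → dep s = [s]
  sub : ∀ s ∈ W, s ∈ S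
  arc_mem : ∀ a b, A a b → (a ∈ S → a ∈ W) ∧ (b ∈ S → b ∈ W)
  out : ∀ s ∈ W, ∃! t, A s t
  inn : ∀ s ∈ W, ∃! t, A t s
  joins : ∀ s t, A s t → s ∈ S ∨ t ∈ S → (s ∈ S ∧ t ∈ S ∧ arr s = dep t) ∨
    ((∀ v, (arr s).head? = some v → v ∉ S) ∧ (∀ v, (dep t).getLast? = some v → v ∉ S) ∧
      ∀ v ∈ arr s, v ∉ dep t)

variable {E A : V → V → Prop} {S W : Set V} {Sg : Set (List V)} {arr dep : V → List V}

/-- The arc from `s` to `t`, preceded by the route that ends at `s` and followed by the route that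
starts at `t`. -/
def joinedPath (arr dep : V → List V) (s t : V) : List (Piece V) :=
  edgePieces (arr s) ++ ⟨s, t, true⟩ :: edgePieces (dep t)

theorem mem_joinedPath {s t : V} {p : Piece V} : p ∈ joinedPath arr dep s t ↔
    p ∈ edgePieces (arr s) ∨ p = ⟨s, t, true⟩ ∨ p ∈ edgePieces (dep t) := by
  simp [joinedPath]

/-- The members of a route are its ends and members of `S`. -/
theorem Routing.mem_cases (R : Routing E S W Sg) {l : List V} (hl : l ∈ Sg) {v : V} (hv : v ∈ l) :
    l.head? = some v ∨ l.getLast? = some v ∨ v ∈ S := by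
  have h := R.inner l hl
  rcases l with _ | ⟨a, l⟩
  · simp at hv
  rcases List.mem_cons.1 hv with rfl | hv
  · exact Or.inl rfl
  rcases List.eq_nil_or_concat l with rfl | ⟨m, b, rfl⟩
  · simp at hv
  rw [List.concat_eq_append] at hv h ⊢
  rcases List.mem_append.1 hv with hv | hv
  · refine Or.inr (Or.inr (h v ?_))
    simpa using hv
  · rw [List.mem_singleton] at hv
    subst hv
    right; left
    rw [← List.cons_append, List.getLast?_concat]

theorem ne_of_mem_dropLast {l : List V} (hl : l.Nodup) {v w : V} (hw : w ∈ l.dropLast)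
    (hv : l.getLast? = some v) : w ≠ v := by
  rcases List.eq_nil_or_concat l with rfl | ⟨m, b, rfl⟩
  · simp at hv
  rw [List.concat_eq_append] at hv hw hl
  rw [List.getLast?_concat, Option.some_inj] at hv
  rw [List.dropLast_concat] at hw
  rw [List.nodup_append] at hl
  exact hv ▸ hl.2.2 w hw b (by simp)

namespace Routing.Compatible

theorem arr_cases (R : Routing E S W Sg) (H : Compatible A S W Sg arr dep) {s : V}
    (hs : s ∈ S → s ∈ W) :
    (arr s).Nodup ∧ ∀ v ∈ arr s, (arr s).head? = some v ∨ v ∈ S := by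
  by_cases h : s ∈ S
  · refine ⟨R.nodup _ (H.arr_mem s (hs h)), fun v hv => ?_⟩
    rcases R.mem_cases (H.arr_mem s (hs h)) hv with h1 | h1 | h1
    · exact Or.inl h1
    · rw [H.arr_last s hs, Option.some_inj] at h1
      exact Or.inr (h1 ▸ h)
    · exact Or.inr h1
  · rw [H.arr_out s h]
    simp

theorem dep_cases (R : Routing E S W Sg) (H : Compatible A S W Sg arr dep) {t : V}
    (ht : t ∈ S → t ∈ W) :
    (dep t).Nodup ∧ ∀ v ∈ dep t, (dep t).getLast? = some v ∨ v ∈ S := by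
  by_cases h : t ∈ S
  · refine ⟨R.nodup _ (H.dep_mem t (ht h)), fun v hv => ?_⟩
    rcases R.mem_cases (H.dep_mem t (ht h)) hv with h1 | h1 | h1
    · rw [H.dep_head t ht, Option.some_inj] at h1
      exact Or.inr (h1 ▸ h)
    · exact Or.inl h1
    · exact Or.inr h1
  · rw [H.dep_out t h]
    simp

theorem edgePieces_arr (R : Routing E S W Sg) (H : Compatible A S W Sg arr dep) {s : V}
    (hs : s ∈ S → s ∈ W) {p : Piece V} (hp : p ∈ edgePieces (arr s)) : s ∈ W ∧ arr s ∈ Sg ∧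
      p ∈ piecesOf E A S := by
  by_cases h : s ∈ S
  · have h1 := H.arr_mem s (hs h)
    have h2 := R.mem _ h1 p hp
    exact ⟨hs h, h1, h2.1, Or.inr ⟨isArc_of_mem_edgePieces hp, h2.2⟩⟩
  · rw [H.arr_out s h] at hp
    simp [edgePieces] at hp

theorem edgePieces_dep (R : Routing E S W Sg) (H : Compatible A S W Sg arr dep) {t : V}
    (ht : t ∈ S → t ∈ W) {p : Piece V} (hp : p ∈ edgePieces (dep t)) : t ∈ W ∧ dep t ∈ Sg ∧
      p ∈ piecesOf E A S := by
  by_cases h : t ∈ S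
  · have h1 := H.dep_mem t (ht h)
    have h2 := R.mem _ h1 p hp
    exact ⟨ht h, h1, h2.1, Or.inr ⟨isArc_of_mem_edgePieces hp, h2.2⟩⟩
  · rw [H.dep_out t h] at hp
    simp [edgePieces] at hp

theorem joinedPath_safe (R : Routing E S W Sg) (H : Compatible A S W Sg arr dep) {s t u v : V}
    (hst : A s t) (htouch : s ∈ S ∨ t ∈ S) (hc : ¬ (s ∈ S ∧ t ∈ S ∧ arr s = dep t))
    (hu : (arr s).head? = some u) (hv : (dep t).getLast? = some v) :
    SafePath (piecesOf E A S) S u (joinedPath arr dep s t) v := by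
  have hs := (H.arc_mem s t hst).1
  have ht := (H.arc_mem s t hst).2
  obtain ⟨h1, h2, h3⟩ := (H.joins s t hst htouch).resolve_left hc
  obtain ⟨M, hM⟩ : ∃ M, arr s = u :: M := by
    cases h : arr s with
    | nil => simp [h] at hu
    | cons a M => rw [h, List.head?_cons, Option.some_inj] at hu; exact ⟨M, by rw [hu]⟩
  obtain ⟨N, hN⟩ : ∃ N, dep t = t :: N := by
    have := H.dep_head t ht
    cases h : dep t with
    | nil => simp [h] at this
    | cons a M => rw [h, List.head?_cons, Option.some_inj] at this; exact ⟨M, by rw [this]⟩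
  have hmap : (joinedPath arr dep s t).map Piece.tgt = M ++ dep t := by
    rw [joinedPath, List.map_append, List.map_cons, hM, hN, map_tgt_edgePieces, map_tgt_edgePieces]
  have hnd : (arr s ++ dep t).Nodup := by
    rw [List.nodup_append]
    exact ⟨(H.arr_cases R hs).1, (H.dep_cases R ht).1, fun a ha b hb hab => h3 a ha (hab ▸ hb)⟩
  refine ⟨?_, ?_, by simp [joinedPath], ?_, h1 u hu, h2 v hv, ?_, ?_⟩
  · intro p hp
    rcases mem_joinedPath.1 hp with hp | rfl | hp
    · exact (H.edgePieces_arr R hs hp).2.2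
    · exact ⟨htouch, Or.inl ⟨rfl, hst⟩⟩
    · exact (H.edgePieces_dep R ht hp).2.2
  · refine isPieceWalk_append.2 ⟨s, ?_, rfl, ?_⟩
    · rw [hM]
      exact edgePieces_walk (hM ▸ H.arr_last s hs)
    · rw [hN]
      exact edgePieces_walk (hN ▸ hv)
  · rw [hmap, ← List.cons_append, ← hM]
    exact hnd
  · intro w hw
    have hne : dep t ≠ [] := by simp [hN]
    rw [hmap, List.dropLast_append_of_ne_nil hne] at hw
    rcases List.mem_append.1 hw with hw | hw
    · rcases (H.arr_cases R hs).2 w (by rw [hM]; simp [hw]) with h4 | h4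
      · have : u = w := by simpa [hu] using h4
        have h5 := (H.arr_cases R hs).1
        rw [hM, List.nodup_cons] at h5
        exact absurd (this ▸ hw) h5.1
      · exact h4
    · rcases (H.dep_cases R ht).2 w (List.mem_of_mem_dropLast hw) with h4 | h4
      · exact absurd rfl (ne_of_mem_dropLast (H.dep_cases R ht).1 hw h4)
      · exact h4
  · rw [joinedPath, List.countP_append, List.countP_cons, countP_edgePieces, countP_edgePieces]
    simp

/-- The safe partition obtained from a routing and compatible arcs. -/
theorem safePartition (R : Routing E S W Sg) (H : Compatible A S W Sg arr dep) :
    SafePartition (piecesOf E A S) S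
      ({p | ∃ l ∈ Sg, (∀ v, l.head? = some v → v ∉ S) ∧ (∀ v, l.getLast? = some v → v ∉ S) ∧
          p = edgePieces l} ∪
        {p | ∃ s t, A s t ∧ (s ∈ S ∨ t ∈ S) ∧ ¬ (s ∈ S ∧ t ∈ S ∧ arr s = dep t) ∧
          p = joinedPath arr dep s t})
      {p | ∃ s t, A s t ∧ (s ∈ S ∧ t ∈ S ∧ arr s = dep t) ∧
          p = ⟨s, t, true⟩ :: edgePieces (dep t)} := by
  classical
  have hhead : ∀ l ∈ Sg, ∃ u M, l = u :: M := fun l hl => by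
    have := R.two_le l hl
    cases l with
    | nil => simp at this
    | cons u M => exact ⟨u, M, rfl⟩
  have hends : ∀ l : List V, l ≠ [] → ∃ u v, l.head? = some u ∧ l.getLast? = some v := by
    intro l hl
    exact ⟨l.head hl, l.getLast hl, List.head?_eq_some_head hl, List.getLast?_eq_some_getLast hl⟩
  have harr : ∀ s, (s ∈ S → s ∈ W) → arr s ≠ [] := fun s hs h => by
    have := H.arr_last s hs
    simp [h] at this
  have hdep : ∀ s, (s ∈ S → s ∈ W) → dep s ≠ [] := fun s hs h => by
    have := H.dep_head s hs
    simp [h] at this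
  have hendS : ∀ l ∈ Sg, l ≠ [] := fun l hl h => by
    have := R.two_le l hl
    simp [h] at this
  -- a route that meets two arcs can only meet the same arc twice
  have huse : ∀ s t, A s t → (s ∈ S ∨ t ∈ S) → ∀ l ∈ Sg, ∀ s' t', A s' t' → (s' ∈ S ∨ t' ∈ S) →
      (s ∈ W ∧ l = arr s ∨ t ∈ W ∧ l = dep t) → (s' ∈ W ∧ l = arr s' ∨ t' ∈ W ∧ l = dep t') →
      s = s' ∧ t = t' := by
    have haux : ∀ s t, A s t → (s ∈ S ∨ t ∈ S) → ∀ l ∈ Sg, ∀ s' t', A s' t' → (s' ∈ S ∨ t' ∈ S) →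
      (s ∈ W ∧ l = arr s) → (t' ∈ W ∧ l = dep t') → s = s' ∧ t = t' := by
      rintro s t hst h1 l hl s' t' hst' h1' ⟨hs, rfl⟩ ⟨ht', h2⟩
      rcases H.joins s' t' hst' h1' with ⟨h3, h4, h5⟩ | ⟨-, h4, -⟩
      · have h6 : (arr s').getLast? = some s := by
          rw [h5, ← h2]
          exact H.arr_last s fun _ => hs
        rw [H.arr_last s' (H.arc_mem s' t' hst').1, Option.some_inj] at h6
        subst h6
        exact ⟨rfl, (H.out _ hs).unique hst hst'⟩
      · exact absurd (H.sub s hs) (h4 s (h2 ▸ H.arr_last s fun _ => hs))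
    rintro s t hst h1 l hl s' t' hst' h1' (h | h) (h' | h')
    · have h2 := H.arr_last s fun _ => h.1
      rw [← h.2, h'.2, H.arr_last s' fun _ => h'.1, Option.some_inj] at h2
      subst h2
      exact ⟨rfl, (H.out _ h.1).unique hst hst'⟩
    · exact haux s t hst h1 l hl s' t' hst' h1' h h'
    · obtain ⟨h3, h4⟩ := haux s' t' hst' h1' l hl s t hst h1 h' h
      exact ⟨h3.symm, h4.symm⟩
    · have h2 := H.dep_head t fun _ => h.1
      rw [← h.2, h'.2, H.dep_head t' fun _ => h'.1, Option.some_inj] at h2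
      subst h2
      exact ⟨(H.inn _ h.1).unique hst hst', rfl⟩
  -- how an element of the partition relates to the routes
  have hkind : ∀ F, F ∈ ({p | ∃ l ∈ Sg, (∀ v, l.head? = some v → v ∉ S) ∧
          (∀ v, l.getLast? = some v → v ∉ S) ∧ p = edgePieces l} ∪
        {p | ∃ s t, A s t ∧ (s ∈ S ∨ t ∈ S) ∧ ¬ (s ∈ S ∧ t ∈ S ∧ arr s = dep t) ∧
          p = joinedPath arr dep s t}) ∪ {p | ∃ s t, A s t ∧ (s ∈ S ∧ t ∈ S ∧ arr s = dep t) ∧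
          p = ⟨s, t, true⟩ :: edgePieces (dep t)} →
      (∃ l ∈ Sg, (∀ v, l.head? = some v → v ∉ S) ∧ (∀ v, l.getLast? = some v → v ∉ S) ∧
        F = edgePieces l) ∨
      ∃ s t, A s t ∧ (s ∈ S ∨ t ∈ S) ∧
        (F = if s ∈ S ∧ t ∈ S ∧ arr s = dep t then ⟨s, t, true⟩ :: edgePieces (dep t)
          else joinedPath arr dep s t) ∧
        ∀ p ∈ F, p = ⟨s, t, true⟩ ∨
          ∃ l ∈ Sg, p ∈ edgePieces l ∧ (s ∈ W ∧ l = arr s ∨ t ∈ W ∧ l = dep t) := by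
    rintro F ((h | ⟨s, t, hst, h1, h2, rfl⟩) | ⟨s, t, hst, h1, rfl⟩)
    · exact Or.inl h
    · refine Or.inr ⟨s, t, hst, h1, by rw [if_neg h2], fun p hp => ?_⟩
      rcases mem_joinedPath.1 hp with hp | hp | hp
      · have := H.edgePieces_arr R (H.arc_mem s t hst).1 hp
        exact Or.inr ⟨arr s, this.2.1, hp, Or.inl ⟨this.1, rfl⟩⟩
      · exact Or.inl hp
      · have := H.edgePieces_dep R (H.arc_mem s t hst).2 hp
        exact Or.inr ⟨dep t, this.2.1, hp, Or.inr ⟨this.1, rfl⟩⟩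
    · refine Or.inr ⟨s, t, hst, Or.inl h1.1, by rw [if_pos h1], fun p hp => ?_⟩
      rcases List.mem_cons.1 hp with hp | hp
      · exact Or.inl hp
      · have := H.edgePieces_dep R (H.arc_mem s t hst).2 hp
        exact Or.inr ⟨dep t, this.2.1, hp, Or.inr ⟨this.1, rfl⟩⟩
  refine ⟨?_, ?_, ?_, ?_⟩
  · rintro _ (⟨l, hl, h1, h2, rfl⟩ | ⟨s, t, hst, h1, h2, rfl⟩)
    · obtain ⟨u, v, hu, hv⟩ := hends l (hendS l hl)
      obtain ⟨u', M, rfl⟩ := hhead l hl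
      rw [List.head?_cons, Option.some_inj] at hu
      subst hu
      refine ⟨u', v, ?_, edgePieces_walk hv, edgePieces_ne_nil (R.two_le _ hl), ?_, h1 u' rfl,
        h2 v hv, ?_, by simp [countP_edgePieces]⟩
      · exact fun p hp => ⟨(R.mem _ hl p hp).1,
          Or.inr ⟨isArc_of_mem_edgePieces hp, (R.mem _ hl p hp).2⟩⟩
      · rw [map_tgt_edgePieces]
        exact R.nodup _ hl
      · rw [map_tgt_edgePieces]
        exact R.inner _ hl
    · obtain ⟨u, -, hu, -⟩ := hends _ (harr s (H.arc_mem s t hst).1)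
      obtain ⟨-, v, -, hv⟩ := hends _ (hdep t (H.arc_mem s t hst).2)
      exact ⟨u, v, H.joinedPath_safe R hst h1 h2 hu hv⟩
  · rintro _ ⟨s, t, hst, ⟨hs, ht, h1⟩, rfl⟩
    have hsW := (H.arc_mem s t hst).1 hs
    have htW := (H.arc_mem s t hst).2 ht
    have hdS := H.dep_mem t htW
    have h2 := H.dep_head t fun _ => htW
    have h3 := H.arr_last s fun _ => hsW
    rw [h1] at h3
    obtain ⟨u, M, hM⟩ := hhead _ hdS
    rw [hM, List.head?_cons, Option.some_inj] at h2
    subst h2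
    have hmap : ((⟨s, u, true⟩ :: edgePieces (dep u) : List (Piece V)).map Piece.tgt) = dep u := by
      rw [List.map_cons, hM, map_tgt_edgePieces]
    refine ⟨?_, ⟨s, rfl, ?_⟩, by simp, ?_, ?_, ?_, ?_⟩
    · intro p hp
      rcases List.mem_cons.1 hp with rfl | hp
      · exact ⟨Or.inl hs, Or.inl ⟨rfl, hst⟩⟩
      · exact (H.edgePieces_dep R (H.arc_mem s u hst).2 hp).2.2
    · rw [hM]
      exact edgePieces_walk (hM ▸ h3)
    · rw [hmap]
      exact R.nodup _ hdS
    · rw [hmap]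
      intro w hw
      rcases R.mem_cases hdS hw with h4 | h4 | h4
      · rw [hM, List.head?_cons, Option.some_inj] at h4
        exact h4 ▸ ht
      · rw [h3, Option.some_inj] at h4
        exact h4 ▸ hs
      · exact h4
    · rw [List.countP_cons, countP_edgePieces]
      simp
    · rw [List.countP_cons]
      simp
  · rintro ⟨a, b, f⟩ ⟨h1, ⟨h2, h3⟩ | ⟨h2, h3⟩⟩ <;> simp only at h1 h2 h3 <;> subst h2
    · by_cases hc : a ∈ S ∧ b ∈ S ∧ arr a = dep b
      · exact ⟨_, Or.inr ⟨a, b, h3, hc, rfl⟩, by simp⟩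
      · exact ⟨_, Or.inl (Or.inr ⟨a, b, h3, h1, hc, rfl⟩), by simp [joinedPath]⟩
    · obtain ⟨l, hl, hp⟩ := R.cover a b h1 h3
      obtain ⟨u, v, hu, hv⟩ := hends l (hendS l hl)
      by_cases hvS : v ∈ S
      · have hvW := R.last l hl v hvS hv
        obtain ⟨t, ht, -⟩ := H.out v hvW
        have hla := H.arr_unique v hvW l hl hv
        by_cases hc : v ∈ S ∧ t ∈ S ∧ arr v = dep t
        · exact ⟨_, Or.inr ⟨v, t, ht, hc, rfl⟩, by simp [← hc.2.2, ← hla, hp]⟩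
        · exact ⟨_, Or.inl (Or.inr ⟨v, t, ht, Or.inl hvS, hc, rfl⟩), by
            rw [mem_joinedPath, ← hla]; exact Or.inl hp⟩
      · by_cases huS : u ∈ S
        · have huW := R.head l hl u huS hu
          obtain ⟨s, hs, -⟩ := H.inn u huW
          have hla := H.dep_unique u huW l hl hu
          by_cases hc : s ∈ S ∧ u ∈ S ∧ arr s = dep u
          · exact ⟨_, Or.inr ⟨s, u, hs, hc, rfl⟩, by simp [← hla, hp]⟩
          · exact ⟨_, Or.inl (Or.inr ⟨s, u, hs, Or.inr huS, hc, rfl⟩), by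
              rw [mem_joinedPath, ← hla]; exact Or.inr (Or.inr hp)⟩
        · refine ⟨_, Or.inl (Or.inl ⟨l, hl, ?_, ?_, rfl⟩), hp⟩
          · rintro w hw
            rw [hu, Option.some_inj] at hw
            exact hw ▸ huS
          · rintro w hw
            rw [hv, Option.some_inj] at hw
            exact hw ▸ hvS
  · -- the route of an edge determines the member of the partition
    have hmix : ∀ l ∈ Sg, (∀ v, l.head? = some v → v ∉ S) → (∀ v, l.getLast? = some v → v ∉ S) →
        ∀ s t, ¬ (s ∈ W ∧ l = arr s ∨ t ∈ W ∧ l = dep t) := by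
      rintro l hl h1 h2 s t (⟨h3, rfl⟩ | ⟨h3, rfl⟩)
      · exact h2 s (H.arr_last s fun _ => h3) (H.sub s h3)
      · exact h1 t (H.dep_head t fun _ => h3) (H.sub t h3)
    have hmix' : ∀ l ∈ Sg, (∀ v, l.head? = some v → v ∉ S) → (∀ v, l.getLast? = some v → v ∉ S) →
        ∀ p ∈ edgePieces l, ∀ s t, ¬ (p = ⟨s, t, true⟩ ∨
          ∃ l ∈ Sg, p ∈ edgePieces l ∧ (s ∈ W ∧ l = arr s ∨ t ∈ W ∧ l = dep t)) := by
      rintro l hl h1 h2 p hp s t (rfl | ⟨l', hl', hp', h3⟩)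
      · have := isArc_of_mem_edgePieces hp
        simp at this
      · rw [R.unique p l hl l' hl' hp hp'] at h1 h2
        exact hmix l' hl' h1 h2 s t h3
    intro p F hF F' hF' hp hp'
    rcases hkind F hF with ⟨l, hl, h1, h2, rfl⟩ | ⟨s, t, hst, h1, h2, h3⟩ <;>
      rcases hkind F' hF' with ⟨l', hl', h1', h2', rfl⟩ | ⟨s', t', hst', h1', h2', h3'⟩
    · rw [R.unique p l hl l' hl' hp hp']
    · exact absurd (h3' p hp') (hmix' l hl h1 h2 p hp s' t')
    · exact absurd (h3 p hp) (hmix' l' hl' h1' h2' p hp' s t)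
    · have : s = s' ∧ t = t' := by
        rcases h3 p hp with h4 | ⟨l, hl, hpl, h4⟩ <;>
          rcases h3' p hp' with h5 | ⟨l', hl', hpl', h5⟩
        · simpa using h4.symm.trans h5
        · rw [h4] at hpl'
          have := isArc_of_mem_edgePieces hpl'
          simp at this
        · rw [h5] at hpl
          have := isArc_of_mem_edgePieces hpl
          simp at this
        · have h6 := R.unique p l hl l' hl' hpl hpl'
          subst h6
          exact huse s t hst h1 l hl s' t' hst' h1' h4 h5
      obtain ⟨rfl, rfl⟩ := this
      rw [h2, h2']

end Routing.Compatible

end Routing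

/-! ### Finite templates and the search for a routing -/

/-- A graph on the vertices `0, …, n - 1`, with the half-edges attached at the members of
`halves`. The `k`-th half-edge is treated as an edge to the outer vertex `n + k`. -/
structure Template where
  n : ℕ
  edges : List (ℕ × ℕ)
  halves : List ℕ

/-- Duplicate-freeness, in a form that is quick to evaluate. -/
def distinct : List ℕ → Bool
  | [] => true
  | a :: l => !l.any (Nat.beq a) && distinct l

/-- Containment of lists, in a form that is quick to evaluate. -/
def within (l m : List ℕ) : Bool := l.all fun a => m.any (Nat.beq a)

theorem any_beq_iff {a : ℕ} {l : List ℕ} : l.any (Nat.beq a) = true ↔ a ∈ l := by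
  simp

theorem distinct_iff {l : List ℕ} : distinct l = true ↔ l.Nodup := by
  induction l with
  | nil => simp [distinct]
  | cons a l ih =>
    rw [distinct, Bool.and_eq_true, ih, List.nodup_cons, ← any_beq_iff, Bool.not_eq_true',
      Bool.not_eq_true]

theorem within_iff {l m : List ℕ} : within l m = true ↔ ∀ a ∈ l, a ∈ m := by
  simp only [within, List.all_eq_true, any_beq_iff]

/-- The pairs of consecutive members of a list. -/
def darts : List ℕ → List (ℕ × ℕ)
  | a :: b :: l => (a, b) :: darts (b :: l)
  | _ => []

theorem mem_of_mem_darts {l : List ℕ} {d : ℕ × ℕ} (h : d ∈ darts l) : d.1 ∈ l ∧ d.2 ∈ l := by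
  induction l with
  | nil => simp [darts] at h
  | cons a l ih =>
    cases l with
    | nil => simp [darts] at h
    | cons b l =>
      rcases List.mem_cons.1 h with rfl | h
      · simp
      · have := ih h
        exact ⟨List.mem_cons_of_mem _ this.1, List.mem_cons_of_mem _ this.2⟩

theorem edgePieces_map {V : Type*} (ι : ℕ → V) (l : List ℕ) :
    edgePieces (l.map ι) = (darts l).map fun d => ⟨ι d.1, ι d.2, false⟩ := by
  induction l with
  | nil => rfl
  | cons a l ih =>
    cases l with
    | nil => rfl
    | cons b l => simpa [edgePieces, darts] using ih

namespace Template
variable (t : Template)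

/-- The number of vertices, outer vertices included. -/
def size : ℕ := t.n + t.halves.length

/-- The neighbours of `v`, outer vertices included. The order in this list is what the rotations of
`follow` refer to. -/
def nbrs (v : ℕ) : List ℕ :=
  t.edges.filterMap (fun e => if e.1 = v then some e.2 else if e.2 = v then some e.1 else none) ++
    t.halves.zipIdx.filterMap (fun h => if h.1 = v then some (t.n + h.2) else none)

/-- The vertices of degree two, which are those with an incoming and an outgoing arc. -/
def slots : List ℕ := (List.range t.n).filter fun v => (t.nbrs v).length == 2

/-- The rest of the route that goes from `a` to `b`. A vertex has three ports: its neighbours, and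
the pair of its arcs if it has just two neighbours. A route that enters at a port leaves at the next
port or at the one after the next, depending on the bit of `r` at the vertex; it ends if it reaches
an outer vertex or leaves by an arc. The first number bounds the number of steps. -/
def follow (r : ℕ) : ℕ → ℕ → ℕ → List ℕ
  | 0, _, b => [b]
  | k + 1, a, b =>
    if t.n ≤ b then [b] else
      match (t.nbrs b)[((t.nbrs b).idxOf a + 1 + r / 2 ^ b % 2) % 3]? with
      | none => [b]
      | some c => b :: follow r k b c

/-- The routes from the outer vertices and from the slots, for the rotations coded by `r`. -/
def routes (r : ℕ) : List (List ℕ) :=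
  t.halves.zipIdx.map (fun h => (t.n + h.2) :: t.follow r t.size (t.n + h.2) h.1) ++
    t.slots.map fun s => s :: t.follow r t.size s ((t.nbrs s).getD (r / 2 ^ s % 2) 0)

/-- The edges and half-edges, in both directions. -/
def allDarts : List (ℕ × ℕ) :=
  (List.range t.n).flatMap fun v => (t.nbrs v).flatMap fun w =>
    if t.n ≤ w then [(v, w), (w, v)] else [(v, w)]

/-- Pairs as numbers, which are quicker to compare in the kernel. -/
def keys (L : List (ℕ × ℕ)) : List ℕ := L.map fun d => Nat.pair d.1 d.2

/-- The test that `L` is a routing, that is, a set of routes which uses each edge once in each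
direction and whose ends are outer vertices and slots, each of them once. -/
def isRouting (L : List (List ℕ)) : Bool :=
  (L.all fun l => distinct l && within l.tail.dropLast (List.range t.n) && Nat.ble 2 l.length &&
    l.all (fun v => Nat.blt v t.size)) &&
  (distinct (L.filterMap List.head?) && distinct (L.filterMap List.getLast?)) &&
  (within t.slots (L.filterMap List.head?) && within t.slots (L.filterMap List.getLast?)) &&
  ((L.filterMap List.head?).all (fun v => Nat.ble t.n v || t.slots.any (Nat.beq v)) &&
    (L.filterMap List.getLast?).all (fun v => Nat.ble t.n v || t.slots.any (Nat.beq v))) &&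
  distinct (keys (L.flatMap darts)) &&
  within (keys (L.flatMap darts)) (keys t.allDarts) &&
  within (keys t.allDarts) (keys (L.flatMap darts))

/-- The route that ends at `s`. -/
def arrive (L : List (List ℕ)) (s : ℕ) : List ℕ := (L.find? fun l => l.getLast? == some s).getD []

/-- The route that starts at `s`. -/
def depart (L : List (List ℕ)) (s : ℕ) : List ℕ := (L.find? fun l => l.head? == some s).getD []

/-- The route to the slot `s` may be continued by an arc to the outside. -/
def outOK (L : List (List ℕ)) (s : ℕ) : Bool := (arrive L s).head?.all (t.n ≤ ·)

/-- The route from the slot `s` may be preceded by an arc from the outside. -/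
def inOK (L : List (List ℕ)) (s : ℕ) : Bool := (depart L s).getLast?.all (t.n ≤ ·)

/-- The routes may be joined by an arc from the slot `s` to the slot `s'`. -/
def arcOK (L : List (List ℕ)) (s s' : ℕ) : Bool :=
  arrive L s == depart L s' ||
    (outOK t L s && inOK t L s' && (arrive L s).all fun v => !(depart L s').contains v)

/-- The routes of `L` may be continued by the outgoing arc of the slot `s`, as told by the last
argument: the target, or `none` for an arc to the outside. -/
def compat (L : List (List ℕ)) (s : ℕ) : Option ℕ → Bool
  | none => t.outOK L s
  | some s' => t.arcOK L s s'

/-- The search, for all ways of choosing the outgoing arcs of the slots `rest` (`none` is an arc to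
the outside), for a compatible routing among `cands`. The choices made so far are in `acc`. -/
def search (need : List (ℕ × Option ℕ) → Bool) (goal : List (ℕ × Option ℕ) → List (List ℕ) → Bool) :
    List (List (List ℕ)) → List (ℕ × Option ℕ) → List ℕ → Bool
  | cands, acc, [] => !need acc || cands.any fun L =>
      (t.slots.all fun s => (acc.any fun q => q.2 == some s) || t.inOK L s) && goal acc L
  | cands, acc, s :: rest =>
      search need goal (cands.filter fun L => t.compat L s none) ((s, none) :: acc) rest &&
      t.slots.all fun s' => s' == s || (acc.any fun q => q.2 == some s') ||
        search need goal (cands.filter fun L => t.compat L s (some s')) ((s, some s') :: acc) rest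

/-- The test that, however the arcs at the slots are chosen subject to `need`, one of the rotations
in `rots` yields a compatible routing with the property `goal`. -/
def check (need : List (ℕ × Option ℕ) → Bool) (goal : List (ℕ × Option ℕ) → List (List ℕ) → Bool)
    (rots : List ℕ) : Bool :=
  t.search need goal ((rots.map t.routes).filter t.isRouting) [] t.slots

theorem nodup_slots : t.slots.Nodup := List.nodup_range.filter _

theorem slots_lt {s : ℕ} (hs : s ∈ t.slots) : s < t.n :=
  List.mem_range.1 (List.mem_filter.1 hs).1

variable {t}

/-- If the search succeeds, it has found a compatible routing for the actual arcs `σ`. -/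
theorem search_sound {need : List (ℕ × Option ℕ) → Bool}
    {goal : List (ℕ × Option ℕ) → List (List ℕ) → Bool} {σ : ℕ → Option ℕ}
    (hσ : ∀ s ∈ t.slots, ∀ s', σ s = some s' → s' ∈ t.slots ∧ s' ≠ s)
    (hinj : ∀ s ∈ t.slots, ∀ s' ∈ t.slots, ∀ u, σ s = some u → σ s' = some u → s = s')
    (hneed : need (t.slots.map fun s => (s, σ s)).reverse = true) (rest done : List ℕ)
    (hd : t.slots = done ++ rest) (cands : List (List (List ℕ)))
    (h : t.search need goal cands (done.map fun s => (s, σ s)).reverse rest = true) :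
    ∃ L ∈ cands, (∀ s ∈ rest, t.compat L s (σ s) = true) ∧
      (∀ s ∈ t.slots, (∀ s' ∈ t.slots, σ s' ≠ some s) → t.inOK L s = true) ∧
      goal (t.slots.map fun s => (s, σ s)).reverse L = true := by
  induction rest generalizing done cands with
  | nil =>
    rw [List.append_nil] at hd
    rw [search, ← hd, hneed] at h
    simp only [Bool.not_true, Bool.false_or, List.any_eq_true] at h
    obtain ⟨L, hL, h1⟩ := h
    rw [Bool.and_eq_true, List.all_eq_true] at h1
    refine ⟨L, hL, by simp, fun s hs hns => ?_, h1.2⟩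
    have h2 := h1.1 s hs
    rw [Bool.or_eq_true] at h2
    refine h2.resolve_left fun h3 => ?_
    simp only [List.any_reverse, List.any_map, List.any_eq_true, Function.comp_apply, beq_iff_eq] at h3
    obtain ⟨s', hs', h4⟩ := h3
    exact hns s' hs' h4
  | cons s rest ih =>
    have hnd := t.nodup_slots
    have hsS : s ∈ t.slots := by rw [hd]; simp
    have hacc : ((s, σ s) :: (done.map fun s => (s, σ s)).reverse) =
        ((done ++ [s]).map fun s => (s, σ s)).reverse := by simp
    have hd' : t.slots = (done ++ [s]) ++ rest := by simp [hd]
    suffices hs : t.search need goal (cands.filter fun L => t.compat L s (σ s))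
        ((s, σ s) :: (done.map fun s => (s, σ s)).reverse) rest = true by
      rw [hacc] at hs
      obtain ⟨L, hL, h1, h2, h3⟩ := ih _ hd' _ hs
      rw [List.mem_filter] at hL
      refine ⟨L, hL.1, fun s' hs' => ?_, h2, h3⟩
      rcases List.mem_cons.1 hs' with rfl | hs'
      · exact hL.2
      · exact h1 s' hs'
    rw [search, Bool.and_eq_true, List.all_eq_true] at h
    cases hs : σ s with
    | none => exact h.1
    | some s' =>
      obtain ⟨h1, h2⟩ := hσ s hsS s' hs
      have h3 := h.2 s' h1
      simp only [Bool.or_eq_true, beq_iff_eq, List.any_reverse, List.any_map, List.any_eq_true,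
        Function.comp_apply] at h3
      rcases h3 with (h3 | ⟨u, hu, h3⟩) | h3
      · exact absurd h3 h2
      · have huS : u ∈ t.slots := by rw [hd]; simp [hu]
        have := hinj u huS s hsS s' h3 hs
        subst this
        rw [hd, List.nodup_append] at hnd
        exact absurd rfl (hnd.2.2 u hu u (by simp))
      · exact h3

/-- What `isRouting` tests. -/
structure IsRouting (t : Template) (L : List (List ℕ)) : Prop where
  nodup : ∀ l ∈ L, l.Nodup
  inner : ∀ l ∈ L, ∀ v ∈ l.tail.dropLast, v < t.n
  two_le : ∀ l ∈ L, 2 ≤ l.length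
  lt_size : ∀ l ∈ L, ∀ v ∈ l, v < t.size
  head_unique : ∀ l ∈ L, ∀ l' ∈ L, ∀ v, l.head? = some v → l'.head? = some v → l = l'
  last_unique : ∀ l ∈ L, ∀ l' ∈ L, ∀ v, l.getLast? = some v → l'.getLast? = some v → l = l'
  exists_head : ∀ s ∈ t.slots, ∃ l ∈ L, l.head? = some s
  exists_last : ∀ s ∈ t.slots, ∃ l ∈ L, l.getLast? = some s
  head : ∀ l ∈ L, ∀ v, l.head? = some v → t.n ≤ v ∨ v ∈ t.slots
  last : ∀ l ∈ L, ∀ v, l.getLast? = some v → t.n ≤ v ∨ v ∈ t.slots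
  unique : ∀ d, ∀ l ∈ L, ∀ l' ∈ L, d ∈ darts l → d ∈ darts l' → l = l'
  mem : ∀ l ∈ L, ∀ d ∈ darts l, d ∈ t.allDarts
  cover : ∀ d ∈ t.allDarts, ∃ l ∈ L, d ∈ darts l

theorem eq_of_nodup_flatMap {α β : Type*} {L : List α} {f : α → List β} (h : (L.flatMap f).Nodup)
    {a b : α} (ha : a ∈ L) (hb : b ∈ L) {x : β} (hxa : x ∈ f a) (hxb : x ∈ f b) : a = b := by
  by_contra hne
  have h1 := (List.nodup_flatMap.1 h).2
  have h2 : ∀ ⦃c⦄, c ∈ L → ∀ ⦃d⦄, d ∈ L → c ≠ d → List.Disjoint (f c) (f d) :=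
    haveI : Std.Symm (Function.onFun List.Disjoint f) := ⟨fun _ _ h => List.Disjoint.symm h⟩
    h1.forall
  exact h2 ha hb hne hxa hxb

theorem key_injective : Function.Injective fun d : ℕ × ℕ => Nat.pair d.1 d.2 := fun a b h => by
  have := Nat.pair_eq_pair.1 h
  exact Prod.ext this.1 this.2

theorem eq_of_nodup_filterMap {α β : Type*} {L : List α} {f : α → Option β}
    (h : (L.filterMap f).Nodup) {a b : α} (ha : a ∈ L) (hb : b ∈ L) {x : β} (hxa : f a = some x)
    (hxb : f b = some x) : a = b := by
  rw [List.filterMap_eq_flatMap_toList] at h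
  exact eq_of_nodup_flatMap h ha hb (x := x) (by simp [hxa]) (by simp [hxb])

theorem isRouting_sound {L : List (List ℕ)} (h : t.isRouting L = true) : t.IsRouting L := by
  simp only [isRouting, Bool.and_eq_true, List.all_eq_true, distinct_iff, within_iff,
    Bool.or_eq_true, any_beq_iff] at h
  obtain ⟨⟨⟨⟨⟨⟨h1, h2, h3⟩, h4, h5⟩, h6, h7⟩, h8⟩, h9⟩, h10⟩ := h
  have hmem : ∀ d M, Nat.pair d.1 d.2 ∈ keys M → d ∈ M := fun d M hd => by
    obtain ⟨d', hd', h⟩ := List.mem_map.1 hd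
    exact key_injective h ▸ hd'
  refine ⟨fun l hl => (h1 l hl).1.1.1, fun l hl v hv => List.mem_range.1 ((h1 l hl).1.1.2 v hv),
    fun l hl => by simpa using (h1 l hl).1.2,
    fun l hl v hv => by simpa using (h1 l hl).2 v hv,
    fun l hl l' hl' v hv hv' => eq_of_nodup_filterMap h2 hl hl' hv hv',
    fun l hl l' hl' v hv hv' => eq_of_nodup_filterMap h3 hl hl' hv hv',
    fun s hs => by simpa using h4 s hs, fun s hs => by simpa using h5 s hs,
    fun l hl v hv => by simpa using h6 v (List.mem_filterMap.2 ⟨l, hl, hv⟩),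
    fun l hl v hv => by simpa using h7 v (List.mem_filterMap.2 ⟨l, hl, hv⟩),
    fun d l hl l' hl' hd hd' => eq_of_nodup_flatMap (List.Nodup.of_map _ h8) hl hl' hd hd', ?_, ?_⟩
  · intro l hl d hd
    refine hmem d _ (h9 _ ?_)
    exact List.mem_map.2 ⟨d, List.mem_flatMap.2 ⟨l, hl, hd⟩, rfl⟩
  · intro d hd
    have := hmem d _ (h10 _ (List.mem_map.2 ⟨d, hd, rfl⟩))
    exact List.mem_flatMap.1 this

theorem mem_allDarts {d : ℕ × ℕ} : d ∈ t.allDarts ↔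
    (d.1 < t.n ∧ d.2 ∈ t.nbrs d.1) ∨ (d.2 < t.n ∧ t.n ≤ d.1 ∧ d.1 ∈ t.nbrs d.2) := by
  obtain ⟨a, b⟩ := d
  simp only [allDarts, List.mem_flatMap, List.mem_range]
  constructor
  · rintro ⟨v, hv, w, hw, h⟩
    split_ifs at h with h1
    · simp only [List.mem_cons, Prod.mk.injEq, List.not_mem_nil, or_false] at h
      rcases h with ⟨rfl, rfl⟩ | ⟨rfl, rfl⟩
      · exact Or.inl ⟨hv, hw⟩
      · exact Or.inr ⟨hv, h1, hw⟩
    · simp only [List.mem_cons, Prod.mk.injEq, List.not_mem_nil, or_false] at h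
      obtain ⟨rfl, rfl⟩ := h
      exact Or.inl ⟨hv, hw⟩
  · rintro (⟨h1, h2⟩ | ⟨h1, h2, h3⟩)
    · refine ⟨a, h1, b, h2, ?_⟩
      split_ifs <;> simp
    · exact ⟨b, h1, a, h3, by simp [h2]⟩

/-- The edges `E` and the arcs `A` at the set `S` are as in the template; `ι` names the vertices. -/
structure Realized {V : Type*} (t : Template) (E A : V → V → Prop) (S : Set V) (ι : ℕ → V) :
    Prop where
  inj : ∀ a < t.size, ∀ b < t.size, ι a = ι b → a = b
  mem : ∀ v, v ∈ S ↔ ∃ a < t.n, v = ι a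
  symm : ∀ u v, E u v → E v u
  adj : ∀ a < t.n, ∀ w, E (ι a) w ↔ ∃ b ∈ t.nbrs a, w = ι b
  arc_mem : ∀ u v, A u v → (u ∈ S → ∃ s ∈ t.slots, u = ι s) ∧ (v ∈ S → ∃ s ∈ t.slots, v = ι s)
  out : ∀ s ∈ t.slots, ∃! v, A (ι s) v
  inn : ∀ s ∈ t.slots, ∃! v, A v (ι s)
  irrefl : ∀ v, ¬ A v v
  ext : ∀ u v, A u v → ∀ a < t.n, ∀ b < t.size, t.n ≤ b →
    (u = ι a → v ≠ ι b) ∧ (v = ι a → u ≠ ι b)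

/-- `σ s` is the target of the arc that leaves `s` if that target is in `S`. -/
def Outgoing {V : Type*} (t : Template) (A : V → V → Prop) (S : Set V) (ι : ℕ → V)
    (σ : ℕ → Option ℕ) : Prop :=
  ∀ s ∈ t.slots, (∀ s', σ s = some s' ↔ s' ∈ t.slots ∧ A (ι s) (ι s')) ∧
    (σ s = none ↔ ∀ v, A (ι s) v → v ∉ S)

namespace Realized
variable {V : Type*} {E A : V → V → Prop} {S : Set V} {ι : ℕ → V}

theorem exists_outgoing (h : t.Realized E A S ι) : ∃ σ, t.Outgoing A S ι σ := by
  have : ∀ s, ∃ o : Option ℕ, s ∈ t.slots → (∀ s', o = some s' ↔ s' ∈ t.slots ∧ A (ι s) (ι s')) ∧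
      (o = none ↔ ∀ v, A (ι s) v → v ∉ S) := by
    intro s
    by_cases hs : s ∈ t.slots
    · obtain ⟨v, hv, hv'⟩ := h.out s hs
      by_cases hvS : v ∈ S
      · obtain ⟨s', hs', rfl⟩ := (h.arc_mem _ _ hv).2 hvS
        refine ⟨some s', fun _ => ⟨fun u => ⟨?_, ?_⟩, ?_⟩⟩
        · intro hu
          rw [Option.some_inj] at hu
          exact hu ▸ ⟨hs', hv⟩
        · rintro ⟨hu, hu'⟩
          have hlt : ∀ s ∈ t.slots, s < t.size := fun s hs =>
            (t.slots_lt hs).trans_le (Nat.le_add_right _ _)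
          rw [h.inj _ (hlt u hu) _ (hlt s' hs') (hv' _ hu')]
        · simp only [reduceCtorEq, false_iff, not_forall]
          exact ⟨_, hv, fun h => h hvS⟩
      · refine ⟨none, fun _ => ⟨fun u => ?_, ?_⟩⟩
        · simp only [reduceCtorEq, false_iff, not_and]
          intro hu hu'
          exact hvS (hv' _ hu' ▸ (h.mem _).2 ⟨u, t.slots_lt hu, rfl⟩)
        · simp only [true_iff]
          intro w hw
          exact hv' _ hw ▸ hvS
    · exact ⟨none, fun h => absurd h hs⟩
  choose σ hσ using this
  exact ⟨σ, fun s hs => hσ s hs⟩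

theorem size_le (t : Template) : t.n ≤ t.size := Nat.le_add_right _ _

theorem mem_iff (h : t.Realized E A S ι) {a : ℕ} (ha : a < t.size) : ι a ∈ S ↔ a < t.n := by
  rw [h.mem]
  constructor
  · rintro ⟨b, hb, hab⟩
    rw [h.inj a ha b (hb.trans_le (size_le t)) hab]
    exact hb
  · exact fun h => ⟨a, h, rfl⟩

theorem routing (h : t.Realized E A S ι) {L : List (List ℕ)} (hL : t.IsRouting L) :
    Routing E S {v | ∃ s ∈ t.slots, v = ι s} {m | ∃ l ∈ L, m = l.map ι} := by
  refine ⟨?_, ?_, ?_, ?_, ?_, ?_, ?_, ?_⟩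
  · rintro _ ⟨l, hl, rfl⟩
    exact (hL.nodup l hl).map_on fun a ha b hb => h.inj a (hL.lt_size l hl a ha) b
      (hL.lt_size l hl b hb)
  · rintro _ ⟨l, hl, rfl⟩
    simpa using hL.two_le l hl
  · rintro _ ⟨l, hl, rfl⟩ v hv
    rw [← List.map_tail, ← List.map_dropLast] at hv
    obtain ⟨a, ha, rfl⟩ := List.mem_map.1 hv
    exact (h.mem _).2 ⟨a, hL.inner l hl a ha, rfl⟩
  · rintro _ ⟨l, hl, rfl⟩ v hv hlv
    rw [List.head?_map, Option.map_eq_some_iff] at hlv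
    obtain ⟨a, ha, rfl⟩ := hlv
    have hlt := (h.mem_iff (hL.lt_size l hl a (List.mem_of_mem_head? ha))).1 hv
    exact ⟨a, (hL.head l hl a ha).resolve_left (by omega), rfl⟩
  · rintro _ ⟨l, hl, rfl⟩ v hv hlv
    rw [List.getLast?_map, Option.map_eq_some_iff] at hlv
    obtain ⟨a, ha, rfl⟩ := hlv
    have hlt := (h.mem_iff (hL.lt_size l hl a (List.mem_of_getLast? ha))).1 hv
    exact ⟨a, (hL.last l hl a ha).resolve_left (by omega), rfl⟩
  · rintro _ ⟨l, hl, rfl⟩ p hp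
    rw [edgePieces_map] at hp
    obtain ⟨d, hd, rfl⟩ := List.mem_map.1 hp
    rcases mem_allDarts.1 (hL.mem l hl d hd) with ⟨h1, h2⟩ | ⟨h1, -, h2⟩
    · exact ⟨Or.inl ((h.mem _).2 ⟨_, h1, rfl⟩), (h.adj _ h1 _).2 ⟨_, h2, rfl⟩⟩
    · exact ⟨Or.inr ((h.mem _).2 ⟨_, h1, rfl⟩), h.symm _ _ ((h.adj _ h1 _).2 ⟨_, h2, rfl⟩)⟩
  · have key : ∀ x y, (x, y) ∈ t.allDarts →
        ∃ l ∈ {m | ∃ l ∈ L, m = l.map ι}, (⟨ι x, ι y, false⟩ : Piece V) ∈ edgePieces l := by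
      intro x y hxy
      obtain ⟨l, hl, hd⟩ := hL.cover _ hxy
      refine ⟨_, ⟨l, hl, rfl⟩, ?_⟩
      rw [edgePieces_map]
      exact List.mem_map.2 ⟨_, hd, rfl⟩
    have key1 : ∀ a b, a ∈ S → E a b →
        ∃ l ∈ {m | ∃ l ∈ L, m = l.map ι}, (⟨a, b, false⟩ : Piece V) ∈ edgePieces l := by
      intro a b ha hab
      obtain ⟨x, hx, rfl⟩ := (h.mem a).1 ha
      obtain ⟨y, hy, rfl⟩ := (h.adj x hx b).1 hab
      exact key x y (mem_allDarts.2 (Or.inl ⟨hx, hy⟩))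
    rintro a b (ha | hb) hab
    · exact key1 a b ha hab
    · obtain ⟨y, hy, rfl⟩ := (h.mem b).1 hb
      obtain ⟨x, hx, rfl⟩ := (h.adj y hy a).1 (h.symm _ _ hab)
      by_cases hxn : x < t.n
      · exact key1 _ _ ((h.mem _).2 ⟨x, hxn, rfl⟩) hab
      · exact key x y (mem_allDarts.2 (Or.inr ⟨hy, not_lt.1 hxn, hx⟩))
  · rintro p _ ⟨l, hl, rfl⟩ _ ⟨l', hl', rfl⟩ hp hp'
    rw [edgePieces_map] at hp hp'
    obtain ⟨d, hd, rfl⟩ := List.mem_map.1 hp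
    obtain ⟨d', hd', hdd⟩ := List.mem_map.1 hp'
    simp only [Piece.mk.injEq, and_true] at hdd
    have h1 := mem_of_mem_darts hd
    have h2 := mem_of_mem_darts hd'
    have : d' = d := Prod.ext
      (h.inj _ (hL.lt_size l' hl' _ h2.1) _ (hL.lt_size l hl _ h1.1) hdd.1)
      (h.inj _ (hL.lt_size l' hl' _ h2.2) _ (hL.lt_size l hl _ h1.2) hdd.2)
    rw [hL.unique d l hl l' hl' hd (this ▸ hd')]

theorem _root_.Template.IsRouting.arrive {L : List (List ℕ)} (hL : t.IsRouting L) {s : ℕ}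
    (hs : s ∈ t.slots) : arrive L s ∈ L ∧ (arrive L s).getLast? = some s := by
  obtain ⟨l, hl, hls⟩ := hL.exists_last s hs
  have : (L.find? fun l => l.getLast? == some s).isSome := by
    rw [List.find?_isSome]
    exact ⟨l, hl, by simp [hls]⟩
  obtain ⟨m, hm⟩ := Option.isSome_iff_exists.1 this
  rw [Template.arrive, hm]
  exact ⟨List.mem_of_find?_eq_some hm, by simpa using List.find?_some hm⟩

theorem _root_.Template.IsRouting.depart {L : List (List ℕ)} (hL : t.IsRouting L) {s : ℕ}
    (hs : s ∈ t.slots) : depart L s ∈ L ∧ (depart L s).head? = some s := by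
  obtain ⟨l, hl, hls⟩ := hL.exists_head s hs
  have : (L.find? fun l => l.head? == some s).isSome := by
    rw [List.find?_isSome]
    exact ⟨l, hl, by simp [hls]⟩
  obtain ⟨m, hm⟩ := Option.isSome_iff_exists.1 this
  rw [Template.depart, hm]
  exact ⟨List.mem_of_find?_eq_some hm, by simpa using List.find?_some hm⟩

/-- If the test of a template succeeds, each realization has a safe partition, which comes from a
routing `L` with the property `goal`. -/
theorem exists_safePartition (h : t.Realized E A S ι) {need : List (ℕ × Option ℕ) → Bool}
    {goal : List (ℕ × Option ℕ) → List (List ℕ) → Bool} {rots : List ℕ}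
    (hc : t.check need goal rots = true) {σ : ℕ → Option ℕ} (hσ : t.Outgoing A S ι σ)
    (hneed : need (t.slots.map fun s => (s, σ s)).reverse = true) :
    ∃ L P C, goal (t.slots.map fun s => (s, σ s)).reverse L = true ∧
      SafePartition (piecesOf E A S) S P C ∧
      (∀ l ∈ L, ∀ a b, l.head? = some a → l.getLast? = some b → t.n ≤ a → t.n ≤ b →
        ∃ F ∈ P, SafePath (piecesOf E A S) S (ι a) F (ι b) ∧ F.countP Piece.isArc = 0) ∧
      (∀ l ∈ L, ∀ a s, l.head? = some a → l.getLast? = some s → t.n ≤ a → s < t.n →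
        ∀ o ∉ S, A (ι s) o → ∃ F ∈ P, SafePath (piecesOf E A S) S (ι a) F o) ∧
      (∀ l ∈ L, ∀ s b, l.head? = some s → l.getLast? = some b → s < t.n → t.n ≤ b →
        ∀ o ∉ S, A o (ι s) → ∃ F ∈ P, SafePath (piecesOf E A S) S o F (ι b)) ∧
      (∀ l ∈ L, ∀ l' ∈ L, ∀ a s s' b, l.head? = some a → l.getLast? = some s →
        l'.head? = some s' → l'.getLast? = some b → t.n ≤ a → s < t.n → s' < t.n → t.n ≤ b →
        A (ι s) (ι s') → ∃ F ∈ P, SafePath (piecesOf E A S) S (ι a) F (ι b)) := by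
  classical
  have hlt : ∀ s ∈ t.slots, s < t.size := fun s hs => (t.slots_lt hs).trans_le (size_le t)
  have hιS : ∀ s ∈ t.slots, ι s ∈ S := fun s hs => (h.mem _).2 ⟨s, t.slots_lt hs, rfl⟩
  obtain ⟨L, hL, hcompat, hin, hgoal⟩ := search_sound (t := t) (σ := σ)
    (fun s hs s' hs' => by
      obtain ⟨h1, h2⟩ := ((hσ s hs).1 s').1 hs'
      exact ⟨h1, fun h3 => h.irrefl _ (h3 ▸ h2)⟩)
    (fun s hs s' hs' u hu hu' => by
      obtain ⟨h1, h2⟩ := ((hσ s hs).1 u).1 hu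
      obtain ⟨h3, h4⟩ := ((hσ s' hs').1 u).1 hu'
      exact h.inj _ (hlt s hs) _ (hlt s' hs') ((h.inn u h1).unique h2 h4))
    hneed t.slots [] rfl _ hc
  have hR : t.IsRouting L := isRouting_sound (List.mem_filter.1 hL).2
  have hRt := h.routing hR
  set Sg : Set (List V) := {m | ∃ l ∈ L, m = l.map ι} with hSg
  set W : Set V := {v | ∃ s ∈ t.slots, v = ι s} with hW
  have hidx : ∀ v, ∃ a, v ∈ S → a < t.n ∧ v = ι a := fun v => by
    by_cases hv : v ∈ S
    · obtain ⟨a, ha⟩ := (h.mem v).1 hv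
      exact ⟨a, fun _ => ha⟩
    · exact ⟨0, fun h => absurd h hv⟩
  choose idx hidx using hidx
  have hidx' : ∀ s ∈ t.slots, idx (ι s) = s := fun s hs => by
    obtain ⟨h1, h2⟩ := hidx _ (hιS s hs)
    exact (h.inj _ (hlt s hs) _ (h1.trans_le (size_le t)) h2).symm
  set arr : V → List V := fun v => if v ∈ S then (arrive L (idx v)).map ι else [v] with harr
  set dep : V → List V := fun v => if v ∈ S then (depart L (idx v)).map ι else [v] with hdep
  have harrS : ∀ s ∈ t.slots, arr (ι s) = (arrive L s).map ι := fun s hs => by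
    simp only [harr, hιS s hs, if_true, hidx' s hs]
  have hdepS : ∀ s ∈ t.slots, dep (ι s) = (depart L s).map ι := fun s hs => by
    simp only [hdep, hιS s hs, if_true, hidx' s hs]
  have harrO : ∀ s, s ∉ S → arr s = [s] := fun s hs => by simp only [harr, hs, if_false]
  have hdepO : ∀ s, s ∉ S → dep s = [s] := fun s hs => by simp only [hdep, hs, if_false]
  have hge : ∀ a < t.size, t.n ≤ a → ι a ∉ S := fun a ha h1 h2 => by
    have := (h.mem_iff ha).1 h2
    omega
  have hout : ∀ s ∈ t.slots, t.outOK L s = true → ∀ v, (arr (ι s)).head? = some v → v ∉ S := by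
    intro s hs h1 v hv
    rw [harrS s hs, List.head?_map, Option.map_eq_some_iff] at hv
    obtain ⟨a, ha, rfl⟩ := hv
    rw [outOK, ha] at h1
    exact hge a (hR.lt_size _ (hR.arrive hs).1 a (List.mem_of_mem_head? ha)) (by simpa using h1)
  have hinn : ∀ s ∈ t.slots, t.inOK L s = true → ∀ v, (dep (ι s)).getLast? = some v → v ∉ S := by
    intro s hs h1 v hv
    rw [hdepS s hs, List.getLast?_map, Option.map_eq_some_iff] at hv
    obtain ⟨a, ha, rfl⟩ := hv
    rw [inOK, ha] at h1
    exact hge a (hR.lt_size _ (hR.depart hs).1 a (List.mem_of_getLast? ha)) (by simpa using h1)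
  have hlast : ∀ s, (s ∈ S → s ∈ W) → (arr s).getLast? = some s := by
    intro s hs
    by_cases hsS : s ∈ S
    · obtain ⟨s, hs', rfl⟩ := hs hsS
      rw [harrS s hs', List.getLast?_map, (hR.arrive hs').2]
      rfl
    · rw [harrO s hsS]
      rfl
  have hhead : ∀ s, (s ∈ S → s ∈ W) → (dep s).head? = some s := by
    intro s hs
    by_cases hsS : s ∈ S
    · obtain ⟨s, hs', rfl⟩ := hs hsS
      rw [hdepS s hs', List.head?_map, (hR.depart hs').2]
      rfl
    · rw [hdepO s hsS]
      rfl
  have hC : Routing.Compatible A S W Sg arr dep := by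
    refine ⟨?_, hlast, ?_, harrO, ?_, hhead, ?_, hdepO, ?_, h.arc_mem, ?_, ?_, ?_⟩
    · rintro _ ⟨s, hs, rfl⟩
      exact ⟨_, (hR.arrive hs).1, harrS s hs⟩
    · rintro _ ⟨s, hs, rfl⟩ _ ⟨l, hl, rfl⟩ hls
      rw [List.getLast?_map, Option.map_eq_some_iff] at hls
      obtain ⟨a, ha, has⟩ := hls
      have := h.inj a (hR.lt_size l hl a (List.mem_of_getLast? ha)) s (hlt s hs) has
      subst this
      rw [harrS a hs, hR.last_unique l hl _ (hR.arrive hs).1 a ha (hR.arrive hs).2]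
    · rintro _ ⟨s, hs, rfl⟩
      exact ⟨_, (hR.depart hs).1, hdepS s hs⟩
    · rintro _ ⟨s, hs, rfl⟩ _ ⟨l, hl, rfl⟩ hls
      rw [List.head?_map, Option.map_eq_some_iff] at hls
      obtain ⟨a, ha, has⟩ := hls
      have := h.inj a (hR.lt_size l hl a (List.mem_of_mem_head? ha)) s (hlt s hs) has
      subst this
      rw [hdepS a hs, hR.head_unique l hl _ (hR.depart hs).1 a ha (hR.depart hs).2]
    · rintro _ ⟨s, hs, rfl⟩
      exact hιS s hs
    · rintro _ ⟨s, hs, rfl⟩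
      exact h.out s hs
    · rintro _ ⟨s, hs, rfl⟩
      exact h.inn s hs
    · intro u v huv htouch
      by_cases hu : u ∈ S <;> by_cases hv : v ∈ S
      · obtain ⟨s, hs, rfl⟩ := (h.arc_mem u v huv).1 hu
        obtain ⟨s', hs', rfl⟩ := (h.arc_mem _ v huv).2 hv
        have h1 := hcompat s hs
        rw [((hσ s hs).1 s').2 ⟨hs', huv⟩, compat, arcOK, Bool.or_eq_true] at h1
        rcases h1 with h1 | h1
        · exact Or.inl ⟨hu, hv, by rw [harrS s hs, hdepS s' hs', eq_of_beq h1]⟩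
        · simp only [Bool.and_eq_true, List.all_eq_true, Bool.not_eq_true',
            List.contains_eq_mem, decide_eq_false_iff_not] at h1
          refine Or.inr ⟨hout s hs h1.1.1, hinn s' hs' h1.1.2, ?_⟩
          rw [harrS s hs, hdepS s' hs']
          intro w hw hw'
          obtain ⟨a, ha, rfl⟩ := List.mem_map.1 hw
          obtain ⟨b, hb, hab⟩ := List.mem_map.1 hw'
          have := h.inj b (hR.lt_size _ (hR.depart hs').1 b hb) a
            (hR.lt_size _ (hR.arrive hs).1 a ha) hab
          exact h1.2 a ha (this ▸ hb)
      · obtain ⟨s, hs, rfl⟩ := (h.arc_mem u v huv).1 hu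
        have h1 := hcompat s hs
        rw [(hσ s hs).2.2 fun w hw => (h.out s hs).unique hw huv ▸ hv, compat] at h1
        refine Or.inr ⟨hout s hs h1, ?_, ?_⟩
        · rw [hdepO v hv]
          rintro w hw
          simp only [List.getLast?_singleton, Option.some_inj] at hw
          exact hw ▸ hv
        · rw [hdepO v hv, harrS s hs]
          intro w hw hw'
          obtain ⟨a, ha, rfl⟩ := List.mem_map.1 hw
          rw [List.mem_singleton] at hw'
          have hasz := hR.lt_size _ (hR.arrive hs).1 a ha
          by_cases han : a < t.n
          · exact hv (hw' ▸ (h.mem_iff hasz).2 han)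
          · exact (h.ext _ _ huv s (t.slots_lt hs) a hasz (not_lt.1 han)).1 rfl hw'.symm
      · obtain ⟨s, hs, rfl⟩ := (h.arc_mem u v huv).2 hv
        have h1 := hin s hs fun s' hs' hss => hu ((h.inn s hs).unique
          (((hσ s' hs').1 s).1 hss).2 huv ▸ hιS s' hs')
        refine Or.inr ⟨?_, hinn s hs h1, ?_⟩
        · rw [harrO u hu]
          rintro w hw
          simp only [List.head?_cons, Option.some_inj] at hw
          exact hw ▸ hu
        · rw [harrO u hu, hdepS s hs]
          intro w hw' hw
          obtain ⟨a, ha, rfl⟩ := List.mem_map.1 hw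
          rw [List.mem_singleton] at hw'
          have hasz := hR.lt_size _ (hR.depart hs).1 a ha
          by_cases han : a < t.n
          · exact hu (hw' ▸ (h.mem_iff hasz).2 han)
          · exact (h.ext _ _ huv s (t.slots_lt hs) a hasz (not_lt.1 han)).2 rfl hw'.symm
      · exact absurd htouch (by tauto)
  -- the paths formed by routes and arcs
  have hpath : ∀ u v a b, A u v → u ∈ S ∨ v ∈ S → ¬ (u ∈ S ∧ v ∈ S ∧ arr u = dep v) →
      (arr u).head? = some a → (dep v).getLast? = some b →
      ∃ F ∈ {p | ∃ l ∈ Sg, (∀ v, l.head? = some v → v ∉ S) ∧ (∀ v, l.getLast? = some v → v ∉ S) ∧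
          p = edgePieces l} ∪
        {p | ∃ s t, A s t ∧ (s ∈ S ∨ t ∈ S) ∧ ¬ (s ∈ S ∧ t ∈ S ∧ arr s = dep t) ∧
          p = joinedPath arr dep s t}, SafePath (piecesOf E A S) S a F b := fun u v a b huv h1 h2 ha hb =>
    ⟨_, Or.inr ⟨u, v, huv, h1, h2, rfl⟩, hC.joinedPath_safe hRt huv h1 h2 ha hb⟩
  have hslot : ∀ l ∈ L, ∀ s, l.getLast? = some s → s < t.n → s ∈ t.slots ∧ l = arrive L s := by
    intro l hl s hs h1
    have hs' := (hR.last l hl s hs).resolve_left (by omega)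
    exact ⟨hs', hR.last_unique l hl _ (hR.arrive hs').1 s hs (hR.arrive hs').2⟩
  have hslot' : ∀ l ∈ L, ∀ s, l.head? = some s → s < t.n → s ∈ t.slots ∧ l = depart L s := by
    intro l hl s hs h1
    have hs' := (hR.head l hl s hs).resolve_left (by omega)
    exact ⟨hs', hR.head_unique l hl _ (hR.depart hs').1 s hs (hR.depart hs').2⟩
  refine ⟨L, _, _, hgoal, hC.safePartition hRt, ?_, ?_, ?_, ?_⟩
  · intro l hl a b ha hb han hbn
    have haS := hge a (hR.lt_size l hl a (List.mem_of_mem_head? ha)) han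
    have hbS := hge b (hR.lt_size l hl b (List.mem_of_getLast? hb)) hbn
    have hmem : edgePieces (l.map ι) ∈ ({p | ∃ l ∈ Sg, (∀ v, l.head? = some v → v ∉ S) ∧
        (∀ v, l.getLast? = some v → v ∉ S) ∧ p = edgePieces l} : Set (List (Piece V))) := by
      refine ⟨l.map ι, ⟨l, hl, rfl⟩, fun v hv => ?_, fun v hv => ?_, rfl⟩
      · rw [List.head?_map, ha, Option.map_some, Option.some_inj] at hv
        exact hv ▸ haS
      · rw [List.getLast?_map, hb, Option.map_some, Option.some_inj] at hv
        exact hv ▸ hbS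
    refine ⟨_, Or.inl hmem, ?_, countP_edgePieces _⟩
    obtain ⟨u, v, huv⟩ := (hC.safePartition hRt).path _ (Or.inl hmem)
    obtain ⟨x, M, rfl⟩ : ∃ x M, l = x :: M := by
      cases l with
      | nil => simp at ha
      | cons x M => exact ⟨x, M, rfl⟩
    rw [List.head?_cons, Option.some_inj] at ha
    subst ha
    have hw : IsPieceWalk (ι x) (edgePieces ((x :: M).map ι)) (ι b) := by
      rw [List.map_cons]
      refine edgePieces_walk ?_
      rw [← List.map_cons, List.getLast?_map, hb]
      rfl
    have h1 := huv.walk.start_unique huv.ne_nil hw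
    subst h1
    have h2 := huv.walk.unique hw
    subst h2
    exact huv
  · intro l hl a s ha hs han hsn o ho hso
    obtain ⟨hs', rfl⟩ := hslot l hl s hs hsn
    refine hpath (ι s) o (ι a) o hso (Or.inl (hιS s hs')) (fun h1 => ho h1.2.1) ?_ ?_
    · rw [harrS s hs', List.head?_map, ha]
      rfl
    · rw [hdepO o ho]
      rfl
  · intro l hl s b hs hb hsn hbn o ho hso
    obtain ⟨hs', rfl⟩ := hslot' l hl s hs hsn
    refine hpath o (ι s) o (ι b) hso (Or.inr (hιS s hs')) (fun h1 => ho h1.1) ?_ ?_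
    · rw [harrO o ho]
      rfl
    · rw [hdepS s hs', List.getLast?_map, hb]
      rfl
  · intro l hl l' hl' a s s' b ha hs hs' hb han hsn hsn' hbn hss
    obtain ⟨h1, rfl⟩ := hslot l hl s hs hsn
    obtain ⟨h2, rfl⟩ := hslot' l' hl' s' hs' hsn'
    have ha' : (arr (ι s)).head? = some (ι a) := by
      rw [harrS s h1, List.head?_map, ha]
      rfl
    refine hpath (ι s) (ι s') (ι a) (ι b) hss (Or.inl (hιS s h1)) (fun h3 => ?_) ha' ?_
    · have h4 := hhead (ι s') fun _ => ⟨s', h2, rfl⟩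
      rw [← h3.2.2, ha', Option.some_inj] at h4
      have := h.inj a (hR.lt_size _ (hR.arrive h1).1 a (List.mem_of_mem_head? ha)) s' (hlt s' h2) h4
      omega
    · rw [hdepS s' h2, List.getLast?_map, hb]
      rfl

end Realized

end Template

/-! ### Members of the fork-collection in a host graph -/

section Hosts
variable {V : Type*}

/-- The graph `B` in its surroundings: `E` is the adjacency relation of the edges and `A` is the
relation given by the arcs. Inside `B` the edges are those of `B`, each vertex in `C` has just one
neighbour outside, these neighbours are distinct and are no ends of arcs at `B`, and the arcs at `B`
are one entering and one leaving each vertex of `W`. -/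
structure Host (E A : V → V → Prop) (B : PGraph V) (C W : Set V) : Prop where
  symm : ∀ u v, E u v → E v u
  adj : ∀ u ∈ B.verts, ∀ v ∈ B.verts, E u v ↔ B.Adj u v
  half : ∀ c ∈ C, ∃! t, t ∉ B.verts ∧ E c t
  half_mem : ∀ v ∈ B.verts, ∀ t, t ∉ B.verts → E v t → v ∈ C
  half_inj : ∀ c ∈ B.verts, ∀ c' ∈ B.verts, ∀ t, t ∉ B.verts → E c t → E c' t → c = c'
  out : ∀ s ∈ W, ∃! v, A s v
  inn : ∀ s ∈ W, ∃! v, A v s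
  arc_mem : ∀ u v, A u v → (u ∈ B.verts → u ∈ W) ∧ (v ∈ B.verts → v ∈ W)
  irrefl : ∀ v, ¬ A v v
  ext_out : ∀ u v, A u v → u ∈ B.verts → v ∉ B.verts → ∀ s ∈ B.verts, ¬ E s v
  ext_in : ∀ u v, A u v → v ∈ B.verts → u ∉ B.verts → ∀ s ∈ B.verts, ¬ E s u

/-- The directed edges at `S` have a partition into safe paths and safe cycles. -/
def Reducible (E A : V → V → Prop) (S : Set V) : Prop :=
  ∃ P C, SafePartition (piecesOf E A S) S P C

/-- The graph `B` is the template, with vertices named by `ι`. -/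
structure Template.Shaped (t : Template) (B : PGraph V) (ι : ℕ → V) : Prop where
  inj : ∀ a < t.n, ∀ b < t.n, ι a = ι b → a = b
  verts : ∀ v, v ∈ B.verts ↔ ∃ a < t.n, v = ι a
  adj : ∀ a < t.n, ∀ b < t.n, B.Adj (ι a) (ι b) ↔ (a, b) ∈ t.edges ∨ (b, a) ∈ t.edges

/-- The edges and half-edges of the template are attached to vertices of the template. -/
structure Template.WellFormed (t : Template) : Prop where
  edges : ∀ e ∈ t.edges, e.1 < t.n ∧ e.2 < t.n
  halves : ∀ a ∈ t.halves, a < t.n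
  nodup : t.halves.Nodup

theorem Template.mem_nbrs {t : Template} {a b : ℕ} : b ∈ t.nbrs a ↔
    (a, b) ∈ t.edges ∨ (b, a) ∈ t.edges ∨ ∃ k, t.halves[k]? = some a ∧ b = t.n + k := by
  simp only [nbrs, List.mem_append, List.mem_filterMap, List.mem_zipIdx_iff_getElem?, Prod.exists]
  constructor
  · rintro (⟨x, y, hxy, h⟩ | ⟨x, k, hk, h⟩)
    · split_ifs at h with h1 h2
      · rw [Option.some_inj] at h
        subst h1 h
        exact Or.inl hxy
      · rw [Option.some_inj] at h
        subst h2 h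
        exact Or.inr (Or.inl hxy)
    · split_ifs at h with h1
      rw [Option.some_inj] at h
      subst h1
      exact Or.inr (Or.inr ⟨k, by simpa using hk, h.symm⟩)
  · rintro (h | h | ⟨k, hk, rfl⟩)
    · exact Or.inl ⟨a, b, h, by simp⟩
    · refine Or.inl ⟨b, a, h, ?_⟩
      by_cases hab : b = a <;> simp [hab]
    · exact Or.inr ⟨a, k, by simpa using hk, by simp⟩

theorem PGraph.HasShape.shaped {B : PGraph V} {vs : List V} {t : Template} (d : V)
    (h : B.HasShape vs (t.edges.map fun e => (vs.getD e.1 d, vs.getD e.2 d)))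
    (hn : vs.length = t.n) (ht : t.WellFormed) : t.Shaped B fun k => vs.getD k d := by
  have hinj : ∀ a < t.n, ∀ b < t.n, vs.getD a d = vs.getD b d → a = b := by
    intro a ha b hb hab
    rw [← hn] at ha hb
    rw [List.getD_eq_getElem _ _ ha, List.getD_eq_getElem _ _ hb] at hab
    exact (h.1.getElem_inj_iff).1 hab
  refine ⟨hinj, ?_, ?_⟩
  · intro v
    rw [h.2.1, Set.mem_ofPred_eq, List.mem_iff_getElem]
    constructor
    · rintro ⟨a, ha, rfl⟩
      exact ⟨a, hn ▸ ha, by simp [ha]⟩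
    · rintro ⟨a, ha, rfl⟩
      exact ⟨a, hn ▸ ha, by rw [List.getD_eq_getElem]⟩
  · intro a ha b hb
    rw [h.2.2]
    have key : ∀ a < t.n, ∀ b < t.n, (vs.getD a d, vs.getD b d) ∈
        (t.edges.map fun e => (vs.getD e.1 d, vs.getD e.2 d)) ↔ (a, b) ∈ t.edges := by
      intro a ha b hb
      constructor
      · intro h1
        obtain ⟨e, he, h2⟩ := List.mem_map.1 h1
        rw [Prod.mk.injEq] at h2
        have := ht.edges e he
        have h3 := hinj _ this.1 _ ha h2.1
        have h4 := hinj _ this.2 _ hb h2.2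
        rwa [← h3, ← h4]
      · exact fun h1 => List.mem_map.2 ⟨_, h1, rfl⟩
    rw [key a ha b hb, key b hb a ha]

theorem Host.realized {E A : V → V → Prop} {B : PGraph V} {C W : Set V} (h : Host E A B C W)
    {t : Template} {ι : ℕ → V} (ht : t.WellFormed) (hs : t.Shaped B ι)
    (hC : ∀ v, v ∈ C ↔ ∃ a ∈ t.halves, v = ι a) (hW : ∀ v, v ∈ W ↔ ∃ s ∈ t.slots, v = ι s) :
    ∃ ι', (∀ a < t.n, ι' a = ι a) ∧
      (∀ k a, t.halves[k]? = some a → E (ι a) (ι' (t.n + k)) ∧ ι' (t.n + k) ∉ B.verts) ∧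
      t.Realized E A B.verts ι' := by
  have hvS : ∀ a < t.n, ι a ∈ B.verts := fun a ha => (hs.verts _).2 ⟨a, ha, rfl⟩
  have hhalf : ∀ c, ∃ x, c ∈ C → x ∉ B.verts ∧ E c x := fun c => by
    by_cases hc : c ∈ C
    · obtain ⟨x, hx, -⟩ := h.half c hc
      exact ⟨x, fun _ => hx⟩
    · exact ⟨c, fun h => absurd h hc⟩
  choose τ hτ using hhalf
  set ι' : ℕ → V := fun k => if k < t.n then ι k else τ (ι (t.halves.getD (k - t.n) 0)) with hι'
  have hlow : ∀ a < t.n, ι' a = ι a := fun a ha => by simp only [hι', ha, if_true]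
  have hhigh : ∀ k a, t.halves[k]? = some a → ι' (t.n + k) = τ (ι a) := by
    intro k a hk
    have h1 : ¬ t.n + k < t.n := by omega
    simp only [hι', h1, if_false]
    rw [Nat.add_sub_cancel_left, List.getD_eq_getElem?_getD, hk, Option.getD_some]
  have hCa : ∀ k a, t.halves[k]? = some a → ι a ∈ C := fun k a hk =>
    (hC _).2 ⟨a, List.mem_of_getElem? hk, rfl⟩
  have hhigh' : ∀ b < t.size, t.n ≤ b → ∃ k a, t.halves[k]? = some a ∧ b = t.n + k := by
    intro b hb hbn
    obtain ⟨k, rfl⟩ := Nat.exists_eq_add_of_le hbn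
    have hk : k < t.halves.length := by
      rw [Template.size] at hb
      omega
    exact ⟨k, t.halves[k], List.getElem?_eq_getElem hk, rfl⟩
  refine ⟨ι', hlow, fun k a hk => ?_, ?_, ?_, h.symm, ?_, ?_, ?_, ?_, h.irrefl, ?_⟩
  · rw [hhigh k a hk]
    exact (hτ _ (hCa k a hk)).symm
  · intro a ha b hb hab
    by_cases han : a < t.n <;> by_cases hbn : b < t.n
    · rw [hlow a han, hlow b hbn] at hab
      exact hs.inj a han b hbn hab
    · obtain ⟨k, c, hk, rfl⟩ := hhigh' b hb (not_lt.1 hbn)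
      rw [hlow a han, hhigh k c hk] at hab
      exact absurd (hab ▸ hvS a han) (hτ _ (hCa k c hk)).1
    · obtain ⟨k, c, hk, rfl⟩ := hhigh' a ha (not_lt.1 han)
      rw [hlow b hbn, hhigh k c hk] at hab
      exact absurd (hab ▸ hvS b hbn) (hτ _ (hCa k c hk)).1
    · obtain ⟨k, c, hk, rfl⟩ := hhigh' a ha (not_lt.1 han)
      obtain ⟨k', c', hk', rfl⟩ := hhigh' b hb (not_lt.1 hbn)
      rw [hhigh k c hk, hhigh k' c' hk'] at hab
      have hc := ht.halves c (List.mem_of_getElem? hk)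
      have hc' := ht.halves c' (List.mem_of_getElem? hk')
      have h1 := h.half_inj (ι c) (hvS c hc) (ι c') (hvS c' hc') _ (hτ _ (hCa k c hk)).1
        (hτ _ (hCa k c hk)).2 (hab ▸ (hτ _ (hCa k' c' hk')).2)
      have h2 := hs.inj c hc c' hc' h1
      subst h2
      have hkl : k < t.halves.length := by
        by_contra h3
        rw [List.getElem?_eq_none (not_lt.1 h3)] at hk
        exact absurd hk (by simp)
      rw [(List.getElem?_inj hkl ht.nodup).1 (hk.trans hk'.symm)]
  · intro v
    rw [hs.verts]
    constructor
    · rintro ⟨a, ha, rfl⟩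
      exact ⟨a, ha, (hlow a ha).symm⟩
    · rintro ⟨a, ha, rfl⟩
      exact ⟨a, ha, hlow a ha⟩
  · intro a ha w
    rw [hlow a ha]
    constructor
    · intro hw
      by_cases hwB : w ∈ B.verts
      · obtain ⟨b, hb, rfl⟩ := (hs.verts w).1 hwB
        rw [h.adj _ (hvS a ha) _ hwB, hs.adj a ha b hb] at hw
        exact ⟨b, Template.mem_nbrs.2 (by tauto), (hlow b hb).symm⟩
      · have haC := h.half_mem _ (hvS a ha) w hwB hw
        obtain ⟨c, hc, hac⟩ := (hC _).1 haC
        have := hs.inj a ha c (ht.halves c hc) hac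
        subst this
        obtain ⟨k, hk⟩ := List.mem_iff_getElem?.1 hc
        refine ⟨t.n + k, Template.mem_nbrs.2 (Or.inr (Or.inr ⟨k, hk, rfl⟩)), ?_⟩
        rw [hhigh k a hk]
        exact (h.half _ haC).unique ⟨hwB, hw⟩ (hτ _ haC)
    · rintro ⟨b, hb, rfl⟩
      rcases Template.mem_nbrs.1 hb with h1 | h1 | ⟨k, hk, rfl⟩
      · have hb := (ht.edges _ h1).2
        rw [hlow b hb, h.adj _ (hvS a ha) _ (hvS b hb), hs.adj a ha b hb]
        exact Or.inl h1
      · have hb := (ht.edges _ h1).1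
        rw [hlow b hb, h.adj _ (hvS a ha) _ (hvS b hb), hs.adj a ha b hb]
        exact Or.inr h1
      · rw [hhigh k a hk]
        exact (hτ _ (hCa k a hk)).2
  · intro u v huv
    have hslot : ∀ x, x ∈ W → ∃ s ∈ t.slots, x = ι' s := by
      intro x hx
      obtain ⟨s, hs', rfl⟩ := (hW x).1 hx
      exact ⟨s, hs', (hlow s (t.slots_lt hs')).symm⟩
    exact ⟨fun hu => hslot u ((h.arc_mem u v huv).1 hu),
      fun hv => hslot v ((h.arc_mem u v huv).2 hv)⟩
  · intro s hs'
    rw [hlow s (t.slots_lt hs')]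
    exact h.out _ ((hW _).2 ⟨s, hs', rfl⟩)
  · intro s hs'
    rw [hlow s (t.slots_lt hs')]
    exact h.inn _ ((hW _).2 ⟨s, hs', rfl⟩)
  · intro u v huv a ha b hb hbn
    obtain ⟨k, c, hk, rfl⟩ := hhigh' b hb hbn
    have hc := ht.halves c (List.mem_of_getElem? hk)
    rw [hlow a ha, hhigh k c hk]
    have h1 := hτ _ (hCa k c hk)
    constructor
    · rintro rfl rfl
      exact h.ext_out _ _ huv (hvS a ha) h1.1 _ (hvS c hc) h1.2
    · rintro rfl rfl
      exact h.ext_in _ _ huv (hvS a ha) h1.1 _ (hvS c hc) h1.2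

/-- A host of a graph is reducible if the test of a template of the graph succeeds. -/
theorem Host.reducible {E A : V → V → Prop} {B : PGraph V} {C W : Set V} (h : Host E A B C W)
    {t : Template} {ι : ℕ → V} (ht : t.WellFormed) (hs : t.Shaped B ι)
    (hC : ∀ v, v ∈ C ↔ ∃ a ∈ t.halves, v = ι a) (hW : ∀ v, v ∈ W ↔ ∃ s ∈ t.slots, v = ι s)
    {need : List (ℕ × Option ℕ) → Bool} {goal : List (ℕ × Option ℕ) → List (List ℕ) → Bool}
    {rots : List ℕ} (hc : t.check need goal rots = true)
    (hneed : ∀ σ, t.Outgoing A B.verts ι σ → need (t.slots.map fun s => (s, σ s)).reverse = true) :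
    Reducible E A B.verts := by
  obtain ⟨ι', h1, -, hR⟩ := h.realized ht hs hC hW
  obtain ⟨σ, hσ⟩ := hR.exists_outgoing
  obtain ⟨-, P, C, -, hP, -⟩ := hR.exists_safePartition hc hσ (hneed σ fun s hs' => by
    refine ⟨fun s' => ?_, ?_⟩
    · rw [(hσ s hs').1 s', h1 s (t.slots_lt hs')]
      refine and_congr_right fun h2 => ?_
      rw [h1 s' (t.slots_lt h2)]
    · rw [(hσ s hs').2, h1 s (t.slots_lt hs')])
  exact ⟨P, C, hP⟩

end Hosts

namespace Template

/-- The subfork. -/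
def subfork : Template := ⟨2, [(0, 1)], [0, 1]⟩

/-- The star fork with centre `0`. -/
def starFork : Template := ⟨4, [(0, 1), (0, 2), (0, 3)], [1, 2, 3]⟩

/-- The fork, with the vertices `x`, `y`, `z`, `a`, `b` numbered in this order. -/
def fork : Template := ⟨5, [(2, 0), (2, 1), (2, 4), (4, 3)], [0, 1, 3]⟩

/-- The p-fork, with the vertices `l`, `x`, `y`, `a`, `b`, `p`, `q`, `z` numbered in this order. -/
def pFork : Template :=
  ⟨8, [(3, 5), (5, 1), (1, 4), (4, 6), (6, 2), (2, 3), (7, 3), (7, 4), (7, 0)], [0, 1, 2]⟩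

/-- The fork with a star fork attached at `u` and `w`. The new vertices are `5` (the centre), `6`,
`7` and `8`. -/
def extendedFork (u w : ℕ) : Template :=
  ⟨9, [(2, 0), (2, 1), (2, 4), (4, 3), (5, 6), (5, 7), (5, 8), (6, u), (7, w)], [0, 1, 3, 8]⟩

theorem subfork_check : subfork.check (fun _ => true) (fun _ _ => true) [0, 1, 2] = true := by
  decide +kernel

theorem starFork_check :
    starFork.check (fun _ => true) (fun _ _ => true) [0, 1, 2, 3, 5] = true := by
  decide +kernel

/-- The fork can be routed if no arc leaves it. This restriction cannot be dropped. -/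
theorem fork_check : fork.check (fun acc => acc.all fun q => q.2.isSome) (fun _ _ => true)
    [0, 2, 4, 8, 9, 11, 14, 27, 31] = true := by
  decide +kernel

theorem pFork_check :
    pFork.check (fun _ => true) (fun _ _ => true) [28, 61, 67, 5, 29, 88, 191, 30] = true := by
  decide +kernel

/-- The routing contains a route from `a` to `b`. -/
def hasRoute (L : List (List ℕ)) (a b : ℕ) : Bool :=
  L.any fun l => l.head? == some a && l.getLast? == some b

/-- The star fork can be routed so that a given arc that leaves it to the outside is reached from
the first or the second half-edge. -/
theorem starFork_out : ([1, 2, 3].all fun s => starFork.check (fun acc => acc.any (· == (s, none)))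
    (fun _ L => hasRoute L 4 s || hasRoute L 5 s) (List.range 16)) = true := by
  decide +kernel

/-- The star fork can be routed so that a given arc that enters it from the outside leads on to the
first or the second half-edge. -/
theorem starFork_in : ([1, 2, 3].all fun s =>
    starFork.check (fun acc => acc.all fun q => !(q.2 == some s))
      (fun _ L => hasRoute L s 4 || hasRoute L s 5) (List.range 16)) = true := by
  decide +kernel

/-- If an arc joins the third leaf of the star fork to another leaf, the star fork can be routed so
that a path leads from the first to the second half-edge or back. -/
theorem starFork_turn : starFork.check
    (fun acc => acc.any fun q => (q.1 == 3 && q.2.isSome) || q.2 == some 3)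
    (fun acc L => [(4, 5), (5, 4)].any fun e => hasRoute L e.1 e.2 || acc.any fun q =>
      q.2.any fun s => hasRoute L e.1 q.1 && hasRoute L s e.2) (List.range 16) = true := by
  decide +kernel

/-- If an arc leads from the first to the second leaf of the star fork, but the third leaf has no
arcs to or from the others, then the star fork can be routed so that a path without arcs leads from
the third half-edge to the second one. -/
theorem starFork_pass : starFork.check
    (fun acc => acc.any (· == (1, some 2)) && acc.any (· == (3, none)) &&
      acc.all fun q => !(q.2 == some 3))
    (fun _ L => hasRoute L 6 5) (List.range 16) = true := by
  decide +kernel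

end Template

/-! ### Routings of the fork with an attached star fork

The star fork may be attached at any two of the vertices `x`, `y`, `a`, `b` of the fork. Up to the
symmetry that exchanges `x` and `y`, and up to the order of the two vertices, there are four cases.
In each of them it is enough that one arc has both ends in the graph. -/

namespace Template

theorem extendedFork_check_0_1 : (extendedFork 0 1).check
    (fun acc => acc.any fun q => q.2.isSome) (fun _ _ => true)
    [12, 15, 40, 7, 56, 488, 172, 494, 80, 476, 483, 47, 457, 463, 13, 362, 303, 339, 3, 60,
      141, 363, 399, 28, 35, 72, 180, 124, 344, 423, 54, 131, 52, 88, 105, 167, 16, 468, 19,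
      499, 4, 18, 23, 26, 32, 42, 46, 61, 113] = true := by
  decide +kernel

theorem extendedFork_check_0_3 : (extendedFork 0 3).check
    (fun acc => acc.any fun q => q.2.isSome) (fun _ _ => true)
    [5, 58, 18, 466, 506, 498, 453, 1, 477, 57, 510, 333, 457, 484, 129, 454, 493, 365, 301,
      475, 54, 56, 455, 150, 178, 210, 349, 489, 13, 36, 380, 19, 41, 185, 406, 27, 29, 30,
      179, 8, 14, 48, 84, 93, 130, 134, 2, 31, 70, 137] = true := by
  decide +kernel

theorem extendedFork_check_0_4 : (extendedFork 0 4).check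
    (fun acc => acc.any fun q => q.2.isSome) (fun _ _ => true)
    [21, 42, 1, 449, 490, 481, 298, 378, 145, 213, 485, 17, 457, 510, 461, 58, 161, 46, 318,
      14, 51, 54, 13, 163, 347, 3, 193, 20, 110, 508, 24, 176, 15, 348, 401, 498, 12, 499, 40,
      52, 108, 286, 382, 23, 69, 86, 129, 134, 465] = true := by
  decide +kernel

theorem extendedFork_check_3_4 : (extendedFork 3 4).check
    (fun acc => acc.any fun q => q.2.isSome) (fun _ _ => true)
    [8, 51, 24, 27, 32, 499, 12, 55, 156, 96, 2, 291, 59, 3, 287, 25, 61, 472, 295, 104, 39,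
      450, 509, 224, 108, 0, 63, 38, 60, 248, 484, 48, 52, 315, 9, 10, 36, 50, 7, 26, 28, 29,
      33, 34, 37, 98, 106, 134, 194, 226] = true := by
  decide +kernel

end Template

/-! ### Attached star forks -/

section Attached
variable {V : Type*}

/-- `B` arises from `B'` and the star fork `T` with centre `z` and leaves `x`, `y`, `c` by joining
`x` to `u` and `y` to `w`. -/
structure StarAttached (B' T B : PGraph V) (z x y c u w : V) : Prop where
  star : T.IsStarForkOn z x y c
  disj : Disjoint B'.verts T.verts
  ne : u ≠ w
  hu : u ∈ B'.verts
  hw : w ∈ B'.verts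
  verts : B.verts = B'.verts ∪ T.verts
  adj : ∀ s t, B.Adj s t ↔ B'.Adj s t ∨ T.Adj s t ∨ s(s, t) = s(x, u) ∨ s(s, t) = s(y, w)

theorem PGraph.IsStarForkOn.swap {T : PGraph V} {z x y c : V} (h : T.IsStarForkOn z x y c) :
    T.IsStarForkOn z y x c := by
  obtain ⟨h1, h2, h3⟩ := h
  refine ⟨?_, ?_, fun s t => ?_⟩
  · simp only [List.nodup_cons, List.mem_cons, List.not_mem_nil, or_false, not_or] at h1 ⊢
    tauto
  · rw [h2]
    ext v
    simp only [List.mem_cons, List.not_mem_nil, or_false, Set.mem_ofPred_eq]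
    tauto
  · rw [h3]
    simp only [List.mem_cons, List.not_mem_nil, or_false]
    tauto

theorem StarAttached.swap {B' T B : PGraph V} {z x y c u w : V}
    (h : StarAttached B' T B z x y c u w) : StarAttached B' T B z y x c w u :=
  ⟨h.star.swap, h.disj, h.ne.symm, h.hw, h.hu, h.verts, fun s t => by rw [h.adj]; tauto⟩

/-- A star fork attached to `B'`, together with the surroundings of the resulting graph. -/
structure AttachedHost (E A : V → V → Prop) (B' T B : PGraph V) (C W : Set V) (z x y c u w : V) :
    Prop where
  att : StarAttached B' T B z x y c u w
  host : Host E A B (insert c C) ((W \ {u, w}) ∪ {x, y, c})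
  hC : C ⊆ B'.verts
  hW : W ⊆ B'.verts
  hu : u ∈ W
  hw : w ∈ W

namespace AttachedHost
variable {E A : V → V → Prop} {B' T B : PGraph V} {C W : Set V} {z x y c u w : V}

theorem swap (H : AttachedHost E A B' T B C W z x y c u w) :
    AttachedHost E A B' T B C W z y x c w u := by
  refine ⟨H.att.swap, ?_, H.hC, H.hW, H.hw, H.hu⟩
  have h1 : (W \ {w, u}) ∪ {y, x, c} = (W \ {u, w}) ∪ ({x, y, c} : Set V) := by
    ext v
    simp only [Set.mem_union, Set.mem_sdiff, Set.mem_insert_iff, Set.mem_singleton_iff]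
    tauto
  rw [h1]
  exact H.host

theorem mem_T (H : AttachedHost E A B' T B C W z x y c u w) {v : V} :
    v ∈ T.verts ↔ v = z ∨ v = x ∨ v = y ∨ v = c := by
  rw [H.att.star.2.1]
  simp

theorem mem_B (H : AttachedHost E A B' T B C W z x y c u w) {v : V} :
    v ∈ B.verts ↔ v ∈ B'.verts ∨ v ∈ T.verts := by
  rw [H.att.verts]
  rfl

theorem notMem_T (H : AttachedHost E A B' T B C W z x y c u w) {v : V} (hv : v ∈ B'.verts) :
    v ∉ T.verts := Set.disjoint_left.1 H.att.disj hv

theorem distinct (H : AttachedHost E A B' T B C W z x y c u w) :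
    z ≠ x ∧ z ≠ y ∧ z ≠ c ∧ x ≠ y ∧ x ≠ c ∧ y ≠ c := by
  have := H.att.star.1
  simp only [List.nodup_cons, List.mem_cons, List.not_mem_nil, or_false, not_or, not_false_eq_true,
    List.nodup_nil, and_true] at this
  tauto

theorem hx (H : AttachedHost E A B' T B C W z x y c u w) : x ∈ T.verts := H.mem_T.2 (by tauto)
theorem hy (H : AttachedHost E A B' T B C W z x y c u w) : y ∈ T.verts := H.mem_T.2 (by tauto)
theorem hc (H : AttachedHost E A B' T B C W z x y c u w) : c ∈ T.verts := H.mem_T.2 (by tauto)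

theorem mem_W_of_T (H : AttachedHost E A B' T B C W z x y c u w) {v : V} (hv : v ∈ T.verts) :
    v ∈ (W \ {u, w}) ∪ ({x, y, c} : Set V) ↔ v = x ∨ v = y ∨ v = c := by
  have : v ∉ W := fun h => H.notMem_T (H.hW h) hv
  simp [this]

theorem mem_W_of_B' (H : AttachedHost E A B' T B C W z x y c u w) {v : V} (hv : v ∈ B'.verts) :
    v ∈ (W \ {u, w}) ∪ ({x, y, c} : Set V) ↔ v ∈ W ∧ v ≠ u ∧ v ≠ w := by
  have h1 := H.notMem_T hv
  rw [H.mem_T] at h1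
  simp only [Set.mem_union, Set.mem_sdiff, Set.mem_insert_iff, Set.mem_singleton_iff]
  tauto

/-- The edges of `B` that leave `T`. -/
theorem adj_T (H : AttachedHost E A B' T B C W z x y c u w) {s t : V} (hs : s ∈ T.verts)
    (ht : t ∈ B'.verts) : E s t ↔ (s = x ∧ t = u) ∨ (s = y ∧ t = w) := by
  have h1 := H.notMem_T ht
  rw [H.host.adj s (H.mem_B.2 (Or.inr hs)) t (H.mem_B.2 (Or.inl ht)), H.att.adj]
  have h2 : ¬ B'.Adj s t := fun h => H.notMem_T (B'.edge_vert h) hs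
  have h3 : ¬ T.Adj s t := fun h => h1 (T.edge_vert h.symm)
  simp only [h2, h3, false_or, Sym2.eq_iff]
  have h4 : s ≠ u := fun h => H.notMem_T H.att.hu (h ▸ hs)
  have h5 : s ≠ w := fun h => H.notMem_T H.att.hw (h ▸ hs)
  tauto

/-- The only other edge that leaves `T` is the one at `c`. -/
theorem exists_outer (H : AttachedHost E A B' T B C W z x y c u w) :
    ∃ o, o ∉ B.verts ∧ ∀ s ∈ T.verts, ∀ t, t ∉ T.verts →
      (E s t ↔ (s = x ∧ t = u) ∨ (s = y ∧ t = w) ∨ (s = c ∧ t = o)) := by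
  obtain ⟨o, ⟨ho, hco⟩, huniq⟩ := H.host.half c (by simp)
  refine ⟨o, ho, fun s hs t ht => ?_⟩
  by_cases htB : t ∈ B'.verts
  · rw [H.adj_T hs htB]
    have : t ≠ o := fun h => ho (h ▸ H.mem_B.2 (Or.inl htB))
    tauto
  · have htn : t ∉ B.verts := fun h => (H.mem_B.1 h).elim htB ht
    constructor
    · intro h
      have h1 := H.host.half_mem s (H.mem_B.2 (Or.inr hs)) t htn h
      rcases h1 with rfl | h1
      · exact Or.inr (Or.inr ⟨rfl, huniq t ⟨htn, h⟩⟩)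
      · exact absurd hs (H.notMem_T (H.hC h1))
    · rintro (⟨-, rfl⟩ | ⟨-, rfl⟩ | ⟨rfl, rfl⟩)
      · exact absurd H.att.hu htB
      · exact absurd H.att.hw htB
      · exact hco

/-- The surroundings of the attached star fork, which has half-edges to `u`, to `w` and outwards. -/
theorem star_host (H : AttachedHost E A B' T B C W z x y c u w) :
    Host E A T {x, y, c} {x, y, c} := by
  obtain ⟨o, ho, hE⟩ := H.exists_outer
  have hd := H.distinct
  have hTB : ∀ v ∈ T.verts, v ∈ B.verts := fun v hv => H.mem_B.2 (Or.inr hv)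
  have hoT : o ∉ T.verts := fun h => ho (hTB o h)
  have huT := H.notMem_T H.att.hu
  have hwT := H.notMem_T H.att.hw
  have huw := H.att.ne
  have huo : u ≠ o := fun h => ho (h ▸ H.mem_B.2 (Or.inl H.att.hu))
  have hwo : w ≠ o := fun h => ho (h ▸ H.mem_B.2 (Or.inl H.att.hw))
  have hsub : ∀ v, v ∈ ({x, y, c} : Set V) → v ∈ T.verts := by
    rintro v (rfl | rfl | rfl)
    · exact H.hx
    · exact H.hy
    · exact H.hc
  have hWx : ∀ v ∈ ({x, y, c} : Set V), v ∈ (W \ {u, w}) ∪ ({x, y, c} : Set V) :=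
    fun v hv => Or.inr hv
  refine ⟨H.host.symm, ?_, ?_, ?_, ?_, fun s hs => H.host.out s (hWx s hs),
    fun s hs => H.host.inn s (hWx s hs), ?_, H.host.irrefl, ?_, ?_⟩
  · intro s hs t ht
    rw [H.host.adj s (hTB s hs) t (hTB t ht), H.att.adj]
    have h2 : ¬ B'.Adj s t := fun h => H.notMem_T (B'.edge_vert h) hs
    have h3 : s ≠ u := fun h => huT (h ▸ hs)
    have h4 : s ≠ w := fun h => hwT (h ▸ hs)
    have h5 : t ≠ u := fun h => huT (h ▸ ht)
    have h6 : t ≠ w := fun h => hwT (h ▸ ht)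
    simp only [h2, false_or, Sym2.eq_iff]
    tauto
  · rintro v (rfl | rfl | rfl)
    · refine ⟨u, ⟨huT, (hE _ H.hx u huT).2 (by tauto)⟩, fun t ht => ?_⟩
      have := (hE _ H.hx t ht.1).1 ht.2
      tauto
    · refine ⟨w, ⟨hwT, (hE _ H.hy w hwT).2 (by tauto)⟩, fun t ht => ?_⟩
      have := (hE _ H.hy t ht.1).1 ht.2
      tauto
    · refine ⟨o, ⟨hoT, (hE _ H.hc o hoT).2 (by tauto)⟩, fun t ht => ?_⟩
      have := (hE _ H.hc t ht.1).1 ht.2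
      tauto
  · intro v hv t ht h
    have := (hE v hv t ht).1 h
    simp only [Set.mem_insert_iff, Set.mem_singleton_iff]
    tauto
  · intro a ha b hb t ht h1 h2
    have h3 := (hE a ha t ht).1 h1
    have h4 := (hE b hb t ht).1 h2
    rcases h3 with ⟨rfl, rfl⟩ | ⟨rfl, rfl⟩ | ⟨rfl, rfl⟩ <;>
      rcases h4 with ⟨rfl, h5⟩ | ⟨rfl, h5⟩ | ⟨rfl, h5⟩ <;> first | rfl | (exfalso; tauto)
  · intro a b hab
    have := H.host.arc_mem a b hab
    exact ⟨fun ha => (H.mem_W_of_T ha).1 (this.1 (hTB a ha)),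
      fun hb => (H.mem_W_of_T hb).1 (this.2 (hTB b hb))⟩
  · intro a b hab ha hb s hs h
    by_cases hbB : b ∈ B'.verts
    · have h1 := (H.host.arc_mem a b hab).2 (H.mem_B.2 (Or.inl hbB))
      rw [H.mem_W_of_B' hbB] at h1
      have h2 := (H.adj_T hs hbB).1 h
      tauto
    · exact H.host.ext_out a b hab (hTB a ha) (fun h => (H.mem_B.1 h).elim hbB hb) s (hTB s hs) h
  · intro a b hab hb ha s hs h
    by_cases haB : a ∈ B'.verts
    · have h1 := (H.host.arc_mem a b hab).1 (H.mem_B.2 (Or.inl haB))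
      rw [H.mem_W_of_B' haB] at h1
      have h2 := (H.adj_T hs haB).1 h
      tauto
    · exact H.host.ext_in a b hab (hTB b hb) (fun h => (H.mem_B.1 h).elim haB ha) s (hTB s hs) h

/-- A directed edge from `B'` to `T` is the only connection, by an edge to `T` or by an arc, that
leaves its source. -/
theorem exit (H : AttachedHost E A B' T B C W z x y c u w) {q : Piece V} (hq : q ∈ piecesOf E A T.verts)
    (hB' : q.src ∈ B'.verts) : q.tgt ∈ T.verts ∧ q.src ∈ W ∧
      ((q.isArc = true ∧ A q.src q.tgt ∧ q.src ≠ u ∧ q.src ≠ w) ∨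
        (q.isArc = false ∧ (∀ v, ¬ A q.src v) ∧
          ((q.tgt = x ∧ q.src = u) ∨ (q.tgt = y ∧ q.src = w)))) := by
  have hT := H.notMem_T hB'
  obtain ⟨h1, h2⟩ := hq
  have h1 := h1.resolve_left hT
  refine ⟨h1, ?_⟩
  have hB := H.mem_B.2 (Or.inl hB')
  rcases h2 with ⟨h2, h3⟩ | ⟨h2, h3⟩
  · have h4 := (H.host.arc_mem _ _ h3).1 hB
    rw [H.mem_W_of_B' hB'] at h4
    exact ⟨h4.1, Or.inl ⟨h2, h3, h4.2⟩⟩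
  · have h4 := (H.adj_T h1 hB').1 (H.host.symm _ _ h3)
    refine ⟨?_, Or.inr ⟨h2, fun v hv => ?_, h4⟩⟩
    · rcases h4 with ⟨-, h4⟩ | ⟨-, h4⟩
      · exact h4 ▸ H.hu
      · exact h4 ▸ H.hw
    · have h5 := (H.host.arc_mem _ _ hv).1 hB
      rw [H.mem_W_of_B' hB'] at h5
      tauto

theorem entry (H : AttachedHost E A B' T B C W z x y c u w) {q : Piece V} (hq : q ∈ piecesOf E A T.verts)
    (hB' : q.tgt ∈ B'.verts) : q.src ∈ T.verts ∧ q.tgt ∈ W ∧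
      ((q.isArc = true ∧ A q.src q.tgt ∧ q.tgt ≠ u ∧ q.tgt ≠ w) ∨
        (q.isArc = false ∧ (∀ v, ¬ A v q.tgt) ∧
          ((q.src = x ∧ q.tgt = u) ∨ (q.src = y ∧ q.tgt = w)))) := by
  have hT := H.notMem_T hB'
  obtain ⟨h1, h2⟩ := hq
  have h1 := h1.resolve_right hT
  refine ⟨h1, ?_⟩
  have hB := H.mem_B.2 (Or.inl hB')
  rcases h2 with ⟨h2, h3⟩ | ⟨h2, h3⟩
  · have h4 := (H.host.arc_mem _ _ h3).2 hB
    rw [H.mem_W_of_B' hB'] at h4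
    exact ⟨h4.1, Or.inl ⟨h2, h3, h4.2⟩⟩
  · have h4 := (H.adj_T h1 hB').1 h3
    refine ⟨?_, Or.inr ⟨h2, fun v hv => ?_, h4⟩⟩
    · rcases h4 with ⟨-, h4⟩ | ⟨-, h4⟩
      · exact h4 ▸ H.hu
      · exact h4 ▸ H.hw
    · have h5 := (H.host.arc_mem _ _ hv).2 hB
      rw [H.mem_W_of_B' hB'] at h5
      tauto

theorem exit_unique (H : AttachedHost E A B' T B C W z x y c u w) {q q' : Piece V}
    (hq : q ∈ piecesOf E A T.verts) (hq' : q' ∈ piecesOf E A T.verts) (hB' : q.src ∈ B'.verts)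
    (h : q.src = q'.src) : q = q' := by
  obtain ⟨h1, h2, h3⟩ := H.exit hq hB'
  obtain ⟨h4, h5, h6⟩ := H.exit hq' (h ▸ hB')
  have huw := H.att.ne
  obtain ⟨s, t, f⟩ := q
  obtain ⟨s', t', f'⟩ := q'
  simp only at *
  subst h
  rcases h3 with ⟨h3, h7, -⟩ | ⟨h3, h7, h8⟩ <;> rcases h6 with ⟨h6, h9, -⟩ | ⟨h6, h9, h10⟩
  · have hsW := (H.host.arc_mem _ _ h7).1 (H.mem_B.2 (Or.inl hB'))
    have := (H.host.out s hsW).unique h7 h9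
    rw [this, h3, h6]
  · exact absurd h7 (h9 t)
  · exact absurd h9 (h7 t')
  · have : t = t' := by
      rcases h8 with ⟨rfl, rfl⟩ | ⟨rfl, rfl⟩ <;> rcases h10 with ⟨rfl, h⟩ | ⟨rfl, h⟩ <;>
        first | rfl | exact absurd h huw | exact absurd h.symm huw
    rw [this, h3, h6]

theorem entry_unique (H : AttachedHost E A B' T B C W z x y c u w) {q q' : Piece V}
    (hq : q ∈ piecesOf E A T.verts) (hq' : q' ∈ piecesOf E A T.verts) (hB' : q.tgt ∈ B'.verts)
    (h : q.tgt = q'.tgt) : q = q' := by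
  obtain ⟨h1, h2, h3⟩ := H.entry hq hB'
  obtain ⟨h4, h5, h6⟩ := H.entry hq' (h ▸ hB')
  have huw := H.att.ne
  obtain ⟨s, t, f⟩ := q
  obtain ⟨s', t', f'⟩ := q'
  simp only at *
  subst h
  rcases h3 with ⟨h3, h7, -⟩ | ⟨h3, h7, h8⟩ <;> rcases h6 with ⟨h6, h9, -⟩ | ⟨h6, h9, h10⟩
  · have hsW := (H.host.arc_mem _ _ h7).2 (H.mem_B.2 (Or.inl hB'))
    have := (H.host.inn t hsW).unique h7 h9
    rw [this, h3, h6]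
  · exact absurd h7 (h9 s)
  · exact absurd h9 (h7 s')
  · have : s = s' := by
      rcases h8 with ⟨rfl, rfl⟩ | ⟨rfl, rfl⟩ <;> rcases h10 with ⟨rfl, h⟩ | ⟨rfl, h⟩ <;>
        first | rfl | exact absurd h huw | exact absurd h.symm huw
    rw [this, h3, h6]

end AttachedHost

/-- The edges that avoid `T`. -/
def avoid (E : V → V → Prop) (T : Set V) : V → V → Prop := fun a b => E a b ∧ a ∉ T ∧ b ∉ T

/-- The arcs after a reduction of `T` with the paths in `P`. -/
def contract (E A : V → V → Prop) (T : Set V) (P : Set (List (Piece V))) : V → V → Prop :=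
  fun a b => avoid A T a b ∨ ∃ l ∈ P, SafePath (piecesOf E A T) T a l b

namespace AttachedHost
variable {E A : V → V → Prop} {B' T B : PGraph V} {C W : Set V} {z x y c u w : V}
  {P D : Set (List (Piece V))}

theorem path_src_unique (H : AttachedHost E A B' T B C W z x y c u w)
    (hP : SafePartition (piecesOf E A T.verts) T.verts P D) {a b b' : V} {l l' : List (Piece V)}
    (ha : a ∈ B'.verts) (hl : l ∈ P) (hl' : l' ∈ P)
    (h : SafePath (piecesOf E A T.verts) T.verts a l b)
    (h' : SafePath (piecesOf E A T.verts) T.verts a l' b') : l = l' ∧ b = b' := by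
  obtain ⟨q, hq, hqa⟩ := h.exists_first
  obtain ⟨q', hq', hqa'⟩ := h'.exists_first
  have := H.exit_unique (h.mem q hq) (h'.mem q' hq') (hqa ▸ ha) (hqa.trans hqa'.symm)
  subst this
  have := hP.unique q l (Or.inl hl) l' (Or.inl hl') hq hq'
  subst this
  exact ⟨rfl, h.walk.unique h'.walk⟩

theorem path_tgt_unique (H : AttachedHost E A B' T B C W z x y c u w)
    (hP : SafePartition (piecesOf E A T.verts) T.verts P D) {a a' b : V} {l l' : List (Piece V)}
    (hb : b ∈ B'.verts) (hl : l ∈ P) (hl' : l' ∈ P)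
    (h : SafePath (piecesOf E A T.verts) T.verts a l b)
    (h' : SafePath (piecesOf E A T.verts) T.verts a' l' b) : l = l' ∧ a = a' := by
  obtain ⟨q, hq, hqa⟩ := h.exists_last
  obtain ⟨q', hq', hqa'⟩ := h'.exists_last
  have := H.entry_unique (h.mem q hq) (h'.mem q' hq') (hqa ▸ hb) (hqa.trans hqa'.symm)
  subst this
  have := hP.unique q l (Or.inl hl) l' (Or.inl hl') hq hq'
  subst this
  exact ⟨rfl, (h.end_unique h').1⟩

/-- A vertex of `B'` from which a path of the reduction starts has no arc that avoids `T`. -/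
theorem path_src_arc (H : AttachedHost E A B' T B C W z x y c u w) {a b v : V} {l : List (Piece V)}
    (ha : a ∈ B'.verts) (h : SafePath (piecesOf E A T.verts) T.verts a l b) (hv : A a v) :
    v ∈ T.verts := by
  obtain ⟨q, hq, rfl⟩ := h.exists_first
  obtain ⟨h1, h2, ⟨h3, h4, -⟩ | ⟨-, h4, -⟩⟩ := H.exit (h.mem q hq) ha
  · have hsW := (H.host.arc_mem _ _ h4).1 (H.mem_B.2 (Or.inl ha))
    exact (H.host.out _ hsW).unique h4 hv ▸ h1
  · exact absurd hv (h4 v)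

theorem path_tgt_arc (H : AttachedHost E A B' T B C W z x y c u w) {a b v : V} {l : List (Piece V)}
    (hb : b ∈ B'.verts) (h : SafePath (piecesOf E A T.verts) T.verts a l b) (hv : A v b) :
    v ∈ T.verts := by
  obtain ⟨q, hq, rfl⟩ := h.exists_last
  obtain ⟨h1, h2, ⟨h3, h4, -⟩ | ⟨-, h4, -⟩⟩ := H.entry (h.mem q hq) hb
  · have hsW := (H.host.arc_mem _ _ h4).2 (H.mem_B.2 (Or.inl hb))
    exact (H.host.inn _ hsW).unique h4 hv ▸ h1
  · exact absurd hv (h4 v)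

theorem contract_src_unique (H : AttachedHost E A B' T B C W z x y c u w)
    (hP : SafePartition (piecesOf E A T.verts) T.verts P D) {a b b' : V} (ha : a ∈ B'.verts)
    (h : contract E A T.verts P a b) (h' : contract E A T.verts P a b') : b = b' := by
  rcases h with h | ⟨l, hl, h⟩ <;> rcases h' with h' | ⟨l', hl', h'⟩
  · have hsW := (H.host.arc_mem _ _ h.1).1 (H.mem_B.2 (Or.inl ha))
    exact (H.host.out _ hsW).unique h.1 h'.1
  · exact absurd (H.path_src_arc ha h' h.1) h.2.2
  · exact absurd (H.path_src_arc ha h h'.1) h'.2.2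
  · exact (H.path_src_unique hP ha hl hl' h h').2

theorem contract_tgt_unique (H : AttachedHost E A B' T B C W z x y c u w)
    (hP : SafePartition (piecesOf E A T.verts) T.verts P D) {a a' b : V} (hb : b ∈ B'.verts)
    (h : contract E A T.verts P a b) (h' : contract E A T.verts P a' b) : a = a' := by
  rcases h with h | ⟨l, hl, h⟩ <;> rcases h' with h' | ⟨l', hl', h'⟩
  · have hsW := (H.host.arc_mem _ _ h.1).2 (H.mem_B.2 (Or.inl hb))
    exact (H.host.inn _ hsW).unique h.1 h'.1
  · exact absurd (H.path_tgt_arc hb h' h.1) h.2.1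
  · exact absurd (H.path_tgt_arc hb h h'.1) h'.2.1
  · exact (H.path_tgt_unique hP hb hl hl' h h').2

/-- The surroundings of `B'` after a reduction of `T`. -/
theorem contract_host (H : AttachedHost E A B' T B C W z x y c u w)
    (hP : SafePartition (piecesOf E A T.verts) T.verts P D) :
    Host (avoid E T.verts) (contract E A T.verts P) B' C W := by
  obtain ⟨o, ho, hE⟩ := H.exists_outer
  have hBB : ∀ v ∈ B'.verts, v ∈ B.verts := fun v hv => H.mem_B.2 (Or.inl hv)
  have hTB : ∀ v ∈ T.verts, v ∈ B.verts := fun v hv => H.mem_B.2 (Or.inr hv)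
  have hnB : ∀ v, v ∉ B'.verts → v ∉ T.verts → v ∉ B.verts := fun v h1 h2 h3 =>
    (H.mem_B.1 h3).elim h1 h2
  have hxu : (⟨x, u, false⟩ : Piece V) ∈ piecesOf E A T.verts :=
    ⟨Or.inl H.hx, Or.inr ⟨rfl, (H.adj_T H.hx H.att.hu).2 (Or.inl ⟨rfl, rfl⟩)⟩⟩
  have hyw : (⟨y, w, false⟩ : Piece V) ∈ piecesOf E A T.verts :=
    ⟨Or.inl H.hy, Or.inr ⟨rfl, (H.adj_T H.hy H.att.hw).2 (Or.inr ⟨rfl, rfl⟩)⟩⟩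
  have hux : (⟨u, x, false⟩ : Piece V) ∈ piecesOf E A T.verts :=
    ⟨Or.inr H.hx, Or.inr ⟨rfl, H.host.symm _ _ ((H.adj_T H.hx H.att.hu).2 (Or.inl ⟨rfl, rfl⟩))⟩⟩
  have hwy : (⟨w, y, false⟩ : Piece V) ∈ piecesOf E A T.verts :=
    ⟨Or.inr H.hy, Or.inr ⟨rfl, H.host.symm _ _ ((H.adj_T H.hy H.att.hw).2 (Or.inr ⟨rfl, rfl⟩))⟩⟩
  refine ⟨?_, ?_, ?_, ?_, ?_, ?_, ?_, ?_, ?_, ?_, ?_⟩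
  · exact fun a b h => ⟨H.host.symm _ _ h.1, h.2.2, h.2.1⟩
  · intro a ha b hb
    have haT := H.notMem_T ha
    have hbT := H.notMem_T hb
    rw [avoid, H.host.adj a (hBB a ha) b (hBB b hb), H.att.adj]
    have h1 : ¬ T.Adj a b := fun h => haT (T.edge_vert h)
    have h2 : a ≠ x ∧ a ≠ y := by rw [H.mem_T] at haT; tauto
    have h3 : b ≠ x ∧ b ≠ y := by rw [H.mem_T] at hbT; tauto
    simp only [h1, haT, hbT, Sym2.eq_iff, not_false_eq_true, and_true, false_or]
    tauto
  · intro v hv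
    obtain ⟨t, ⟨ht, hvt⟩, huniq⟩ := H.host.half v (Or.inr hv)
    refine ⟨t, ⟨fun h => ht (hBB t h), hvt, H.notMem_T (H.hC hv), fun h => ht (hTB t h)⟩, ?_⟩
    rintro s ⟨hs, hs', -, hsT⟩
    exact huniq s ⟨hnB s hs hsT, hs'⟩
  · rintro v hv t ht ⟨h1, -, htT⟩
    have := H.host.half_mem v (hBB v hv) t (hnB t ht htT) h1
    rcases this with rfl | h
    · exact absurd H.hc (H.notMem_T hv)
    · exact h
  · rintro a ha b hb t ht ⟨h1, -, htT⟩ ⟨h2, -, -⟩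
    exact H.host.half_inj a (hBB a ha) b (hBB b hb) t (hnB t ht htT) h1 h2
  · intro s hs
    suffices h : ∃ v, contract E A T.verts P s v by
      obtain ⟨v, hv⟩ := h
      exact ⟨v, hv, fun v' hv' => H.contract_src_unique hP (H.hW hs) hv' hv⟩
    have hsT := H.notMem_T (H.hW hs)
    have key : ∀ q ∈ piecesOf E A T.verts, q.src = s → ∃ v, contract E A T.verts P s v := by
      rintro q hq rfl
      obtain ⟨l, hl, -, v, hv⟩ := hP.exists_path_src hq hsT
      exact ⟨v, Or.inr ⟨l, hl, hv⟩⟩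
    by_cases hsu : s = u
    · exact key _ hux hsu.symm
    by_cases hsw : s = w
    · exact key _ hwy hsw.symm
    obtain ⟨v, hv, -⟩ := H.host.out s ((H.mem_W_of_B' (H.hW hs)).2 ⟨hs, hsu, hsw⟩)
    by_cases hvT : v ∈ T.verts
    · exact key ⟨s, v, true⟩ ⟨Or.inr hvT, Or.inl ⟨rfl, hv⟩⟩ rfl
    · exact ⟨v, Or.inl ⟨hv, hsT, hvT⟩⟩
  · intro s hs
    suffices h : ∃ v, contract E A T.verts P v s by
      obtain ⟨v, hv⟩ := h
      exact ⟨v, hv, fun v' hv' => H.contract_tgt_unique hP (H.hW hs) hv' hv⟩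
    have hsT := H.notMem_T (H.hW hs)
    have key : ∀ q ∈ piecesOf E A T.verts, q.tgt = s → ∃ v, contract E A T.verts P v s := by
      rintro q hq rfl
      obtain ⟨l, hl, -, v, hv⟩ := hP.exists_path_tgt hq hsT
      exact ⟨v, Or.inr ⟨l, hl, hv⟩⟩
    by_cases hsu : s = u
    · exact key _ hxu hsu.symm
    by_cases hsw : s = w
    · exact key _ hyw hsw.symm
    obtain ⟨v, hv, -⟩ := H.host.inn s ((H.mem_W_of_B' (H.hW hs)).2 ⟨hs, hsu, hsw⟩)
    by_cases hvT : v ∈ T.verts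
    · exact key ⟨v, s, true⟩ ⟨Or.inl hvT, Or.inl ⟨rfl, hv⟩⟩ rfl
    · exact ⟨v, Or.inl ⟨hv, hvT, hsT⟩⟩
  · rintro a b (h | ⟨l, hl, h⟩)
    · have h1 := H.host.arc_mem a b h.1
      exact ⟨fun ha => ((H.mem_W_of_B' ha).1 (h1.1 (hBB a ha))).1,
        fun hb => ((H.mem_W_of_B' hb).1 (h1.2 (hBB b hb))).1⟩
    · constructor
      · intro ha
        obtain ⟨q, hq, rfl⟩ := h.exists_first
        exact (H.exit (h.mem q hq) ha).2.1
      · intro hb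
        obtain ⟨q, hq, rfl⟩ := h.exists_last
        exact (H.entry (h.mem q hq) hb).2.1
  · rintro v (h | ⟨l, hl, h⟩)
    · exact H.host.irrefl v h.1
    · exact h.ne rfl
  · rintro a b (h | ⟨l, hl, h⟩) ha hb s hs ⟨h1, -, hbT⟩
    · exact H.host.ext_out a b h.1 (hBB a ha) (hnB b hb hbT) s (hBB s hs) h1
    · obtain ⟨q, hq, rfl⟩ := h.exists_last
      obtain ⟨h2, h3⟩ := h.mem q hq
      have h2 := h2.resolve_right hbT
      rcases h3 with ⟨-, h3⟩ | ⟨-, h3⟩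
      · exact H.host.ext_out _ _ h3 (hTB _ h2) (hnB _ hb hbT) s (hBB s hs) h1
      · have := H.host.half_inj _ (hTB _ h2) s (hBB s hs) _ (hnB _ hb hbT) h3 h1
        exact H.notMem_T hs (this ▸ h2)
  · rintro a b (h | ⟨l, hl, h⟩) hb ha s hs ⟨h1, -, haT⟩
    · exact H.host.ext_in a b h.1 (hBB b hb) (hnB a ha haT) s (hBB s hs) h1
    · obtain ⟨q, hq, rfl⟩ := h.exists_first
      obtain ⟨h2, h3⟩ := h.mem q hq
      have h2 := h2.resolve_left haT
      rcases h3 with ⟨-, h3⟩ | ⟨-, h3⟩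
      · exact H.host.ext_in _ _ h3 (hTB _ h2) (hnB _ ha haT) s (hBB s hs) h1
      · have := H.host.half_inj _ (hTB _ h2) s (hBB s hs) _ (hnB _ ha haT) (H.host.symm _ _ h3) h1
        exact H.notMem_T hs (this ▸ h2)

end AttachedHost

end Attached

/-! ### Reducing a graph with an attached star fork -/

section Attached
variable {V : Type*}

namespace AttachedHost
variable {E A : V → V → Prop} {B' T B : PGraph V} {C W : Set V} {z x y c u w : V}
  {P D : Set (List (Piece V))}

theorem pieces_eq (H : AttachedHost E A B' T B C W z x y c u w) :
    {q ∈ piecesOf E A B.verts | q.src ∈ T.verts ∨ q.tgt ∈ T.verts} = piecesOf E A T.verts := by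
  ext q
  constructor
  · rintro ⟨⟨-, h1⟩, h2⟩
    exact ⟨h2, h1⟩
  · rintro ⟨h1, h2⟩
    exact ⟨⟨h1.imp (fun h => H.mem_B.2 (Or.inr h)) fun h => H.mem_B.2 (Or.inr h), h2⟩, h1⟩

/-- A reduction of `T` and a reduction of `B'` in the resulting graph give a reduction of `B`. The
arcs that replace the paths at `T` may be treated as edges, as told by `flag`, if these
paths have no arcs. -/
theorem comp_flag (H : AttachedHost E A B' T B C W z x y c u w)
    (hP : SafePartition (piecesOf E A T.verts) T.verts P D) (flag : V → V → Bool)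
    (hflag : ∀ l ∈ P, ∀ a b, SafePath (piecesOf E A T.verts) T.verts a l b → flag a b = false →
      l.countP Piece.isArc = 0 ∧ ¬ E a b)
    {Q₁ : Set (Piece V)} {P₁ C₁ : Set (List (Piece V))}
    (hQ₁ : ∀ p, p ∈ Q₁ ↔ (p.src ∈ B'.verts ∨ p.tgt ∈ B'.verts) ∧
      ((p ∈ piecesOf E A B.verts ∧ p.src ∉ T.verts ∧ p.tgt ∉ T.verts) ∨
        ((∃ l ∈ P, SafePath (piecesOf E A T.verts) T.verts p.src l p.tgt) ∧
          p.isArc = flag p.src p.tgt)))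
    (h₁ : SafePartition Q₁ B'.verts P₁ C₁)
    (hdisj : ∀ l ∈ P₁ ∪ C₁, ∀ p ∈ l, ∀ q ∈ l,
      ¬ (p ∈ piecesOf E A B.verts ∧ p.src ∉ T.verts ∧ p.tgt ∉ T.verts) →
      ¬ (q ∈ piecesOf E A B.verts ∧ q.src ∉ T.verts ∧ q.tgt ∉ T.verts) → p = q) :
    Reducible E A B.verts := by
  have hR := H.pieces_eq
  unfold Reducible
  have hB : B.verts = B'.verts ∪ T.verts := H.att.verts
  have hP' := hP
  rw [← hR] at hP'
  have key : ∃ P C, SafePartition (piecesOf E A B.verts) (B'.verts ∪ T.verts) P C := by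
    refine SafePartition.comp H.att.disj hP' h₁ ?_ ?_ ?_ ?_ ?_ ?_ hdisj
    · intro q hq h1 h2
      refine (hQ₁ q).2 ⟨?_, Or.inl ⟨hq, h1, h2⟩⟩
      exact hq.1.imp (fun h => (H.mem_B.1 h).resolve_right h1)
        fun h => (H.mem_B.1 h).resolve_right h2
    · intro p hp
      rcases ((hQ₁ p).1 hp).2 with h | ⟨⟨l, hl, h⟩, h2⟩
      · exact Or.inl h
      · refine Or.inr ⟨l, hl, hR ▸ h, ?_⟩
        by_cases hf : p.isArc = true
        · rw [if_pos hf]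
          exact h.arc_le_one
        · rw [if_neg hf]
          rw [h2, Bool.not_eq_true] at hf
          exact (hflag l hl _ _ h hf).1.le
    · intro l hl a b h hab
      rw [hR] at h
      refine ⟨⟨a, b, flag a b⟩, (hQ₁ _).2 ⟨hab, Or.inr ⟨⟨l, hl, h⟩, rfl⟩⟩, ?_, rfl, rfl⟩
      rintro ⟨⟨-, ⟨-, h1⟩ | ⟨h1, h2⟩⟩, h3, h4⟩
      · rcases hab with hab | hab
        · exact h4 (H.path_src_arc hab h h1)
        · exact h3 (H.path_tgt_arc hab h h1)
      · exact (hflag l hl _ _ h h1).2 h2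
    · intro p hp p' hp' h h' hs ht
      have h1 := (((hQ₁ p).1 hp).2.resolve_left h).2
      have h2 := (((hQ₁ p').1 hp').2.resolve_left h').2
      obtain ⟨a, b, f⟩ := p
      obtain ⟨a', b', f'⟩ := p'
      simp only at *
      subst hs ht
      rw [h1, h2]
    · intro l hl l' hl' a b hab h h'
      rw [hR] at h h'
      rcases hab with hab | hab
      · exact (H.path_src_unique hP hab hl hl' h h').1
      · exact (H.path_tgt_unique hP hab hl hl' h h').1
    · exact fun p hp => ((hQ₁ p).1 hp).1
  rwa [← hB] at key

theorem mem_contract_pieces (H : AttachedHost E A B' T B C W z x y c u w) {p : Piece V} :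
    p ∈ piecesOf (avoid E T.verts) (contract E A T.verts P) B'.verts ↔
      (p.src ∈ B'.verts ∨ p.tgt ∈ B'.verts) ∧
      ((p ∈ piecesOf E A B.verts ∧ p.src ∉ T.verts ∧ p.tgt ∉ T.verts) ∨
        ((∃ l ∈ P, SafePath (piecesOf E A T.verts) T.verts p.src l p.tgt) ∧ p.isArc = true)) := by
  have hBB : p.src ∈ B'.verts ∨ p.tgt ∈ B'.verts → p.src ∈ B.verts ∨ p.tgt ∈ B.verts :=
    Or.imp (fun h => H.mem_B.2 (Or.inl h)) fun h => H.mem_B.2 (Or.inl h)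
  have h1 : ∀ (E A : V → V → Prop) (S : Set V), p ∈ piecesOf E A S ↔ (p.src ∈ S ∨ p.tgt ∈ S) ∧
    ((p.isArc = true ∧ A p.src p.tgt) ∨ (p.isArc = false ∧ E p.src p.tgt)) := fun _ _ _ => Iff.rfl
  rw [h1, h1]
  simp only [contract, avoid]
  generalize (∃ l ∈ P, SafePath (piecesOf E A T.verts) T.verts p.src l p.tgt) = R
  tauto

/-- The composition in which all paths at `T` are replaced by arcs. -/
theorem comp (H : AttachedHost E A B' T B C W z x y c u w)
    (hP : SafePartition (piecesOf E A T.verts) T.verts P D)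
    (h : Reducible (avoid E T.verts) (contract E A T.verts P) B'.verts) :
    Reducible E A B.verts := by
  obtain ⟨P₁, C₁, h₁⟩ := h
  refine H.comp_flag hP (fun _ _ => true) (by simp) (fun p => H.mem_contract_pieces) h₁ ?_
  intro l hl p hp q hq hp' hq'
  have h2 := ((H.mem_contract_pieces.1 (h₁.mem_piece hl hp)).2.resolve_left hp').2
  have h3 := ((H.mem_contract_pieces.1 (h₁.mem_piece hl hq)).2.resolve_left hq').2
  exact countP_isArc_eq_one_of_mem (h₁.arc_le_one hl) hp hq h2 h3

/-- The star fork as a template. -/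
theorem star_realized (H : AttachedHost E A B' T B C W z x y c u w) :
    ∃ ι : ℕ → V, Template.starFork.Realized E A T.verts ι ∧ ι 1 = x ∧ ι 2 = y ∧ ι 3 = c ∧
      ι 4 = u ∧ ι 5 = w ∧ ι 6 ∉ B.verts ∧ E c (ι 6) := by
  have hwf : Template.starFork.WellFormed := ⟨by decide, by decide, by decide⟩
  have hs : Template.starFork.Shaped T fun k => [z, x, y, c].getD k z :=
    PGraph.HasShape.shaped z H.att.star rfl hwf
  have hsl : Template.starFork.slots = [1, 2, 3] := by decide
  obtain ⟨ι, h1, h2, h3⟩ := H.star_host.realized hwf hs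
    (by simp [Template.starFork]) (by simp [hsl])
  obtain ⟨o, ho, hE⟩ := H.exists_outer
  have e1 : ι 1 = x := h1 1 (by decide)
  have e2 : ι 2 = y := h1 2 (by decide)
  have e3 : ι 3 = c := h1 3 (by decide)
  have hx := h2 0 1 rfl
  have hy := h2 1 2 rfl
  have hc := h2 2 3 rfl
  simp only [List.getD_cons_succ, List.getD_cons_zero, Template.starFork, Nat.reduceAdd,
    Nat.add_zero] at hx hy hc
  have hd := H.distinct
  refine ⟨ι, h3, e1, e2, e3, ?_, ?_, ?_, ?_⟩
  · have := (hE _ H.hx _ hx.2).1 hx.1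
    tauto
  · have := (hE _ H.hy _ hy.2).1 hy.1
    tauto
  · have := (hE _ H.hc _ hc.2).1 hc.1
    have h4 : ι 6 = o := by tauto
    rwa [h4]
  · exact hc.1

/-- An arc of `B'` or a path that joins two vertices of `B'`: the remaining graph has an arc in
`B'`. -/
theorem comp_of_core (H : AttachedHost E A B' T B C W z x y c u w)
    (hcore : ∀ E A, Host E A B' C W → (∃ s ∈ B'.verts, ∃ t ∈ B'.verts, A s t) →
      Reducible E A B'.verts)
    (hP : SafePartition (piecesOf E A T.verts) T.verts P D) {s t : V} (hs : s ∈ B'.verts)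
    (ht : t ∈ B'.verts) (h : contract E A T.verts P s t) : Reducible E A B.verts :=
  H.comp hP (hcore _ _ (H.contract_host hP) ⟨s, hs, t, ht, h⟩)

end AttachedHost

/-! ### Cutting an auxiliary arc -/

/-- The arc relation in which the arcs from `s` to `o` and from `i` to `w` have been joined to
an arc from `s` to `w`. -/
def spliced (A : V → V → Prop) (s o i w : V) : V → V → Prop :=
  fun a b => (A a b ∧ ¬ (a = s ∧ b = o) ∧ ¬ (a = i ∧ b = w)) ∨ (a = s ∧ b = w)

/-- Splicing an arc that leaves `B` with one that enters `B` yields an arc inside `B`. -/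
theorem Host.spliced {E A : V → V → Prop} {B : PGraph V} {C W : Set V} (h : Host E A B C W)
    (hWB : W ⊆ B.verts) {s o i w : V} (hsw : s ≠ w) (hs : s ∈ B.verts) (hw : w ∈ B.verts)
    (ho : o ∉ B.verts) (hi : i ∉ B.verts) (hso : A s o) (hiw : A i w) :
    Host E (spliced A s o i w) B C W := by
  have hsW := (h.arc_mem _ _ hso).1 hs
  have hwW := (h.arc_mem _ _ hiw).2 hw
  refine ⟨h.symm, h.adj, h.half, h.half_mem, h.half_inj, ?_, ?_, ?_, ?_, ?_, ?_⟩
  · intro a ha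
    by_cases has : a = s
    · subst has
      refine ⟨w, Or.inr ⟨rfl, rfl⟩, ?_⟩
      rintro b (⟨h1, h2, -⟩ | ⟨-, rfl⟩)
      · exact absurd ⟨rfl, (h.out _ hsW).unique h1 hso⟩ h2
      · rfl
    · obtain ⟨b, hb, hb'⟩ := h.out a ha
      refine ⟨b, Or.inl ⟨hb, fun h1 => has h1.1, fun h1 => hi (h1.1 ▸ hWB ha)⟩, ?_⟩
      rintro b' (⟨h1, -⟩ | ⟨h1, -⟩)
      · exact hb' _ h1
      · exact absurd h1 has
  · intro a ha
    by_cases haw : a = w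
    · subst haw
      refine ⟨s, Or.inr ⟨rfl, rfl⟩, ?_⟩
      rintro b (⟨h1, -, h2⟩ | ⟨rfl, -⟩)
      · exact absurd ⟨(h.inn _ hwW).unique h1 hiw, rfl⟩ h2
      · rfl
    · obtain ⟨b, hb, hb'⟩ := h.inn a ha
      refine ⟨b, Or.inl ⟨hb, fun h1 => ho (h1.2 ▸ hWB ha), fun h1 => haw h1.2⟩, ?_⟩
      rintro b' (⟨h1, -⟩ | ⟨-, h1⟩)
      · exact hb' _ h1
      · exact absurd h1 haw
  · rintro a b (⟨h1, -⟩ | ⟨rfl, rfl⟩)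
    · exact h.arc_mem a b h1
    · exact ⟨fun _ => hsW, fun _ => hwW⟩
  · rintro a (⟨h1, -⟩ | ⟨rfl, h1⟩)
    · exact h.irrefl _ h1
    · exact hsw h1
  · rintro a b (⟨h1, -⟩ | ⟨rfl, rfl⟩) ha hb
    · exact h.ext_out a b h1 ha hb
    · exact absurd hw hb
  · rintro a b (⟨h1, -⟩ | ⟨rfl, rfl⟩) hb ha
    · exact h.ext_in a b h1 hb ha
    · exact absurd hs ha

/-- If a reduction exists whenever there is an internal arc, then it also exists without an internal
arc, provided that one of the arcs that enter `B` counts as an edge: join it to an arc that leaves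
`B`, reduce, and cut the member of the partition that uses the resulting arc from `s` to `w`. The
part that starts with the edge into `w` may run through the arc from `s` to `o` as well, if it comes
from a cycle, but it contains no other arc. -/
theorem Host.exists_cut {E A : V → V → Prop} {B : PGraph V} {C W : Set V} (h : Host E A B C W)
    (hWB : W ⊆ B.verts)
    (hcore : ∀ E A, Host E A B C W → (∃ s ∈ B.verts, ∃ t ∈ B.verts, A s t) →
      Reducible E A B.verts)
    {s o i w : V} (hsw : s ≠ w) (hs : s ∈ B.verts) (hw : w ∈ B.verts)
    (ho : o ∉ B.verts) (hi : i ∉ B.verts) (hio : i ≠ o) (hso : A s o) (hiw : A i w) :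
    ∃ P D, SafePartition {p | (p ∈ piecesOf E A B.verts ∧ p ≠ ⟨i, w, true⟩) ∨ p = ⟨i, w, false⟩}
      B.verts P D ∧
      ∀ l ∈ P ∪ D, ⟨i, w, false⟩ ∈ l → ∀ q ∈ l, q.isArc = true → q = ⟨s, o, true⟩ := by
  obtain ⟨P, D, hPD⟩ := hcore _ _ (h.spliced hWB hsw hs hw ho hi hso hiw)
    ⟨s, hs, w, hw, Or.inr ⟨rfl, rfl⟩⟩
  have hsW := (h.arc_mem _ _ hso).1 hs
  set A₀ : V → V → Prop := fun a b => A a b ∧ ¬ (a = s ∧ b = o) ∧ ¬ (a = i ∧ b = w) with hA₀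
  have hsw' : ¬ A s w := fun h1 => ho ((h.out _ hsW).unique h1 hso ▸ hw)
  have e1 : piecesOf E (_root_.spliced A s o i w) B.verts =
      insert ⟨s, w, true⟩ (piecesOf E A₀ B.verts) := by
    ext ⟨a, b, f⟩
    simp only [piecesOf, _root_.spliced, hA₀, Set.mem_insert_iff, Set.mem_ofPred_eq,
      Piece.mk.injEq]
    constructor
    · rintro ⟨h1, ⟨h2, h3 | h3⟩ | h2⟩
      · exact Or.inr ⟨h1, Or.inl ⟨h2, h3⟩⟩
      · exact Or.inl ⟨h3.1, h3.2, h2⟩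
      · exact Or.inr ⟨h1, Or.inr h2⟩
    · rintro (⟨rfl, rfl, rfl⟩ | ⟨h1, h2⟩)
      · exact ⟨Or.inl hs, Or.inl ⟨rfl, Or.inr ⟨rfl, rfl⟩⟩⟩
      · exact ⟨h1, by tauto⟩
  rw [e1] at hPD
  -- the conditions of the cut hold as `o` and `i` are not joined to `B` by edges
  obtain ⟨P', D', h1, h2⟩ := hPD.cut (p₁ := ⟨s, o, true⟩) (p₂ := ⟨i, w, false⟩)
    (fun h1 => by
      rcases h1.2 with ⟨-, h2⟩ | ⟨h2, -⟩
      · exact hsw' h2.1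
      · exact absurd h2 (by simp)) rfl hs hw rfl ho rfl hi hio
    (fun h1 => by
      rcases h1.2 with ⟨-, h2⟩ | ⟨h2, -⟩
      · exact h2.2.1 ⟨rfl, rfl⟩
      · exact absurd h2 (by simp))
    (fun h1 => by
      rcases h1.2 with ⟨h2, -⟩ | ⟨-, h2⟩
      · exact absurd h2 (by simp)
      · exact h.ext_in _ _ hiw hw hi w hw (h.symm _ _ h2)) rfl
    (fun q hq hqa hqs hqo => by
      rcases hq.2 with ⟨h2, -⟩ | ⟨-, h2⟩
      · exact absurd (h2.symm.trans hqa) (by simp)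
      · exact h.ext_out _ _ hso hs ho q.tgt (hq.1.resolve_left hqs) (by
          rw [show o = q.src from hqo.symm]
          exact h.symm _ _ h2))
    (fun q hq hqa hqs hqo => by
      rcases hq.2 with ⟨h2, -⟩ | ⟨-, h2⟩
      · exact absurd (h2.symm.trans hqa) (by simp)
      · exact h.ext_in _ _ hiw hw hi q.src (hq.1.resolve_right hqs) (by
          rw [show i = q.tgt from hqo.symm]
          exact h2))
  refine ⟨P', D', ?_, h2⟩
  convert h1 using 1
  ext ⟨a, b, f⟩
  simp only [piecesOf, hA₀, Set.mem_insert_iff, Set.mem_ofPred_eq, Piece.mk.injEq, ne_eq]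
  constructor
  · rintro (⟨⟨h3, ⟨rfl, h4⟩ | ⟨rfl, h4⟩⟩, h5⟩ | h3)
    · by_cases h6 : a = s ∧ b = o
      · exact Or.inl ⟨h6.1, h6.2, rfl⟩
      · exact Or.inr (Or.inr ⟨h3, Or.inl ⟨rfl, h4, h6, by tauto⟩⟩)
    · exact Or.inr (Or.inr ⟨h3, Or.inr ⟨rfl, h4⟩⟩)
    · exact Or.inr (Or.inl h3)
  · rintro (⟨rfl, rfl, rfl⟩ | h3 | ⟨h3, ⟨rfl, h4, h5, h6⟩ | ⟨rfl, h4⟩⟩)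
    · exact Or.inl ⟨⟨Or.inl hs, Or.inl ⟨rfl, hso⟩⟩, fun h3 => hi (h3.1 ▸ hs)⟩
    · exact Or.inr h3
    · exact Or.inl ⟨⟨h3, Or.inl ⟨rfl, h4⟩⟩, by tauto⟩
    · exact Or.inl ⟨⟨h3, Or.inr ⟨rfl, h4⟩⟩, by simp⟩

namespace AttachedHost
variable {E A : V → V → Prop} {B' T B : PGraph V} {C W : Set V} {z x y c u w : V}

/-- If the only arc inside `B` leads from `x` to `y`, a path without arcs can be routed through the
star fork to `w`. It counts as an edge, which leaves room for an auxiliary arc into `w`. -/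
theorem reducible_of_pass (H : AttachedHost E A B' T B C W z x y c u w)
    (hcore : ∀ E A, Host E A B' C W → (∃ s ∈ B'.verts, ∃ t ∈ B'.verts, A s t) →
      Reducible E A B'.verts)
    {s o : V} (hs : s ∈ W) (hsw : s ≠ w) (hso : A s o) (ho : o ∉ B.verts)
    (hxy : A x y) (hc : ∀ v, A c v → v ∉ T.verts) (hc' : ∀ v ∈ T.verts, ¬ A v c) :
    Reducible E A B.verts := by
  classical
  obtain ⟨ι, hR, e1, e2, e3, e4, e5, e6, e7⟩ := H.star_realized
  have hsl : Template.starFork.slots = [1, 2, 3] := by decide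
  have hmem : ∀ k ∈ Template.starFork.slots, ι k ∈ T.verts := fun k hk =>
    (hR.mem _).2 ⟨k, Template.slots_lt _ hk, rfl⟩
  obtain ⟨σ, hσ⟩ := hR.exists_outgoing
  obtain ⟨L, P, D, hg, hP, h1, -⟩ := hR.exists_safePartition Template.starFork_pass hσ (by
    have h1 : σ 1 = some 2 := ((hσ 1 (by simp [hsl])).1 2).2 ⟨by simp [hsl], by rwa [e1, e2]⟩
    have h3 : σ 3 = none := (hσ 3 (by simp [hsl])).2.2 (by rwa [e3])
    have h2 : σ 2 ≠ some 3 := fun h => by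
      have := (((hσ 2 (by simp [hsl])).1 3).1 h).2
      rw [e2, e3] at this
      exact hc' y H.hy this
    simp only [hsl]
    simp [h1, h3, h2])
  have hpass : ∃ l ∈ L, l.head? = some 6 ∧ l.getLast? = some 5 := by
    simpa [Template.hasRoute, List.any_eq_true] using hg
  obtain ⟨l, hl, hl1, hl2⟩ := hpass
  obtain ⟨F, hF, hFp, hF0⟩ := h1 l hl 6 5 hl1 hl2 (by decide) (by decide)
  rw [e5] at hFp
  set i := ι 6 with hi
  have hsB' := H.hW hs
  have hwB' := H.hW H.hw
  have hsT := H.notMem_T hsB'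
  have hoB' : o ∉ B'.verts := fun h => ho (H.mem_B.2 (Or.inl h))
  have hoT : o ∉ T.verts := fun h => ho (H.mem_B.2 (Or.inr h))
  have hiB' : i ∉ B'.verts := fun h => e6 (H.mem_B.2 (Or.inl h))
  have hcB : c ∈ B.verts := H.mem_B.2 (Or.inr H.hc)
  have hwB : w ∈ B.verts := H.mem_B.2 (Or.inl hwB')
  have hio : i ≠ o := fun h => H.host.ext_out s o hso (H.mem_B.2 (Or.inl hsB')) ho c hcB (h ▸ e7)
  have hiw : ¬ E i w := fun h =>
    H.notMem_T hwB' (H.host.half_inj c hcB w hwB i e6 e7 (H.host.symm _ _ h) ▸ H.hc)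
  have hiw' : contract E A T.verts P i w := Or.inr ⟨F, hF, hFp⟩
  obtain ⟨P₁, C₁, h₁, hdisj⟩ := (H.contract_host hP).exists_cut H.hW hcore hsw hsB' hwB'
    hoB' hiB' hio (Or.inl ⟨hso, hsT, hoT⟩) hiw'
  -- the path `F` counts as an edge from `i` to `w`, and all other paths through `T` as arcs
  have hQ : ∀ p : Piece V, p ∈ {p | (p ∈ piecesOf (avoid E T.verts) (contract E A T.verts P) B'.verts ∧
      p ≠ ⟨i, w, true⟩) ∨ p = ⟨i, w, false⟩} ↔ (p.src ∈ B'.verts ∨ p.tgt ∈ B'.verts) ∧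
      ((p ∈ piecesOf E A B.verts ∧ p.src ∉ T.verts ∧ p.tgt ∉ T.verts) ∨
        ((∃ l ∈ P, SafePath (piecesOf E A T.verts) T.verts p.src l p.tgt) ∧
          p.isArc = !(decide (p.src = i ∧ p.tgt = w)))) := by
    rintro ⟨a, b, f⟩
    rw [Set.mem_ofPred_eq, H.mem_contract_pieces]
    constructor
    · rintro (⟨⟨h2, h3 | ⟨h3, rfl⟩⟩, h4⟩ | h2)
      · exact ⟨h2, Or.inl h3⟩
      · refine ⟨h2, Or.inr ⟨h3, ?_⟩⟩
        have : ¬ (a = i ∧ b = w) := fun h => h4 (by rw [h.1, h.2])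
        simp [this]
      · rw [Piece.mk.injEq] at h2
        obtain ⟨rfl, rfl, rfl⟩ := h2
        exact ⟨Or.inr hwB', Or.inr ⟨⟨F, hF, hFp⟩, by simp⟩⟩
    · rintro ⟨h2, h3 | ⟨h3, h4⟩⟩
      · refine Or.inl ⟨⟨h2, Or.inl h3⟩, fun h4 => ?_⟩
        rw [Piece.mk.injEq] at h4
        obtain ⟨rfl, rfl, rfl⟩ := h4
        rcases h3.1.2 with ⟨-, h5⟩ | ⟨h5, -⟩
        · exact h3.2.1 (H.path_tgt_arc hwB' hFp h5)
        · exact absurd h5 (by simp)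
      · by_cases h5 : a = i ∧ b = w
        · right
          obtain ⟨rfl, rfl⟩ := h5
          simpa using h4
        · left
          refine ⟨⟨h2, Or.inr ⟨h3, by simpa [h5] using h4⟩⟩, fun h6 => h5 ?_⟩
          rw [Piece.mk.injEq] at h6
          exact ⟨h6.1, h6.2.1⟩
  refine H.comp_flag hP (fun a b => !(decide (a = i ∧ b = w))) ?_ hQ h₁ ?_
  · intro l hl a b h hab
    simp only [Bool.not_eq_false', decide_eq_true_eq] at hab
    obtain ⟨rfl, rfl⟩ := hab
    rw [(H.path_tgt_unique hP hwB' hl hF h hFp).1]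
    exact ⟨hF0, hiw⟩
  · intro l hl
    have hform : ∀ p ∈ l, ¬ (p ∈ piecesOf E A B.verts ∧ p.src ∉ T.verts ∧ p.tgt ∉ T.verts) →
        p.isArc = true ∨ p = ⟨i, w, false⟩ := by
      rintro ⟨a, b, f⟩ hp hp'
      have h2 := (((hQ _).1 (h₁.mem_piece hl hp)).2.resolve_left hp').2
      by_cases h5 : a = i ∧ b = w
      · right
        obtain ⟨rfl, rfl⟩ := h5
        simpa using h2
      · left
        simpa [h5] using h2
    have hold : (⟨s, o, true⟩ : Piece V) ∈ piecesOf E A B.verts ∧ s ∉ T.verts ∧ o ∉ T.verts :=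
      ⟨⟨Or.inl (H.mem_B.2 (Or.inl hsB')), Or.inl ⟨rfl, hso⟩⟩, hsT, hoT⟩
    intro p hp q hq hp' hq'
    rcases hform p hp hp' with h2 | h2 <;> rcases hform q hq hq' with h3 | h3
    · exact countP_isArc_eq_one_of_mem (h₁.arc_le_one hl) hp hq h2 h3
    · have := hdisj l hl (h3 ▸ hq) p hp h2
      exact absurd (this ▸ hold) hp'
    · have := hdisj l hl (h2 ▸ hp) q hq h3
      exact absurd (this ▸ hold) hq'
    · exact h2.trans h3.symm

theorem starFork_slot {ι : ℕ → V} (e1 : ι 1 = x) (e2 : ι 2 = y) (e3 : ι 3 = c) {v : V}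
    (hv : v = x ∨ v = y ∨ v = c) : ∃ k ∈ [1, 2, 3], ι k = v := by
  rcases hv with rfl | rfl | rfl
  · exact ⟨1, by simp, e1⟩
  · exact ⟨2, by simp, e2⟩
  · exact ⟨3, by simp, e3⟩

/-- An arc from the star fork to `B'` can be continued to a path inside `B'`, from `u` or `w`. -/
theorem reducible_of_out (H : AttachedHost E A B' T B C W z x y c u w)
    (hcore : ∀ E A, Host E A B' C W → (∃ s ∈ B'.verts, ∃ t ∈ B'.verts, A s t) →
      Reducible E A B'.verts)
    {s t : V} (hs : s ∈ T.verts) (ht : t ∈ B'.verts) (hst : A s t) : Reducible E A B.verts := by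
  obtain ⟨ι, hR, e1, e2, e3, e4, e5, -, -⟩ := H.star_realized
  have hsl : Template.starFork.slots = [1, 2, 3] := by decide
  obtain ⟨σ, hσ⟩ := hR.exists_outgoing
  have hsW := (H.mem_W_of_T hs).1 ((H.host.arc_mem _ _ hst).1 (H.mem_B.2 (Or.inr hs)))
  obtain ⟨k, hk, rfl⟩ := starFork_slot e1 e2 e3 hsW
  have htT := H.notMem_T ht
  have hσk : σ k = none := (hσ k (hsl ▸ hk)).2.2 fun v hv =>
    (H.host.out _ ((H.host.arc_mem _ _ hst).1 (H.mem_B.2 (Or.inr hs)))).unique hst hv ▸ htT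
  obtain ⟨L, P, D, hg, hP, -, h1, -, -⟩ := hR.exists_safePartition
    (List.all_eq_true.1 Template.starFork_out k hk) hσ (by
      rw [List.any_eq_true]
      refine ⟨(k, none), ?_, by simp⟩
      rw [List.mem_reverse, List.mem_map]
      exact ⟨k, hsl ▸ hk, by rw [hσk]⟩)
  have hk4 : k < Template.starFork.n := Template.slots_lt _ (hsl ▸ hk)
  simp only [Template.hasRoute, Bool.or_eq_true, List.any_eq_true, Bool.and_eq_true,
    beq_iff_eq] at hg
  rcases hg with ⟨l, hl, hl1, hl2⟩ | ⟨l, hl, hl1, hl2⟩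
  · obtain ⟨F, hF, hFp⟩ := h1 l hl 4 k hl1 hl2 (by decide) hk4 t htT hst
    exact H.comp_of_core hcore hP H.att.hu ht (Or.inr ⟨F, hF, e4 ▸ hFp⟩)
  · obtain ⟨F, hF, hFp⟩ := h1 l hl 5 k hl1 hl2 (by decide) hk4 t htT hst
    exact H.comp_of_core hcore hP H.att.hw ht (Or.inr ⟨F, hF, e5 ▸ hFp⟩)

/-- An arc from `B'` to the star fork can be continued to a path inside `B'`, to `u` or `w`. -/
theorem reducible_of_in (H : AttachedHost E A B' T B C W z x y c u w)
    (hcore : ∀ E A, Host E A B' C W → (∃ s ∈ B'.verts, ∃ t ∈ B'.verts, A s t) →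
      Reducible E A B'.verts)
    {s t : V} (hs : s ∈ B'.verts) (ht : t ∈ T.verts) (hst : A s t) : Reducible E A B.verts := by
  obtain ⟨ι, hR, e1, e2, e3, e4, e5, -, -⟩ := H.star_realized
  have hsl : Template.starFork.slots = [1, 2, 3] := by decide
  obtain ⟨σ, hσ⟩ := hR.exists_outgoing
  have htW := (H.mem_W_of_T ht).1 ((H.host.arc_mem _ _ hst).2 (H.mem_B.2 (Or.inr ht)))
  obtain ⟨k, hk, rfl⟩ := starFork_slot e1 e2 e3 htW
  have hsT := H.notMem_T hs
  obtain ⟨L, P, D, hg, hP, -, -, h1, -⟩ := hR.exists_safePartition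
    (List.all_eq_true.1 Template.starFork_in k hk) hσ (by
      rw [List.all_eq_true]
      intro q hq
      rw [List.mem_reverse, List.mem_map] at hq
      obtain ⟨j, hj, rfl⟩ := hq
      rw [Bool.not_eq_true', beq_eq_false_iff_ne]
      intro h2
      have h3 := ((hσ j hj).1 k).1 h2
      have h4 := (H.host.inn _ ((H.host.arc_mem _ _ hst).2 (H.mem_B.2 (Or.inr ht)))).unique hst h3.2
      exact hsT (h4 ▸ (hR.mem _).2 ⟨j, Template.slots_lt _ hj, rfl⟩))
  have hk4 : k < Template.starFork.n := Template.slots_lt _ (hsl ▸ hk)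
  simp only [Template.hasRoute, Bool.or_eq_true, List.any_eq_true, Bool.and_eq_true,
    beq_iff_eq] at hg
  rcases hg with ⟨l, hl, hl1, hl2⟩ | ⟨l, hl, hl1, hl2⟩
  · obtain ⟨F, hF, hFp⟩ := h1 l hl k 4 hl1 hl2 hk4 (by decide) s hsT hst
    exact H.comp_of_core hcore hP hs H.att.hu (Or.inr ⟨F, hF, e4 ▸ hFp⟩)
  · obtain ⟨F, hF, hFp⟩ := h1 l hl k 5 hl1 hl2 hk4 (by decide) s hsT hst
    exact H.comp_of_core hcore hP hs H.att.hw (Or.inr ⟨F, hF, e5 ▸ hFp⟩)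

/-- An arc between `c` and another leaf of the star fork allows a path from `u` to `w` or back. -/
theorem reducible_of_turn (H : AttachedHost E A B' T B C W z x y c u w)
    (hcore : ∀ E A, Host E A B' C W → (∃ s ∈ B'.verts, ∃ t ∈ B'.verts, A s t) →
      Reducible E A B'.verts)
    {v : V} (hv : v ∈ T.verts) (hcv : A c v ∨ A v c) : Reducible E A B.verts := by
  obtain ⟨ι, hR, e1, e2, e3, e4, e5, -, -⟩ := H.star_realized
  have hsl : Template.starFork.slots = [1, 2, 3] := by decide
  obtain ⟨σ, hσ⟩ := hR.exists_outgoing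
  have hvB := H.mem_B.2 (Or.inr hv)
  have hvW : v = x ∨ v = y ∨ v = c := by
    rcases hcv with h | h
    · exact (H.mem_W_of_T hv).1 ((H.host.arc_mem _ _ h).2 hvB)
    · exact (H.mem_W_of_T hv).1 ((H.host.arc_mem _ _ h).1 hvB)
  obtain ⟨k, hk, rfl⟩ := starFork_slot e1 e2 e3 hvW
  obtain ⟨L, P, D, hg, hP, h0, -, -, h1⟩ := hR.exists_safePartition Template.starFork_turn hσ (by
      rw [List.any_eq_true]
      rcases hcv with h | h
      · have h2 := ((hσ 3 (by simp [hsl])).1 k).2 ⟨hsl ▸ hk, by rwa [e3]⟩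
        refine ⟨(3, σ 3), ?_, by simp [h2]⟩
        rw [List.mem_reverse, List.mem_map]
        exact ⟨3, by simp [hsl], rfl⟩
      · have h2 := ((hσ k (hsl ▸ hk)).1 3).2 ⟨by simp [hsl], by rwa [e3]⟩
        refine ⟨(k, σ k), ?_, by simp [h2]⟩
        rw [List.mem_reverse, List.mem_map]
        exact ⟨k, hsl ▸ hk, rfl⟩)
  have key : ∀ a b, 4 ≤ a → 4 ≤ b → (Template.hasRoute L a b ||
      (Template.starFork.slots.map fun s => (s, σ s)).reverse.any fun q =>
        q.2.any fun s => Template.hasRoute L a q.1 && Template.hasRoute L s b) = true →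
      contract E A T.verts P (ι a) (ι b) := by
    intro a b ha hb h
    simp only [Template.hasRoute, Bool.or_eq_true, List.any_eq_true, Bool.and_eq_true,
      beq_iff_eq, List.mem_reverse, List.mem_map] at h
    rcases h with ⟨l, hl, hl1, hl2⟩ | ⟨-, ⟨s, hs, rfl⟩, h⟩
    · obtain ⟨F, hF, hFp, -⟩ := h0 l hl a b hl1 hl2 ha hb
      exact Or.inr ⟨F, hF, hFp⟩
    · rw [Option.any_eq_true] at h
      obtain ⟨s', hs', h⟩ := h
      simp only [Bool.and_eq_true, List.any_eq_true, beq_iff_eq] at h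
      obtain ⟨⟨l, hl, hl1, hl2⟩, l', hl', hl1', hl2'⟩ := h
      have h2 := ((hσ s hs).1 s').1 hs'
      obtain ⟨F, hF, hFp⟩ := h1 l hl l' hl' a s s' b hl1 hl2 hl1' hl2' ha
        (Template.slots_lt _ hs) (Template.slots_lt _ h2.1) hb h2.2
      exact Or.inr ⟨F, hF, hFp⟩
  simp only [List.any_cons, List.any_nil, Bool.or_false] at hg
  rw [Bool.or_eq_true] at hg
  rcases hg with hg | hg
  · have := key 4 5 (by omega) (by omega) hg
    rw [e4, e5] at this
    exact H.comp_of_core hcore hP H.att.hu H.att.hw this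
  · have := key 5 4 (by omega) (by omega) hg
    rw [e4, e5] at this
    exact H.comp_of_core hcore hP H.att.hw H.att.hu this

/-- The reduction of a graph with an attached star fork, given an arc inside it. -/
theorem reducible (H : AttachedHost E A B' T B C W z x y c u w)
    (hcore : ∀ E A, Host E A B' C W → (∃ s ∈ B'.verts, ∃ t ∈ B'.verts, A s t) →
      Reducible E A B'.verts)
    (hex : ∃ s ∈ W, s ≠ u ∧ s ≠ w)
    (hint : ∃ s ∈ B.verts, ∃ t ∈ B.verts, A s t) : Reducible E A B.verts := by
  by_cases h1 : ∃ s ∈ T.verts, ∃ t ∈ B'.verts, A s t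
  · obtain ⟨s, hs, t, ht, hst⟩ := h1
    exact H.reducible_of_out hcore hs ht hst
  by_cases h2 : ∃ s ∈ B'.verts, ∃ t ∈ T.verts, A s t
  · obtain ⟨s, hs, t, ht, hst⟩ := h2
    exact H.reducible_of_in hcore hs ht hst
  by_cases h3 : ∃ v ∈ T.verts, A c v ∨ A v c
  · obtain ⟨v, hv, hcv⟩ := h3
    exact H.reducible_of_turn hcore hv hcv
  by_cases h4 : ∃ s ∈ B'.verts, ∃ t ∈ B'.verts, A s t
  · obtain ⟨s, hs, t, ht, hst⟩ := h4
    obtain ⟨ι, hR, -⟩ := H.star_realized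
    obtain ⟨σ, hσ⟩ := hR.exists_outgoing
    obtain ⟨-, P, D, -, hP, -⟩ := hR.exists_safePartition Template.starFork_check hσ rfl
    exact H.comp_of_core hcore hP hs ht (Or.inl ⟨hst, H.notMem_T hs, H.notMem_T ht⟩)
  -- the only arcs inside `B` are now between `x` and `y`, and `r` provides an arc that leaves `B`
  obtain ⟨r, hr, hru, hrw⟩ := hex
  have hrB' := H.hW hr
  obtain ⟨o, ho, -⟩ := H.host.out r ((H.mem_W_of_B' hrB').2 ⟨hr, hru, hrw⟩)
  have hoB : o ∉ B.verts := fun h => by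
    rcases H.mem_B.1 h with h | h
    · exact h4 ⟨r, hrB', o, h, ho⟩
    · exact h2 ⟨r, hrB', o, h, ho⟩
  obtain ⟨s, hs, t, ht, hst⟩ := hint
  have hs' : s ∈ T.verts := by
    refine (H.mem_B.1 hs).resolve_left fun h => ?_
    rcases H.mem_B.1 ht with h' | h'
    · exact h4 ⟨s, h, t, h', hst⟩
    · exact h2 ⟨s, h, t, h', hst⟩
  have ht' : t ∈ T.verts := (H.mem_B.1 ht).resolve_left fun h => h1 ⟨s, hs', t, h, hst⟩
  have hsx := (H.mem_W_of_T hs').1 ((H.host.arc_mem _ _ hst).1 hs)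
  have htx := (H.mem_W_of_T ht').1 ((H.host.arc_mem _ _ hst).2 ht)
  have hsc : s ≠ c := fun h => h3 ⟨t, ht', Or.inl (h ▸ hst)⟩
  have htc : t ≠ c := fun h => h3 ⟨s, hs', Or.inr (h ▸ hst)⟩
  have hne : s ≠ t := fun h => H.host.irrefl _ (h ▸ hst)
  have hc : ∀ v, A c v → v ∉ T.verts := fun v hv h => h3 ⟨v, h, Or.inl hv⟩
  have hc' : ∀ v ∈ T.verts, ¬ A v c := fun v h hv => h3 ⟨v, h, Or.inr hv⟩
  rcases hsx with rfl | rfl | rfl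
  · rcases htx with rfl | rfl | rfl
    · exact absurd rfl hne
    · exact H.reducible_of_pass hcore hr hrw ho hoB hst hc hc'
    · exact absurd rfl htc
  · rcases htx with rfl | rfl | rfl
    · exact H.swap.reducible_of_pass hcore hr hru ho hoB hst hc hc'
    · exact absurd rfl hne
    · exact absurd rfl htc
  · exact absurd rfl hsc

end AttachedHost

end Attached

/-! ### Big forks -/

section BigForks
variable {V : Type*}

/-- The fork (`j = 0`) and the `j`-big-forks `B` with their connecting sets `C`, together with the
set `W` of the vertices that still have degree two when the half-edges at `C` are counted. -/
inductive BigForkData : ℕ → PGraph V → Set V → Set V → Prop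
  | fork (F : PGraph V) (x y z a b : V)
      (h : F.HasShape [x, y, z, a, b] [(z, x), (z, y), (z, b), (b, a)]) :
      BigForkData 0 F {x, y, a} {x, y, a, b}
  | attach (j : ℕ) (B' T B : PGraph V) (C W : Set V) (z x y c u w : V)
      (h : BigForkData j B' C W) (att : StarAttached B' T B z x y c u w) (hu : u ∈ W) (hw : w ∈ W) :
      BigForkData (j + 1) B (insert c C) ((W \ {u, w}) ∪ {x, y, c})

theorem StarAttached.mem_T {B' T B : PGraph V} {z x y c u w : V}
    (h : StarAttached B' T B z x y c u w) {v : V} :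
    v ∈ T.verts ↔ v = z ∨ v = x ∨ v = y ∨ v = c := by
  rw [h.star.2.1]
  simp

theorem StarAttached.notMem_B' {B' T B : PGraph V} {z x y c u w : V}
    (h : StarAttached B' T B z x y c u w) : z ∉ B'.verts ∧ x ∉ B'.verts ∧ y ∉ B'.verts ∧
      c ∉ B'.verts := by
  have h1 : ∀ v ∈ T.verts, v ∉ B'.verts := fun v hv hv' => Set.disjoint_left.1 h.disj hv' hv
  simp only [h.mem_T] at h1
  exact ⟨h1 z (by tauto), h1 x (by tauto), h1 y (by tauto), h1 c (by tauto)⟩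

theorem StarAttached.distinct {B' T B : PGraph V} {z x y c u w : V}
    (h : StarAttached B' T B z x y c u w) :
    z ≠ x ∧ z ≠ y ∧ z ≠ c ∧ x ≠ y ∧ x ≠ c ∧ y ≠ c := by
  have := h.star.1
  simp only [List.nodup_cons, List.mem_cons, List.not_mem_nil, or_false, not_or, not_false_eq_true,
    List.nodup_nil, and_true] at this
  tauto

namespace BigForkData
variable {j : ℕ} {B : PGraph V} {C W : Set V}

theorem connecting_subset (h : BigForkData j B C W) : C ⊆ B.verts := by
  induction h with
  | fork F x y z a b h =>
    rw [h.2.1]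
    rintro v (rfl | rfl | rfl) <;> simp
  | attach j B' T B C W z x y c u w h att hu hw ih =>
    rw [att.verts]
    rintro v (rfl | hv)
    · exact Or.inr (att.mem_T.2 (by tauto))
    · exact Or.inl (ih hv)

theorem free_subset (h : BigForkData j B C W) : W ⊆ B.verts := by
  induction h with
  | fork F x y z a b h =>
    rw [h.2.1]
    rintro v (rfl | rfl | rfl | rfl) <;> simp
  | attach j B' T B C W z x y c u w h att hu hw ih =>
    rw [att.verts]
    rintro v (hv | hv)
    · exact Or.inl (ih hv.1)
    · refine Or.inr (att.mem_T.2 ?_)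
      simp only [Set.mem_insert_iff, Set.mem_singleton_iff] at hv
      tauto

theorem finite_verts (h : BigForkData j B C W) : B.verts.Finite := by
  induction h with
  | fork F x y z a b h =>
    rw [h.2.1]
    exact List.finite_toSet _
  | attach j B' T B C W z x y c u w h att hu hw ih =>
    rw [att.verts]
    refine ih.union ?_
    rw [att.star.2.1]
    exact List.finite_toSet _

/-- The vertices that keep arcs outnumber the half-edges, because attaching a star fork adds one to
both sides. -/
theorem ncard_free (h : BigForkData j B C W) : W.ncard = C.ncard + 1 ∧ 3 ≤ C.ncard := by
  induction h with
  | fork F x y z a b h =>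
    have hd := h.1
    simp only [List.nodup_cons, List.mem_cons, List.not_mem_nil, or_false, not_or,
      not_false_eq_true, List.nodup_nil, and_true] at hd
    have h1 : ({x, y, a} : Set V).ncard = 3 := Set.ncard_eq_three.2 ⟨x, y, a, by tauto, by tauto,
      by tauto, rfl⟩
    have h2 : ({x, y, a, b} : Set V) = insert b {x, y, a} := by
      ext v
      simp only [Set.mem_insert_iff, Set.mem_singleton_iff]
      tauto
    rw [h2, Set.ncard_insert_of_notMem (by
      simp only [Set.mem_insert_iff, Set.mem_singleton_iff]
      tauto), h1]
    omega
  | attach j B' T B C W z x y c u w h att hu hw ih =>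
    have hfin := h.finite_verts
    have hCf := hfin.subset h.connecting_subset
    have hWf := hfin.subset h.free_subset
    obtain ⟨-, hx, hy, hc⟩ := att.notMem_B'
    have hd := att.distinct
    have h1 : ({x, y, c} : Set V).ncard = 3 := Set.ncard_eq_three.2 ⟨x, y, c, by tauto, by tauto,
      by tauto, rfl⟩
    have h2 : Disjoint (W \ {u, w}) ({x, y, c} : Set V) := by
      rw [Set.disjoint_left]
      rintro v hv (rfl | rfl | rfl)
      · exact hx (h.free_subset hv.1)
      · exact hy (h.free_subset hv.1)
      · exact hc (h.free_subset hv.1)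
    have h3 : (W \ {u, w}).ncard = W.ncard - 2 := by
      rw [Set.ncard_sdiff (by
        rintro v (rfl | rfl)
        · exact hu
        · exact hw), Set.ncard_pair att.ne]
    rw [Set.ncard_union_eq h2 (hWf.subset Set.sdiff_subset), h1, h3,
      Set.ncard_insert_of_notMem (fun h' => hc (h.connecting_subset h')) hCf]
    omega

theorem exists_free_ne (h : BigForkData j B C W) (u w : V) : ∃ s ∈ W, s ≠ u ∧ s ≠ w := by
  obtain ⟨h1, h2⟩ := h.ncard_free
  by_contra hcon
  push Not at hcon
  have : W ⊆ {u, w} := fun v hv => by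
    by_cases hvu : v = u
    · exact Or.inl hvu
    · exact Or.inr (hcon v hv hvu)
  have := (Set.ncard_le_ncard this (by simp)).trans (Set.ncard_insert_le _ _)
  rw [Set.ncard_singleton] at this
  omega

/-- Counting the half-edges at `C`, the vertices in `W` have degree two and all others have degree
three. -/
theorem deg_add (h : BigForkData j B C W) : ∀ v ∈ B.verts,
    (v ∈ W → B.deg v + C.indicator 1 v = 2) ∧ (v ∉ W → B.deg v + C.indicator 1 v = 3) := by
  induction h with
  | fork F x y z a b h =>
    have hd := h.1
    simp only [List.nodup_cons, List.mem_cons, List.not_mem_nil, or_false, not_or,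
      not_false_eq_true, List.nodup_nil, and_true] at hd
    have hn : ∀ v w, w ∈ F.neighborSet v ↔ F.Adj v w := fun v w => Iff.rfl
    have hadj := h.2.2
    simp only [List.mem_cons, List.not_mem_nil, or_false, Prod.mk.injEq] at hadj
    have hx : F.neighborSet x = {z} := by
      ext w; rw [hn, hadj, Set.mem_singleton_iff]; grind
    have hy : F.neighborSet y = {z} := by
      ext w; rw [hn, hadj, Set.mem_singleton_iff]; grind
    have ha : F.neighborSet a = {b} := by
      ext w; rw [hn, hadj, Set.mem_singleton_iff]; grind
    have hb : F.neighborSet b = {z, a} := by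
      ext w; rw [hn, hadj, Set.mem_insert_iff, Set.mem_singleton_iff]; grind
    have hz : F.neighborSet z = {x, y, b} := by
      ext w; rw [hn, hadj, Set.mem_insert_iff, Set.mem_insert_iff, Set.mem_singleton_iff]; grind
    intro v hv
    rw [h.2.1] at hv
    simp only [List.mem_cons, List.not_mem_nil, or_false, Set.mem_ofPred_eq] at hv
    rcases hv with rfl | rfl | rfl | rfl | rfl
    · simp [PGraph.deg, hx]
    · simp [PGraph.deg, hy]
    · have : ({x, y, b} : Set V).ncard = 3 := Set.ncard_eq_three.2 ⟨x, y, b, by tauto, by tauto,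
        by tauto, rfl⟩
      rw [PGraph.deg, hz, this, Set.indicator_of_notMem (by
        simp only [Set.mem_insert_iff, Set.mem_singleton_iff]
        tauto)]
      refine ⟨fun hvW => ?_, fun _ => rfl⟩
      simp only [Set.mem_insert_iff, Set.mem_singleton_iff] at hvW
      tauto
    · simp [PGraph.deg, ha]
    · rw [PGraph.deg, hb, Set.ncard_pair (by tauto), Set.indicator_of_notMem (by
        simp only [Set.mem_insert_iff, Set.mem_singleton_iff]
        tauto)]
      simp
  | attach j B' T B C W z x y c u w h att hu hw ih =>
    have hfin : ∀ v, (B'.neighborSet v).Finite := fun v =>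
      h.finite_verts.subset (B'.neighborSet_subset_verts v)
    obtain ⟨hz', hx', hy', hc'⟩ := att.notMem_B'
    have hd := att.distinct
    have hn : ∀ v w, w ∈ B.neighborSet v ↔ B.Adj v w := fun v w => Iff.rfl
    have hn' : ∀ v w, w ∈ B'.neighborSet v ↔ B'.Adj v w := fun v w => Iff.rfl
    have hadj := att.adj
    have hTadj := att.star.2.2
    simp only [List.mem_cons, List.not_mem_nil, or_false, Prod.mk.injEq] at hTadj
    simp only [hTadj, Sym2.eq_iff] at hadj
    have huB := att.hu
    have hwB := att.hw
    have huw := att.ne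
    have hl : ∀ s t, B'.Adj s t → s ∈ B'.verts := fun s t h => B'.edge_vert h
    have hl' : ∀ s t, B'.Adj s t → t ∈ B'.verts := fun s t h => B'.edge_vert h.symm
    have hCB := h.connecting_subset
    have hWB := h.free_subset
    intro v hv
    rw [att.verts] at hv
    have ind : ∀ v, v ≠ c → (insert c C).indicator (1 : V → ℕ) v = C.indicator 1 v := by
      intro v hv
      by_cases hvC : v ∈ C
      · rw [Set.indicator_of_mem hvC, Set.indicator_of_mem (Set.mem_insert_of_mem _ hvC)]
      · rw [Set.indicator_of_notMem hvC, Set.indicator_of_notMem]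
        rintro (h | h)
        · exact hv h
        · exact hvC h
    rcases hv with hv | hv
    · have hvc : v ≠ c := fun h => hc' (h ▸ hv)
      rw [ind v hvc]
      obtain ⟨ih1, ih2⟩ := ih v hv
      by_cases hvu : v = u
      · subst hvu
        have hN : B.neighborSet v = insert x (B'.neighborSet v) := by
          ext t; rw [hn, hadj, Set.mem_insert_iff, hn']; grind
        have hdeg : B.deg v = B'.deg v + 1 := by
          rw [PGraph.deg, PGraph.deg, hN]
          exact Set.ncard_insert_of_notMem (fun h => hx' (hl' v _ h)) (hfin v)
        refine ⟨fun hvW => ?_, fun _ => ?_⟩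
        · exfalso
          simp only [Set.mem_union, Set.mem_sdiff, Set.mem_insert_iff, Set.mem_singleton_iff] at hvW
          grind
        · have := ih1 hu
          omega
      by_cases hvw : v = w
      · subst hvw
        have hN : B.neighborSet v = insert y (B'.neighborSet v) := by
          ext t; rw [hn, hadj, Set.mem_insert_iff, hn']; grind
        have hdeg : B.deg v = B'.deg v + 1 := by
          rw [PGraph.deg, PGraph.deg, hN]
          exact Set.ncard_insert_of_notMem (fun h => hy' (hl' v _ h)) (hfin v)
        refine ⟨fun hvW => ?_, fun _ => ?_⟩
        · exfalso
          simp only [Set.mem_union, Set.mem_sdiff, Set.mem_insert_iff, Set.mem_singleton_iff] at hvW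
          grind
        · have := ih1 hw
          omega
      have hN : B.neighborSet v = B'.neighborSet v := by
        ext t; rw [hn, hadj, hn']; grind
      have hdeg : B.deg v = B'.deg v := by rw [PGraph.deg, hN, PGraph.deg]
      rw [hdeg]
      have hvW : v ∈ (W \ {u, w}) ∪ ({x, y, c} : Set V) ↔ v ∈ W := by
        simp only [Set.mem_union, Set.mem_sdiff, Set.mem_insert_iff, Set.mem_singleton_iff]
        grind
      rw [hvW]
      exact ⟨ih1, ih2⟩
    · rcases att.mem_T.1 hv with rfl | rfl | rfl | rfl
      · have hN : B.neighborSet v = {x, y, c} := by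
          ext t; rw [hn, hadj, Set.mem_insert_iff, Set.mem_insert_iff, Set.mem_singleton_iff]; grind
        have h3 : ({x, y, c} : Set V).ncard = 3 := Set.ncard_eq_three.2 ⟨x, y, c, by tauto,
          by tauto, by tauto, rfl⟩
        rw [PGraph.deg, hN, h3, ind v (by tauto), Set.indicator_of_notMem fun h' => hz' (hCB h')]
        refine ⟨fun hvW => ?_, fun _ => rfl⟩
        exfalso
        rcases hvW with h | h
        · exact hz' (hWB h.1)
        · simp only [Set.mem_insert_iff, Set.mem_singleton_iff] at h
          tauto
      · have hN : B.neighborSet v = {z, u} := by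
          ext t; rw [hn, hadj, Set.mem_insert_iff, Set.mem_singleton_iff]; grind
        rw [PGraph.deg, hN, Set.ncard_pair (show z ≠ u from fun h => hz' (h ▸ huB)), ind v (by tauto),
          Set.indicator_of_notMem fun h' => hx' (hCB h')]
        simp
      · have hN : B.neighborSet v = {z, w} := by
          ext t; rw [hn, hadj, Set.mem_insert_iff, Set.mem_singleton_iff]; grind
        rw [PGraph.deg, hN, Set.ncard_pair (show z ≠ w from fun h => hz' (h ▸ hwB)), ind v (by tauto),
          Set.indicator_of_notMem fun h' => hy' (hCB h')]
        simp
      · have hN : B.neighborSet v = {z} := by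
          ext t; rw [hn, hadj, Set.mem_singleton_iff]; grind
        rw [PGraph.deg, hN, Set.ncard_singleton, Set.indicator_of_mem (by simp)]
        simp

theorem mem_free_of_deg (h : BigForkData j B C W) {v : V} (hv : v ∈ B.verts)
    (hd : B.deg v ≤ 1 ∨ (B.deg v = 2 ∧ v ∉ C)) : v ∈ W := by
  by_contra hvW
  have h1 := (h.deg_add v hv).2 hvW
  by_cases hvC : v ∈ C
  · rw [Set.indicator_of_mem hvC] at h1
    simp only [Pi.one_apply] at h1
    rcases hd with hd | hd
    · omega
    · exact hd.2 hvC
  · rw [Set.indicator_of_notMem hvC] at h1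
    omega

theorem leaves_eq {F : PGraph V} {x y z a b : V}
    (h : F.HasShape [x, y, z, a, b] [(z, x), (z, y), (z, b), (b, a)]) :
    F.leaves = {x, y, a} := by
  have hF := BigForkData.fork F x y z a b h
  have hd := h.1
  simp only [List.nodup_cons, List.mem_cons, List.not_mem_nil, or_false, not_or,
    not_false_eq_true, List.nodup_nil, and_true] at hd
  ext v
  constructor
  · rintro ⟨hv, h1⟩
    by_contra hC
    have h2 := hF.deg_add v hv
    rw [Set.indicator_of_notMem hC, h1] at h2
    by_cases hW : v ∈ ({x, y, a, b} : Set V)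
    · have := h2.1 hW
      omega
    · have := h2.2 hW
      omega
  · intro hC
    have hv := hF.connecting_subset hC
    have h2 := (hF.deg_add v hv).1 (by
      simp only [Set.mem_insert_iff, Set.mem_singleton_iff] at hC ⊢
      tauto)
    rw [Set.indicator_of_mem hC] at h2
    simp only [Pi.one_apply] at h2
    exact ⟨hv, by omega⟩

theorem of_isBigForkWith (h : PGraph.IsBigForkWith j B C) : ∃ W, BigForkData j B C W := by
  induction h with
  | one F B c hF hB =>
    obtain ⟨x, y, z, a, b, hF⟩ := hF
    rw [leaves_eq hF] at hB ⊢
    obtain ⟨T, z', x', y', u, w, h1, h2, h3, h4, h5, h6⟩ := hB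
    have hd := BigForkData.fork F x y z a b hF
    have hu := h4 u (by simp)
    have hw := h4 w (by simp)
    exact ⟨_, .attach 0 F T B _ _ z' x' y' c u w hd ⟨h1, h2, h3, hu.1, hw.1, h5, h6⟩
      (hd.mem_free_of_deg hu.1 hu.2) (hd.mem_free_of_deg hw.1 hw.2)⟩
  | succ j B' B C c hB' hB ih =>
    obtain ⟨W, hd⟩ := ih
    obtain ⟨T, z', x', y', u, w, h1, h2, h3, h4, h5, h6⟩ := hB
    have hu := h4 u (by simp)
    have hw := h4 w (by simp)
    exact ⟨_, .attach j B' T B _ _ z' x' y' c u w hd ⟨h1, h2, h3, hu.1, hw.1, h5, h6⟩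
      (hd.mem_free_of_deg hu.1 hu.2) (hd.mem_free_of_deg hw.1 hw.2)⟩

end BigForkData

/-- A host of a graph with an arc inside it is reducible if a test succeeds that needs such an arc. -/
theorem Host.reducible_of_internal {E A : V → V → Prop} {B : PGraph V} {C W : Set V}
    (h : Host E A B C W) {t : Template} {ι : ℕ → V} (ht : t.WellFormed) (hs : t.Shaped B ι)
    (hC : ∀ v, v ∈ C ↔ ∃ a ∈ t.halves, v = ι a) (hW : ∀ v, v ∈ W ↔ ∃ s ∈ t.slots, v = ι s)
    {rots : List ℕ} (hc : t.check (fun acc => acc.any fun q => q.2.isSome) (fun _ _ => true) rots = true)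
    (hint : ∃ s ∈ B.verts, ∃ t ∈ B.verts, A s t) : Reducible E A B.verts := by
  refine h.reducible ht hs hC hW hc fun σ hσ => ?_
  obtain ⟨v, hv, v', hv', hvv⟩ := hint
  obtain ⟨s, hs, rfl⟩ := (hW v).1 ((h.arc_mem _ _ hvv).1 hv)
  obtain ⟨s', hs', rfl⟩ := (hW v').1 ((h.arc_mem _ _ hvv).2 hv')
  have h1 := ((hσ s hs).1 s').2 ⟨hs', hvv⟩
  rw [List.any_eq_true]
  refine ⟨(s, σ s), ?_, by simp [h1]⟩
  rw [List.mem_reverse, List.mem_map]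
  exact ⟨s, hs, rfl⟩

section ExtendedFork
variable {F T B : PGraph V} {x y z a b z' x' y' c u w : V}

/-- The shape of the fork with an attached star fork, as a list of vertices and edges. -/
theorem StarAttached.hasShape (att : StarAttached F T B z' x' y' c u w)
    (hF : F.HasShape [x, y, z, a, b] [(z, x), (z, y), (z, b), (b, a)]) :
    B.HasShape [x, y, z, a, b, z', x', y', c]
      [(z, x), (z, y), (z, b), (b, a), (z', x'), (z', y'), (z', c), (x', u), (y', w)] := by
  refine ⟨?_, ?_, ?_⟩
  · have h1 : ([x, y, z, a, b] ++ [z', x', y', c]).Nodup := by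
      rw [List.nodup_append]
      refine ⟨hF.1, att.star.1, ?_⟩
      intro v hv v' hv' hvv
      subst hvv
      have h1 : v ∈ F.verts := by rw [hF.2.1]; exact hv
      have h2 : v ∈ T.verts := by rw [att.star.2.1]; exact hv'
      exact Set.disjoint_left.1 att.disj h1 h2
    exact h1
  · rw [att.verts, hF.2.1, att.star.2.1]
    ext v
    simp only [List.mem_cons, List.not_mem_nil, or_false, Set.mem_union, Set.mem_ofPred_eq]
    tauto
  · intro s t
    have h1 : ∀ p : V × V, p ∈ [(z, x), (z, y), (z, b), (b, a), (z', x'), (z', y'), (z', c),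
        (x', u), (y', w)] ↔ p ∈ [(z, x), (z, y), (z, b), (b, a)] ∨
          p ∈ [(z', x'), (z', y'), (z', c)] ∨ p = (x', u) ∨ p = (y', w) := by
      intro p
      rw [← List.mem_pair, ← List.mem_append, ← List.mem_append]
      rfl
    have h2 : ∀ p q : V, s(s, t) = s(p, q) ↔ (s, t) = (p, q) ∨ (t, s) = (p, q) := by
      intro p q
      rw [Sym2.eq_iff, Prod.mk.injEq, Prod.mk.injEq]
      tauto
    rw [att.adj, hF.2.2, att.star.2.2, h1, h1, h2, h2]
    tauto

theorem extendedFork_reducible {E A : V → V → Prop}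
    (hF : F.HasShape [x, y, z, a, b] [(z, x), (z, y), (z, b), (b, a)])
    (att : StarAttached F T B z' x' y' c u w)
    (hh : Host E A B (insert c {x, y, a}) (({x, y, a, b} \ {u, w}) ∪ {x', y', c}))
    (hint : ∃ s ∈ B.verts, ∃ t ∈ B.verts, A s t)
    (huw : (u = x ∧ w = y) ∨ (u = x ∧ w = a) ∨ (u = x ∧ w = b) ∨ (u = a ∧ w = b)) :
    Reducible E A B.verts := by
  have hsh := att.hasShape hF
  have hd := hF.1
  simp only [List.nodup_cons, List.mem_cons, List.not_mem_nil, or_false, not_or,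
    not_false_eq_true, List.nodup_nil, and_true] at hd
  have hC : ∀ p q v, v ∈ (insert c {x, y, a} : Set V) ↔ ∃ k ∈ (Template.extendedFork p q).halves,
      v = [x, y, z, a, b, z', x', y', c].getD k x := by
    intro p q v
    simp only [Template.extendedFork, List.mem_cons, List.not_mem_nil, or_false,
      Set.mem_insert_iff, Set.mem_singleton_iff, exists_eq_or_imp, exists_eq_left,
      List.getD_cons_succ, List.getD_cons_zero]
    tauto
  rcases huw with ⟨rfl, rfl⟩ | ⟨rfl, rfl⟩ | ⟨rfl, rfl⟩ | ⟨rfl, rfl⟩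
  · have wf : (Template.extendedFork 0 1).WellFormed := ⟨by decide, by decide, by decide⟩
    have hsl : (Template.extendedFork 0 1).slots = [3, 4, 6, 7, 8] := by decide
    refine hh.reducible_of_internal wf (hsh.shaped u rfl wf) (hC 0 1) (fun v => ?_)
      Template.extendedFork_check_0_1 hint
    simp only [hsl, List.mem_cons, List.not_mem_nil, or_false, Set.mem_union, Set.mem_sdiff,
      Set.mem_insert_iff, Set.mem_singleton_iff, exists_eq_or_imp, exists_eq_left,
      List.getD_cons_succ, List.getD_cons_zero]
    grind
  · have wf : (Template.extendedFork 0 3).WellFormed := ⟨by decide, by decide, by decide⟩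
    have hsl : (Template.extendedFork 0 3).slots = [1, 4, 6, 7, 8] := by decide
    refine hh.reducible_of_internal wf (hsh.shaped u rfl wf) (hC 0 3) (fun v => ?_)
      Template.extendedFork_check_0_3 hint
    simp only [hsl, List.mem_cons, List.not_mem_nil, or_false, Set.mem_union, Set.mem_sdiff,
      Set.mem_insert_iff, Set.mem_singleton_iff, exists_eq_or_imp, exists_eq_left,
      List.getD_cons_succ, List.getD_cons_zero]
    grind
  · have wf : (Template.extendedFork 0 4).WellFormed := ⟨by decide, by decide, by decide⟩
    have hsl : (Template.extendedFork 0 4).slots = [1, 3, 6, 7, 8] := by decide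
    refine hh.reducible_of_internal wf (hsh.shaped u rfl wf) (hC 0 4) (fun v => ?_)
      Template.extendedFork_check_0_4 hint
    simp only [hsl, List.mem_cons, List.not_mem_nil, or_false, Set.mem_union, Set.mem_sdiff,
      Set.mem_insert_iff, Set.mem_singleton_iff, exists_eq_or_imp, exists_eq_left,
      List.getD_cons_succ, List.getD_cons_zero]
    grind
  · have wf : (Template.extendedFork 3 4).WellFormed := ⟨by decide, by decide, by decide⟩
    have hsl : (Template.extendedFork 3 4).slots = [0, 1, 6, 7, 8] := by decide
    refine hh.reducible_of_internal wf (hsh.shaped x rfl wf) (hC 3 4) (fun v => ?_)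
      Template.extendedFork_check_3_4 hint
    simp only [hsl, List.mem_cons, List.not_mem_nil, or_false, Set.mem_union, Set.mem_sdiff,
      Set.mem_insert_iff, Set.mem_singleton_iff, exists_eq_or_imp, exists_eq_left,
      List.getD_cons_succ, List.getD_cons_zero]
    grind

end ExtendedFork

/-- A big fork is reducible if there is an arc inside it. The induction starts with the `1`-big-forks
(the fork itself does not have this property), where it is verified by the tests. -/
theorem BigForkData.reducible {j : ℕ} {B : PGraph V} {C W : Set V} (h : BigForkData j B C W)
    (hj : 1 ≤ j) : ∀ E A, Host E A B C W → (∃ s ∈ B.verts, ∃ t ∈ B.verts, A s t) →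
      Reducible E A B.verts := by
  induction h with
  | fork => omega
  | attach j B' T B C W z' x' y' c u w h att hu hw ih =>
    intro E A hh hint
    rcases Nat.eq_zero_or_pos j with rfl | hj'
    · cases h with
      | fork _ x y z a b hF =>
      -- the fork with `x` and `y` exchanged, to reach the four tested cases
      have hF' : B'.HasShape [y, x, z, a, b] [(z, y), (z, x), (z, b), (b, a)] := by
        have hp := List.Perm.swap y x [z, a, b]
        have hp' := List.Perm.swap (z, y) (z, x) [(z, b), (b, a)]
        refine ⟨hp.nodup_iff.1 hF.1, ?_, ?_⟩
        · rw [hF.2.1]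
          ext v
          exact hp.mem_iff
        · intro s t
          rw [hF.2.2, hp'.mem_iff, hp'.mem_iff]
      have e1 : (insert c {x, y, a} : Set V) = insert c {y, x, a} := by
        rw [Set.insert_comm x y]
      have e2 : (({x, y, a, b} \ {u, w}) ∪ {x', y', c} : Set V) =
          ({y, x, a, b} \ {u, w}) ∪ {x', y', c} := by
        rw [Set.insert_comm x y]
      have e3 : ∀ s : Set V, (s \ {u, w}) ∪ {x', y', c} = (s \ {w, u}) ∪ {y', x', c} := by
        intro s
        rw [Set.pair_comm u w, Set.insert_comm x' y']
      have hh1 := hh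
      rw [e3] at hh1
      have hh2 := hh
      rw [e1, e2] at hh2
      have hh3 := hh2
      rw [e3] at hh3
      simp only [Set.mem_insert_iff, Set.mem_singleton_iff] at hu hw
      have hne := att.ne
      rcases hu with rfl | rfl | rfl | rfl <;> rcases hw with rfl | rfl | rfl | rfl <;>
        first
        | exact absurd rfl hne
        | (refine extendedFork_reducible hF att hh hint ?_; simp; done)
        | (refine extendedFork_reducible hF att.swap hh1 hint ?_; simp; done)
        | (refine extendedFork_reducible hF' att hh2 hint ?_; simp; done)
        | (refine extendedFork_reducible hF' att.swap hh3 hint ?_; simp)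
    · exact AttachedHost.reducible ⟨att, hh, h.connecting_subset, h.free_subset, hu, hw⟩
        (ih hj') (h.exists_free_ne u w) hint

end BigForks

/-! ### Bold graphs in a mixed graph -/

section Bold
variable {V : Type*}

/-- A bold `K` in the mixed graph `M`. The additional edges of `K` are those of `D`, the half-edges
at `C ∪ X` have become the edges in `J`, and `W` is the set of the vertices of `K` that have degree
two if the edges in `D` and the half-edges at `X` are not counted. -/
structure BoldHost (M : MixedGraph V) (K : PGraph V) (C W X : Set V) (D : SimpleGraph V)
    (J : Set (V × V)) : Prop where
  adj : ∀ u v, u ∈ K.verts → (M.E.Adj u v ↔ K.Adj u v ∨ D.Adj u v ∨ (u, v) ∈ J)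
  joint_mem : ∀ u v, (u, v) ∈ J → u ∈ K.verts ∧ v ∉ K.verts
  joint_inj : ∀ u u' v, (u, v) ∈ J → (u', v) ∈ J → u = u'
  joint_card : ∀ v ∈ K.verts, {t | (v, t) ∈ J}.encard = (C.indicator 1 v + X.indicator 1 v : ℕ)
  joint_arc : ∀ u v, (u, v) ∈ J → ∀ b, (v, b) ∉ M.arcs ∧ (b, v) ∉ M.arcs
  extra_mem : ∀ u v, D.Adj u v → u ∈ W ∧ v ∈ W ∧ ¬ K.Adj u v
  extra_unique : ∀ u v w, D.Adj u v → D.Adj u w → v = w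
  extra_half : ∀ u v, D.Adj u v → u ∉ X
  subC : C ⊆ K.verts
  subW : W ⊆ K.verts
  subX : X ⊆ W
  out : ∀ s ∈ W, s ∉ X → (∀ v, ¬ D.Adj s v) → ∃! v, (s, v) ∈ M.arcs
  inn : ∀ s ∈ W, s ∉ X → (∀ v, ¬ D.Adj s v) → ∃! v, (v, s) ∈ M.arcs
  arc_mem : ∀ u v, (u, v) ∈ M.arcs →
    (u ∈ K.verts → u ∈ W ∧ u ∉ X ∧ ∀ t, ¬ D.Adj u t) ∧
    (v ∈ K.verts → v ∈ W ∧ v ∉ X ∧ ∀ t, ¬ D.Adj v t)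

/-- The edges of `K` together with one half-edge at each vertex `c` of `C`, which leads to `τ c`. -/
def plainEdges (K : PGraph V) (C : Set V) (τ : V → V) (a b : V) : Prop :=
  K.Adj a b ∨ (a ∈ C ∧ b = τ a) ∨ (b ∈ C ∧ a = τ b)

/-- The half-edges at `X`. -/
def extraHalf (C X : Set V) (J : Set (V × V)) (τ : V → V) (a b : V) : Prop :=
  (a, b) ∈ J ∧ a ∈ X ∧ ¬ (a ∈ C ∧ b = τ a)

/-- The edges that are treated as pairs of opposite arcs. -/
def extraEdges (C X : Set V) (D : SimpleGraph V) (J : Set (V × V)) (τ : V → V) (a b : V) : Prop :=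
  D.Adj a b ∨ extraHalf C X J τ a b ∨ extraHalf C X J τ b a

open Classical in
/-- The directed edge without the information that it is an arc, if it belongs to `R`. -/
noncomputable def unmark (R : V → V → Prop) (p : Piece V) : Piece V :=
  if R p.src p.tgt then ⟨p.src, p.tgt, false⟩ else p

namespace BoldHost
variable {M : MixedGraph V} {K : PGraph V} {C W X : Set V} {D : SimpleGraph V} {J : Set (V × V)}

/-- Among the one or two edges in `J` at a vertex `c` of `C`, one is chosen to be the half-edge of the
member of the fork-collection; the others come from `X`. -/
theorem exists_choice (h : BoldHost M K C W X D J) : ∃ τ : V → V, (∀ c ∈ C, (c, τ c) ∈ J) ∧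
    (∀ v ∈ X, ∃! t, (v, t) ∈ J ∧ ¬ (v ∈ C ∧ t = τ v)) ∧
    (∀ u v, (u, v) ∈ J → (u ∈ C ∧ v = τ u) ∨ extraHalf C X J τ u v) := by
  have h1 : ∀ c, ∃ t, c ∈ C → (c, t) ∈ J := by
    intro c
    by_cases hc : c ∈ C
    · have h2 : {t | (c, t) ∈ J}.Nonempty := by
        refine Set.encard_ne_zero.1 ?_
        rw [h.joint_card c (h.subC hc), Set.indicator_of_mem hc]
        simp
      obtain ⟨t, ht⟩ := h2
      exact ⟨t, fun _ => ht⟩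
    · exact ⟨c, fun h => absurd h hc⟩
  choose τ hτ using h1
  refine ⟨τ, hτ, fun v hv => ?_, fun u v huv => ?_⟩
  · have h2 := h.joint_card v (h.subW (h.subX hv))
    rw [Set.indicator_of_mem hv] at h2
    by_cases hc : v ∈ C
    · rw [Set.indicator_of_mem hc] at h2
      have h3 : {t | (v, t) ∈ J}.encard = 2 := by
        rw [h2]
        rfl
      obtain ⟨a, b, hab, h4⟩ := Set.encard_eq_two.1 h3
      have h5 : ∀ t, (v, t) ∈ J ↔ t = a ∨ t = b := fun t => by
        have := Set.ext_iff.1 h4 t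
        simpa using this
      have h6 := (h5 _).1 (hτ v hc)
      rcases h6 with h6 | h6
      · refine ⟨b, ⟨(h5 b).2 (by simp), fun h7 => hab (h6 ▸ h7.2.symm)⟩, ?_⟩
        rintro t ⟨ht, ht'⟩
        rcases (h5 t).1 ht with h7 | h7
        · exact absurd ⟨hc, h7.trans h6.symm⟩ ht'
        · exact h7
      · refine ⟨a, ⟨(h5 a).2 (by simp), fun h7 => hab (h6 ▸ h7.2)⟩, ?_⟩
        rintro t ⟨ht, ht'⟩
        rcases (h5 t).1 ht with h7 | h7
        · exact h7
        · exact absurd ⟨hc, h7.trans h6.symm⟩ ht'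
    · rw [Set.indicator_of_notMem hc] at h2
      obtain ⟨a, h4⟩ := Set.encard_eq_one.1 (h2.trans (by simp))
      have h5 : ∀ t, (v, t) ∈ J ↔ t = a := fun t => by
        have := Set.ext_iff.1 h4 t
        simpa using this
      exact ⟨a, ⟨(h5 a).2 rfl, fun h7 => hc h7.1⟩, fun t ht => (h5 t).1 ht.1⟩
  · by_cases h3 : u ∈ C ∧ v = τ u
    · exact Or.inl h3
    · refine Or.inr ⟨huv, ?_, h3⟩
      by_contra hX
      have h2 := h.joint_card u (h.joint_mem u v huv).1
      rw [Set.indicator_of_notMem hX] at h2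
      by_cases hc : u ∈ C
      · rw [Set.indicator_of_mem hc] at h2
        obtain ⟨a, h4⟩ := Set.encard_eq_one.1 (h2.trans (by simp))
        have h5 : ∀ t, (u, t) ∈ J ↔ t = a := fun t => by
          have := Set.ext_iff.1 h4 t
          simpa using this
        exact h3 ⟨hc, ((h5 v).1 huv).trans ((h5 _).1 (hτ u hc)).symm⟩
      · rw [Set.indicator_of_notMem hc] at h2
        have h4 : {t | (u, t) ∈ J} = ∅ := Set.encard_eq_zero.1 (by simpa using h2)
        have h5 : v ∈ {t | (u, t) ∈ J} := huv
        rw [h4] at h5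
        exact h5

variable {τ : V → V}

/-- With the extra edges treated as pairs of opposite arcs, the surroundings of `K` are as if there
were no extra edges. -/
theorem host (h : BoldHost M K C W X D J) (h1 : ∀ c ∈ C, (c, τ c) ∈ J)
    (h2 : ∀ v ∈ X, ∃! t, (v, t) ∈ J ∧ ¬ (v ∈ C ∧ t = τ v)) :
    Host (plainEdges K C τ) (fun a b => (a, b) ∈ M.arcs ∨ extraEdges C X D J τ a b) K C W := by
  have hτS : ∀ c ∈ C, τ c ∉ K.verts := fun c hc => (h.joint_mem _ _ (h1 c hc)).2
  have hl : ∀ a b, K.Adj a b → a ∈ K.verts := fun a b hab => K.edge_vert hab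
  have hl' : ∀ a b, K.Adj a b → b ∈ K.verts := fun a b hab => K.edge_vert hab.symm
  have hout : ∀ s ∈ K.verts, ∀ t, t ∉ K.verts → plainEdges K C τ s t → s ∈ C ∧ t = τ s := by
    rintro s hs t ht (h3 | h3 | h3)
    · exact absurd (hl' _ _ h3) ht
    · exact h3
    · exact absurd (h.subC h3.1) ht
  have hX : ∀ a b, extraHalf C X J τ a b → a ∈ K.verts ∧ b ∉ K.verts := fun a b hab =>
    h.joint_mem a b hab.1
  have hsymm : ∀ a b, extraEdges C X D J τ a b → extraEdges C X D J τ b a := by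
    rintro a b (h3 | h3 | h3)
    · exact Or.inl h3.symm
    · exact Or.inr (Or.inr h3)
    · exact Or.inr (Or.inl h3)
  have hone : ∀ s ∈ W, (∃ v, extraEdges C X D J τ s v) ∨ (s ∉ X ∧ ∀ v, ¬ D.Adj s v) := by
    intro s hs
    by_cases hsX : s ∈ X
    · obtain ⟨t, ht, -⟩ := h2 s hsX
      exact Or.inl ⟨t, Or.inr (Or.inl ⟨ht.1, hsX, ht.2⟩)⟩
    · by_cases hsD : ∃ v, D.Adj s v
      · obtain ⟨v, hv⟩ := hsD
        exact Or.inl ⟨v, Or.inl hv⟩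
      · push Not at hsD
        exact Or.inr ⟨hsX, hsD⟩
  have hu : ∀ s ∈ W, ∀ v v', extraEdges C X D J τ s v → extraEdges C X D J τ s v' → v = v' := by
    rintro s hs v v' (h3 | h3 | h3) (h4 | h4 | h4)
    · exact h.extra_unique s v v' h3 h4
    · exact absurd h4.2.1 (h.extra_half s v h3)
    · exact absurd (h.subW hs) (hX _ _ h4).2
    · exact absurd h3.2.1 (h.extra_half s v' h4)
    · exact (h2 s h3.2.1).unique ⟨h3.1, h3.2.2⟩ ⟨h4.1, h4.2.2⟩
    · exact absurd (h.subW hs) (hX _ _ h4).2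
    · exact absurd (h.subW hs) (hX _ _ h3).2
    · exact absurd (h.subW hs) (hX _ _ h3).2
    · exact absurd (h.subW hs) (hX _ _ h3).2
  have hfree : ∀ s ∈ W, s ∉ X → (∀ v, ¬ D.Adj s v) → ∀ v, ¬ extraEdges C X D J τ s v := by
    rintro s hs hsX hsD v (h3 | h3 | h3)
    · exact hsD v h3
    · exact hsX h3.2.1
    · exact absurd (h.subW hs) (hX _ _ h3).2
  have hmem : ∀ s v, extraEdges C X D J τ s v → s ∈ K.verts → s ∈ W := by
    rintro s v (h3 | h3 | h3) hs
    · exact (h.extra_mem s v h3).1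
    · exact h.subX h3.2.1
    · exact absurd hs (hX _ _ h3).2
  have hext : ∀ a t, extraEdges C X D J τ a t → a ∈ K.verts → t ∉ K.verts →
      ∀ s ∈ K.verts, ¬ plainEdges K C τ s t := by
    intro a t h3 ha ht s hs h4
    obtain ⟨h5, h6⟩ := hout s hs t ht h4
    rcases h3 with h3 | h3 | h3
    · exact ht (h.subW (h.extra_mem a t h3).2.1)
    · have := h.joint_inj a s t h3.1 (h6 ▸ h1 s h5)
      subst this
      exact h3.2.2 ⟨h5, h6⟩
    · exact absurd ha (hX _ _ h3).2
  refine ⟨?_, ?_, ?_, ?_, ?_, ?_, ?_, ?_, ?_, ?_, ?_⟩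
  · rintro a b (h3 | h3 | h3)
    · exact Or.inl h3.symm
    · exact Or.inr (Or.inr h3)
    · exact Or.inr (Or.inl h3)
  · intro a ha b hb
    constructor
    · rintro (h3 | h3 | h3)
      · exact h3
      · exact absurd (h3.2 ▸ hb) (hτS a h3.1)
      · exact absurd (h3.2 ▸ ha) (hτS b h3.1)
    · exact Or.inl
  · intro c hc
    exact ⟨τ c, ⟨hτS c hc, Or.inr (Or.inl ⟨hc, rfl⟩)⟩,
      fun t ht => (hout c (h.subC hc) t ht.1 ht.2).2⟩
  · exact fun v hv t ht hvt => (hout v hv t ht hvt).1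
  · intro c hc c' hc' t ht h3 h4
    obtain ⟨h5, h6⟩ := hout c hc t ht h3
    obtain ⟨h7, h8⟩ := hout c' hc' t ht h4
    exact h.joint_inj c c' t (h6 ▸ h1 c h5) (h8 ▸ h1 c' h7)
  · intro s hs
    rcases hone s hs with ⟨v, hv⟩ | ⟨h3, h4⟩
    · refine ⟨v, Or.inr hv, ?_⟩
      rintro v' (hv' | hv')
      · obtain ⟨h3, h4, h5⟩ := (h.arc_mem _ _ hv').1 (h.subW hs)
        exact absurd hv (hfree s hs h4 h5 v)
      · exact hu s hs v' v hv' hv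
    · obtain ⟨v, hv, hv'⟩ := h.out s hs h3 h4
      refine ⟨v, Or.inl hv, ?_⟩
      rintro v' (h5 | h5)
      · exact hv' v' h5
      · exact absurd h5 (hfree s hs h3 h4 v')
  · intro s hs
    rcases hone s hs with ⟨v, hv⟩ | ⟨h3, h4⟩
    · refine ⟨v, Or.inr (hsymm _ _ hv), ?_⟩
      rintro v' (hv' | hv')
      · obtain ⟨h3, h4, h5⟩ := (h.arc_mem _ _ hv').2 (h.subW hs)
        exact absurd hv (hfree s hs h4 h5 v)
      · exact hu s hs v' v (hsymm _ _ hv') hv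
    · obtain ⟨v, hv, hv'⟩ := h.inn s hs h3 h4
      refine ⟨v, Or.inl hv, ?_⟩
      rintro v' (h5 | h5)
      · exact hv' v' h5
      · exact absurd (hsymm _ _ h5) (hfree s hs h3 h4 v')
  · rintro a b (h3 | h3)
    · exact ⟨fun ha => ((h.arc_mem a b h3).1 ha).1, fun hb => ((h.arc_mem a b h3).2 hb).1⟩
    · exact ⟨hmem a b h3, hmem b a (hsymm _ _ h3)⟩
  · rintro v (h3 | h3 | h3 | h3)
    · exact M.arcs_ne _ h3 rfl
    · exact D.irrefl h3
    · exact (hX _ _ h3).2 (hX _ _ h3).1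
    · exact (hX _ _ h3).2 (hX _ _ h3).1
  · rintro a b (h3 | h3) ha hb s hs h4
    · obtain ⟨h5, h6⟩ := hout s hs b hb h4
      exact (h.joint_arc s b (h6 ▸ h1 s h5) a).2 h3
    · exact hext a b h3 ha hb s hs h4
  · rintro a b (h3 | h3) hb ha s hs h4
    · obtain ⟨h5, h6⟩ := hout s hs a ha h4
      exact (h.joint_arc s a (h6 ▸ h1 s h5) b).1 h3
    · exact hext b a (hsymm _ _ h3) hb ha s hs h4

/-- Once a reduction is found, the extra edges count as edges again. -/
theorem reducible_of_partition (h : BoldHost M K C W X D J) (h1 : ∀ c ∈ C, (c, τ c) ∈ J)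
    (h3 : ∀ u v, (u, v) ∈ J → (u ∈ C ∧ v = τ u) ∨ extraHalf C X J τ u v)
    {Q : Set (Piece V)} {P R : Set (List (Piece V))} (hQ : SafePartition Q K.verts P R)
    {Q₀ : Set (Piece V)}
    (hQ₀ : Q₀ = piecesOf (plainEdges K C τ) (fun a b => (a, b) ∈ M.arcs ∨ extraEdges C X D J τ a b)
      K.verts)
    (hsub : ∀ p ∈ Q, p ∈ Q₀ ∨ ∃ q ∈ Q₀, extraEdges C X D J τ q.src q.tgt ∧
      p = ⟨q.src, q.tgt, false⟩ ∧ q ∉ Q ∧ (q.src ∉ K.verts ∨ q.tgt ∉ K.verts))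
    (hsup : ∀ q ∈ Q₀, q ∈ Q ∨ (extraEdges C X D J τ q.src q.tgt ∧ ⟨q.src, q.tgt, false⟩ ∈ Q)) :
    Reducible M.E.Adj (fun a b => (a, b) ∈ M.arcs) K.verts := by
  have hτS : ∀ c ∈ C, τ c ∉ K.verts := fun c hc => (h.joint_mem _ _ (h1 c hc)).2
  have hl : ∀ a b, K.Adj a b → a ∈ K.verts := fun a b hab => K.edge_vert hab
  have hl' : ∀ a b, K.Adj a b → b ∈ K.verts := fun a b hab => K.edge_vert hab.symm
  have hX : ∀ a b, extraHalf C X J τ a b → a ∈ K.verts ∧ b ∉ K.verts := fun a b hab =>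
    h.joint_mem a b hab.1
  have hsymm : ∀ a b, extraEdges C X D J τ a b → extraEdges C X D J τ b a := by
    rintro a b (h3 | h3 | h3)
    · exact Or.inl h3.symm
    · exact Or.inr (Or.inr h3)
    · exact Or.inr (Or.inl h3)
  -- extra edges are neither plain edges nor joined by arcs
  have hplain : ∀ a b, extraEdges C X D J τ a b → ¬ plainEdges K C τ a b := by
    rintro a b (h4 | h4 | h4)
    · obtain ⟨ha, hb, hab⟩ := h.extra_mem a b h4
      rintro (h5 | h5 | h5)
      · exact hab h5
      · exact hτS a h5.1 (h5.2 ▸ h.subW hb)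
      · exact hτS b h5.1 (h5.2 ▸ h.subW ha)
    · obtain ⟨ha, hb⟩ := hX _ _ h4
      rintro (h5 | h5 | h5)
      · exact hb (hl' _ _ h5)
      · exact h4.2.2 h5
      · exact hb (h.subC h5.1)
    · obtain ⟨hb, ha⟩ := hX _ _ h4
      rintro (h5 | h5 | h5)
      · exact ha (hl _ _ h5)
      · exact ha (h.subC h5.1)
      · exact h4.2.2 h5
  have harc : ∀ a b, extraEdges C X D J τ a b → (a, b) ∉ M.arcs := by
    rintro a b (h4 | h4 | h4) h5
    · exact ((h.arc_mem a b h5).1 (h.subW (h.extra_mem a b h4).1)).2.2 b h4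
    · exact ((h.arc_mem a b h5).1 (hX _ _ h4).1).2.1 h4.2.1
    · exact ((h.arc_mem a b h5).2 (hX _ _ h4).1).2.1 h4.2.1
  have hadj : ∀ a b, a ∈ K.verts ∨ b ∈ K.verts →
      (M.E.Adj a b ↔ plainEdges K C τ a b ∨ extraEdges C X D J τ a b) := by
    have key : ∀ a b, a ∈ K.verts →
        (M.E.Adj a b ↔ plainEdges K C τ a b ∨ extraEdges C X D J τ a b) := by
      intro a b ha
      rw [h.adj a b ha]
      constructor
      · rintro (h4 | h4 | h4)
        · exact Or.inl (Or.inl h4)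
        · exact Or.inr (Or.inl h4)
        · rcases h3 a b h4 with h5 | h5
          · exact Or.inl (Or.inr (Or.inl h5))
          · exact Or.inr (Or.inr (Or.inl h5))
      · rintro ((h4 | h4 | h4) | h4 | h4 | h4)
        · exact Or.inl h4
        · exact Or.inr (Or.inr (h4.2 ▸ h1 a h4.1))
        · exact absurd (h4.2 ▸ ha) (hτS b h4.1)
        · exact Or.inr (Or.inl h4)
        · exact Or.inr (Or.inr h4.1)
        · exact absurd ha (hX _ _ h4).2
    rintro a b (ha | hb)
    · exact key a b ha
    · rw [M.E.adj_comm, key b a hb]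
      refine or_congr ⟨?_, ?_⟩ ⟨hsymm b a, hsymm a b⟩ <;>
        · rintro (h4 | h4 | h4)
          · exact Or.inl h4.symm
          · exact Or.inr (Or.inr h4)
          · exact Or.inr (Or.inl h4)
  have hg1 : ∀ p : Piece V, (unmark (extraEdges C X D J τ) p).src = p.src := fun p => by
    unfold unmark; split_ifs <;> rfl
  have hg2 : ∀ p : Piece V, (unmark (extraEdges C X D J τ) p).tgt = p.tgt := fun p => by
    unfold unmark; split_ifs <;> rfl
  have hgp : ∀ p : Piece V, extraEdges C X D J τ p.src p.tgt →
      unmark (extraEdges C X D J τ) p = ⟨p.src, p.tgt, false⟩ := fun p hp => if_pos hp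
  have hgn : ∀ p : Piece V, ¬ extraEdges C X D J τ p.src p.tgt →
      unmark (extraEdges C X D J τ) p = p := fun p hp => if_neg hp
  have hflag : ∀ q ∈ Q₀, extraEdges C X D J τ q.src q.tgt → q.isArc = true := by
    intro q hq hq'
    rw [hQ₀] at hq
    rcases hq.2 with h4 | h4
    · exact h4.1
    · exact absurd h4.2 (hplain _ _ hq')
  refine hQ.relabel (unmark (extraEdges C X D J τ)) hg1 hg2 ?_ ?_ ?_ ?_
  · intro p hp
    by_cases hs : extraEdges C X D J τ p.src p.tgt
    · rw [hgp p hs] at hp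
      exact absurd hp (by simp)
    · rwa [hgn p hs] at hp
  · intro p hp p' hp' hpp
    have e1 : p.src = p'.src := by rw [← hg1 p, hpp, hg1]
    have e2 : p.tgt = p'.tgt := by rw [← hg2 p, hpp, hg2]
    by_cases hs : extraEdges C X D J τ p.src p.tgt
    · have hs' := hs
      rw [e1, e2] at hs'
      have hext : ∀ q q' : Piece V, q.src = q'.src → q.tgt = q'.tgt → q.isArc = q'.isArc →
          q = q' := by
        rintro ⟨_, _, _⟩ ⟨_, _, _⟩ rfl rfl rfl
        rfl
      rcases hsub p hp with h4 | ⟨q, hq, hqs, rfl, hqQ, -⟩ <;>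
        rcases hsub p' hp' with h5 | ⟨q', hq', hqs', rfl, hqQ', -⟩
      · exact hext _ _ e1 e2 ((hflag p h4 hs).trans (hflag p' h5 hs').symm)
      · exact absurd (hext p q' e1 e2 ((hflag p h4 hs).trans (hflag q' hq' hqs').symm) ▸ hp) hqQ'
      · exact absurd (hext q p' e1 e2 ((hflag q hq hqs).trans (hflag p' h5 hs').symm) ▸ hp') hqQ
      · exact hext _ _ e1 e2 rfl
    · have hs' := hs
      rw [e1, e2] at hs'
      rwa [hgn p hs, hgn p' hs'] at hpp
  · ext p
    constructor
    · rintro ⟨h4, h5 | h5⟩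
      · have hp : p ∈ Q₀ := by
          rw [hQ₀]
          exact ⟨h4, Or.inl ⟨h5.1, Or.inl h5.2⟩⟩
        have hns : ¬ extraEdges C X D J τ p.src p.tgt := fun hs => harc _ _ hs h5.2
        exact ⟨p, (hsup p hp).resolve_right fun h6 => hns h6.1, hgn p hns⟩
      · rcases (hadj _ _ h4).1 h5.2 with h6 | h6
        · have hp : p ∈ Q₀ := by
            rw [hQ₀]
            exact ⟨h4, Or.inr ⟨h5.1, h6⟩⟩
          have hns : ¬ extraEdges C X D J τ p.src p.tgt := fun hs => hplain _ _ hs h6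
          exact ⟨p, (hsup p hp).resolve_right fun h6 => hns h6.1, hgn p hns⟩
        · have hp : (⟨p.src, p.tgt, true⟩ : Piece V) ∈ Q₀ := by
            rw [hQ₀]
            exact ⟨h4, Or.inl ⟨rfl, Or.inr h6⟩⟩
          have hpe : p = ⟨p.src, p.tgt, false⟩ := by rw [← h5.1]
          rcases hsup _ hp with h7 | h7
          · exact ⟨_, h7, (hgp ⟨p.src, p.tgt, true⟩ h6).trans hpe.symm⟩
          · exact ⟨_, h7.2, (hgp ⟨p.src, p.tgt, false⟩ h6).trans hpe.symm⟩
    · rintro ⟨q, hq, rfl⟩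
      have h4 : ∃ q' ∈ Q₀, q'.src = q.src ∧ q'.tgt = q.tgt ∧
          (¬ extraEdges C X D J τ q.src q.tgt → q' = q) := by
        rcases hsub q hq with h4 | ⟨q', hq', hqs, rfl, -⟩
        · exact ⟨q, h4, rfl, rfl, fun _ => rfl⟩
        · exact ⟨q', hq', rfl, rfl, fun h => absurd hqs h⟩
      obtain ⟨q', hq', e1, e2, h5⟩ := h4
      rw [hQ₀] at hq'
      have ht : q.src ∈ K.verts ∨ q.tgt ∈ K.verts := by
        rw [← e1, ← e2]
        exact hq'.1
      by_cases hs : extraEdges C X D J τ q.src q.tgt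
      · rw [hgp q hs]
        exact ⟨ht, Or.inr ⟨rfl, (hadj _ _ ht).2 (Or.inr hs)⟩⟩
      · rw [hgn q hs]
        have := h5 hs
        subst this
        refine ⟨ht, ?_⟩
        rcases hq'.2 with ⟨h6, h7⟩ | h6
        · exact Or.inl ⟨h6, h7.resolve_right hs⟩
        · exact Or.inr ⟨h6.1, (hadj _ _ ht).2 (Or.inl h6.2)⟩
  · intro p hp q hq hpa hqa hps hpt e1 e2
    have hp0 : p ∈ Q₀ := by
      rcases hsub p hp with h4 | ⟨q', -, -, rfl, -⟩
      · exact h4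
      · exact absurd hpa (by simp)
    by_cases hs : extraEdges C X D J τ p.src p.tgt
    · exfalso
      have hs' := hsymm _ _ hs
      rw [e1, ← e2] at hs'
      rcases hsub q hq with h4 | ⟨q', -, -, rfl, -, h5⟩
      · rw [hflag q h4 hs'] at hqa
        exact absurd hqa (by simp)
      · simp only at e1 e2 h5
        rw [← e1, e2] at h5
        tauto
    · rwa [hgn p hs]

theorem reducible_of_plain (h : BoldHost M K C W X D J) (h1 : ∀ c ∈ C, (c, τ c) ∈ J)
    (h3 : ∀ u v, (u, v) ∈ J → (u ∈ C ∧ v = τ u) ∨ extraHalf C X J τ u v)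
    (hr : Reducible (plainEdges K C τ) (fun a b => (a, b) ∈ M.arcs ∨ extraEdges C X D J τ a b)
      K.verts) :
    Reducible M.E.Adj (fun a b => (a, b) ∈ M.arcs) K.verts := by
  obtain ⟨P, R, hPR⟩ := hr
  exact h.reducible_of_partition h1 h3 hPR rfl (fun p hp => Or.inl hp) fun q hq => Or.inl hq

/-- A bold big fork is reducible unless all arcs at it leave it, it has no additional edges, and it
has no half-edges but those at its connecting set. -/
theorem reducible_of_bigFork (h : BoldHost M K C W X D J) {j : ℕ} (hK : BigForkData j K C W)
    (hj : 1 ≤ j)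
    (hex : (∃ s ∈ K.verts, ∃ t ∈ K.verts, (s, t) ∈ M.arcs) ∨ (∃ s t, D.Adj s t) ∨ X.Nonempty) :
    Reducible M.E.Adj (fun a b => (a, b) ∈ M.arcs) K.verts := by
  obtain ⟨τ, h1, h2, h3⟩ := h.exists_choice
  have hh := h.host h1 h2
  have hcore := hK.reducible hj
  by_cases hint : ∃ s ∈ K.verts, ∃ t ∈ K.verts, (s, t) ∈ M.arcs ∨ extraEdges C X D J τ s t
  · exact h.reducible_of_plain h1 h3 (hcore _ _ hh hint)
  -- an extra half-edge at `w` counts as an arc from its outer end `i`, and may be cut there because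
  -- it is an edge after all
  have hXn : X.Nonempty := by
    rcases hex with ⟨s, hs, t, ht, hst⟩ | ⟨s, t, hst⟩ | hX
    · exact absurd ⟨s, hs, t, ht, Or.inl hst⟩ hint
    · have := h.extra_mem s t hst
      exact absurd ⟨s, h.subW this.1, t, h.subW this.2.1, Or.inr (Or.inl hst)⟩ hint
    · exact hX
  obtain ⟨w, hwX⟩ := hXn
  obtain ⟨i, ⟨hi1, hi2⟩, -⟩ := h2 w hwX
  have hiX : extraHalf C X J τ w i := ⟨hi1, hwX, hi2⟩
  have hiS := (h.joint_mem w i hi1).2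
  have hwS := h.subW (h.subX hwX)
  obtain ⟨s, hs, hsw, -⟩ := hK.exists_free_ne w w
  have hsS := h.subW hs
  obtain ⟨o, hso, -⟩ := hh.out s hs
  have hoS : o ∉ K.verts := fun ho => hint ⟨s, hsS, o, ho, hso⟩
  have hio : i ≠ o := by
    rintro rfl
    rcases hso with hso | hso | hso | hso
    · exact (h.joint_arc w i hi1 s).2 hso
    · exact hiS (h.subW (h.extra_mem _ _ hso).2.1)
    · exact hsw (h.joint_inj s w i hso.1 hi1)
    · exact (h.joint_mem _ _ hso.1).2 hsS
  obtain ⟨P, R, hPR, -⟩ := hh.exists_cut h.subW hcore hsw hsS hwS hoS hiS hio hso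
    (Or.inr (Or.inr (Or.inr hiX)))
  refine h.reducible_of_partition h1 h3 hPR rfl ?_ ?_
  · rintro p (hp | rfl)
    · exact Or.inl hp.1
    · refine Or.inr ⟨⟨i, w, true⟩, ⟨Or.inr hwS, Or.inl ⟨rfl, Or.inr (Or.inr (Or.inr hiX))⟩⟩,
        Or.inr (Or.inr hiX), rfl, ?_, Or.inl hiS⟩
      rintro (h4 | h4)
      · exact h4.2 rfl
      · simp at h4
  · intro q hq
    by_cases hqe : q = ⟨i, w, true⟩
    · subst hqe
      exact Or.inr ⟨Or.inr (Or.inr hiX), Or.inr rfl⟩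
    · exact Or.inl (Or.inl ⟨hq, hqe⟩)

end BoldHost

end Bold

/-! ### Additions in a mixed graph -/

section Additions
variable {V : Type*}

/-- The graph `G'` arises from `G` by addition of the bold `K`. The graph `B` is `K` with its
additional edges, `h` counts the half-edges, and `J` is the set of the edges that they have
become. -/
structure BoldAddition (G' G K B : PGraph V) (h : V → ℕ) (J : Set (V × V)) : Prop where
  bold_verts : B.verts = K.verts
  disj : Disjoint G.verts K.verts
  joint : ∀ p ∈ J, p.1 ∈ K.verts ∧ p.2 ∈ G.verts ∧ G.deg p.2 = 2
  card : ∀ v ∈ K.verts, {t | (v, t) ∈ J}.encard = h v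
  inj : ∀ p ∈ J, ∀ q ∈ J, p.2 = q.2 → p = q
  verts : G'.verts = G.verts ∪ K.verts
  adj : ∀ u v, G'.Adj u v ↔ G.Adj u v ∨ B.Adj u v ∨ (u, v) ∈ J ∨ (v, u) ∈ J
  fin : ∀ v ∈ G'.verts, (G'.neighborSet v).Finite

/-- The edges of the mixed graph `M` form a graph that arises from `G` by addition of the bold `K`,
and the arcs of `M` join vertices of degree two. -/
structure Attachment (M : MixedGraph V) (G K B : PGraph V) (h : V → ℕ) (J : Set (V × V)) : Prop
    extends BoldAddition M.E G K B h J where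
  arc : ∀ a ∈ M.arcs, M.E.deg a.1 = 2 ∧ M.E.deg a.2 = 2

namespace BoldAddition
variable {G' G K B : PGraph V} {h : V → ℕ} {J : Set (V × V)}

theorem joint_mem (H : BoldAddition G' G K B h J) {u v : V} (hJ : (u, v) ∈ J) :
    u ∈ K.verts ∧ v ∉ K.verts :=
  ⟨(H.joint _ hJ).1, fun hv => Set.disjoint_left.1 H.disj (H.joint _ hJ).2.1 hv⟩

theorem adj_left (H : BoldAddition G' G K B h J) {u : V} (hu : u ∈ K.verts) (v : V) :
    G'.Adj u v ↔ B.Adj u v ∨ (u, v) ∈ J := by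
  have huG : u ∉ G.verts := fun h => Set.disjoint_left.1 H.disj h hu
  rw [H.adj]
  have h1 : ¬ G.Adj u v := fun h => huG (G.edge_vert h)
  have h2 : (v, u) ∉ J := fun h => (H.joint_mem h).2 hu
  tauto

theorem adj_right (H : BoldAddition G' G K B h J) {u : V} (hu : u ∈ G.verts) (v : V) :
    G'.Adj u v ↔ G.Adj u v ∨ (v, u) ∈ J := by
  have huK : u ∉ K.verts := fun h => Set.disjoint_left.1 H.disj hu h
  rw [H.adj]
  have h1 : ¬ B.Adj u v := fun h => huK (H.bold_verts ▸ B.edge_vert h)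
  have h2 : (u, v) ∉ J := fun h => huK (H.joint_mem h).1
  tauto

theorem deg_joint (H : BoldAddition G' G K B h J) {u v : V} (hJ : (u, v) ∈ J) :
    G'.deg v = 3 := by
  obtain ⟨huK, hvG, hd⟩ := H.joint _ hJ
  have hN : G'.neighborSet v = insert u (G.neighborSet v) := by
    ext t
    have h1 := H.adj_right hvG t
    constructor
    · intro ht
      rcases h1.1 ht with h2 | h2
      · exact Or.inr h2
      · have := H.inj _ h2 _ hJ rfl
        exact Or.inl (Prod.mk.inj this).1
    · rintro (rfl | ht)
      · exact h1.2 (Or.inr hJ)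
      · exact h1.2 (Or.inl ht)
  have hfin : (G.neighborSet v).Finite := by
    refine (H.fin v ?_).subset ?_
    · rw [H.verts]
      exact Or.inl hvG
    · rw [hN]
      exact Set.subset_insert _ _
  rw [PGraph.deg, hN, Set.ncard_insert_of_notMem _ hfin]
  · exact congrArg (· + 1) hd
  · intro h1
    exact Set.disjoint_left.1 H.disj (G.edge_vert (G.adj_symm h1)) huK

theorem mem_verts (H : BoldAddition G' G K B h J) {v : V} (hv : v ∈ K.verts) : v ∈ G'.verts := by
  rw [H.verts]
  exact Or.inr hv

theorem deg_eq (H : BoldAddition G' G K B h J) {v : V} (hv : v ∈ K.verts) :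
    G'.deg v = B.deg v + h v := by
  have hN : G'.neighborSet v = B.neighborSet v ∪ {t | (v, t) ∈ J} := by
    ext t
    exact H.adj_left hv t
  have hfin := H.fin v (H.mem_verts hv)
  rw [hN] at hfin
  rw [PGraph.deg, hN, Set.ncard_union_eq _ (hfin.subset Set.subset_union_left)
    (hfin.subset Set.subset_union_right)]
  · rw [PGraph.deg]
    congr 1
    rw [Set.ncard_def, H.card v hv]
    rfl
  · rw [Set.disjoint_left]
    intro t ht ht'
    exact (H.joint_mem ht').2 (H.bold_verts ▸ B.edge_vert (B.adj_symm ht))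

theorem deg_old (H : BoldAddition G' G K B h J) {v : V} (hv : v ∈ G.verts)
    (hJ : ∀ u, (u, v) ∉ J) : G'.deg v = G.deg v := by
  have hN : G'.neighborSet v = G.neighborSet v := by
    ext t
    refine (H.adj_right hv t).trans ⟨fun h1 => h1.resolve_right (hJ t), Or.inl⟩
  rw [PGraph.deg, hN, PGraph.deg]

end BoldAddition

theorem MixedGraph.finite_neighborSet (M : MixedGraph V) {v : V} (hv : v ∈ M.E.verts) :
    (M.E.neighborSet v).Finite := by
  refine Set.finite_of_ncard_ne_zero ?_
  have := M.deg_two_or_three v hv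
  unfold PGraph.deg at this
  omega

namespace Attachment
variable {M : MixedGraph V} {G K B : PGraph V} {h : V → ℕ} {J : Set (V × V)}

theorem joint_arc (H : Attachment M G K B h J) {u v : V} (hJ : (u, v) ∈ J) (b : V) :
    (v, b) ∉ M.arcs ∧ (b, v) ∉ M.arcs := by
  have h1 := H.deg_joint hJ
  constructor
  · intro h2
    have := (H.arc _ h2).1
    simp only at this
    omega
  · intro h2
    have := (H.arc _ h2).2
    simp only at this
    omega

/-- A bold whose vertices all have degree two or three if the additional edges and half-edges are
not counted. -/
theorem boldHost (H : Attachment M G K B h J) {C W X : Set V} {D : SimpleGraph V}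
    (hCK : C ⊆ K.verts) (hWK : W ⊆ K.verts)
    (hdeg : ∀ v ∈ K.verts, (v ∈ W → K.deg v + C.indicator 1 v = 2) ∧
      (v ∉ W → K.deg v + C.indicator 1 v = 3))
    (hD : ∀ u v, D.Adj u v → u ∈ K.verts ∧ v ∈ K.verts ∧ ¬ K.Adj u v)
    (hDD : ∀ u v w, D.Adj u v → D.Adj u w → v = w) (hDX : ∀ u v, D.Adj u v → u ∉ X)
    (hBa : ∀ u v, B.Adj u v ↔ K.Adj u v ∨ D.Adj u v)
    (hh : ∀ v ∈ K.verts, h v = C.indicator 1 v + X.indicator 1 v) :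
    BoldHost M K C W (X ∩ K.verts) D J := by
  have hB : ∀ v ∈ K.verts, (B.neighborSet v).Finite := fun v hv =>
    (M.finite_neighborSet (H.mem_verts hv)).subset fun t ht => (H.adj_left hv t).2 (Or.inl ht)
  have hBN : ∀ v, B.neighborSet v = K.neighborSet v ∪ D.neighborSet v := fun v => by
    ext t
    exact hBa v t
  have hdisj : ∀ v, Disjoint (K.neighborSet v) (D.neighborSet v) := fun v => by
    rw [Set.disjoint_left]
    exact fun t ht ht' => (hD v t ht').2.2 ht
  have hd : ∀ v ∈ K.verts, M.E.deg v = (K.deg v + C.indicator 1 v) +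
      ((D.neighborSet v).ncard + X.indicator 1 v) := by
    intro v hv
    have hf := hB v hv
    rw [hBN] at hf
    rw [H.deg_eq hv, hh v hv, PGraph.deg, hBN, Set.ncard_union_eq (hdisj v)
      (hf.subset Set.subset_union_left) (hf.subset Set.subset_union_right), PGraph.deg]
    omega
  have hDpos : ∀ u v, D.Adj u v → 1 ≤ (D.neighborSet u).ncard := by
    intro u v huv
    have hf := hB u (hD u v huv).1
    rw [hBN] at hf
    exact (Set.ncard_pos (hf.subset Set.subset_union_right)).2 ⟨v, huv⟩
  have hDzero : ∀ u, (∀ v, ¬ D.Adj u v) → (D.neighborSet u).ncard = 0 := by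
    intro u hu
    have : D.neighborSet u = ∅ := Set.eq_empty_of_forall_notMem fun v hv => hu v hv
    rw [this, Set.ncard_empty]
  have h23 := fun v hv => M.deg_two_or_three v (H.mem_verts hv)
  have hDW : ∀ u v, D.Adj u v → u ∈ W := by
    intro u v huv
    by_contra hW
    have hu := (hD u v huv).1
    have h1 := (hdeg u hu).2 hW
    have h2 := hd u hu
    have h3 := h23 u hu
    have h4 := hDpos u v huv
    omega
  have htwo : ∀ s ∈ W, s ∉ X ∩ K.verts → (∀ v, ¬ D.Adj s v) → M.E.deg s = 2 := by
    intro s hs hsX hsD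
    have hsK := hWK hs
    have h1 := (hdeg s hsK).1 hs
    have h2 := hd s hsK
    rw [hDzero s hsD, Set.indicator_of_notMem fun h => hsX ⟨h, hsK⟩] at h2
    omega
  have harc : ∀ u ∈ K.verts, M.E.deg u = 2 → u ∈ W ∧ u ∉ X ∩ K.verts ∧ ∀ t, ¬ D.Adj u t := by
    intro u hu h2
    have h3 := hd u hu
    refine ⟨?_, fun hX => ?_, fun t ht => ?_⟩
    · by_contra hW
      have h1 := (hdeg u hu).2 hW
      omega
    · rw [Set.indicator_of_mem hX.1] at h3
      simp only [Pi.one_apply] at h3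
      by_cases hW : u ∈ W
      · have h1 := (hdeg u hu).1 hW
        omega
      · have h1 := (hdeg u hu).2 hW
        omega
    · have h4 := hDpos u t ht
      have h1 := (hdeg u hu).1 (hDW u t ht)
      omega
  refine ⟨?_, fun u v => H.joint_mem, ?_, ?_, fun u v => H.joint_arc, ?_, hDD,
    fun u v huv hX => hDX u v huv hX.1, hCK, hWK, ?_, ?_, ?_, ?_⟩
  · intro u v hu
    rw [H.adj_left hu, hBa, or_assoc]
  · intro u u' v h1 h2
    exact (Prod.mk.inj (H.inj _ h1 _ h2 rfl)).1
  · intro v hv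
    rw [H.card v hv, hh v hv]
    congr 2
    by_cases hX : v ∈ X
    · rw [Set.indicator_of_mem hX, Set.indicator_of_mem (show v ∈ X ∩ K.verts from ⟨hX, hv⟩)]
    · rw [Set.indicator_of_notMem hX, Set.indicator_of_notMem fun h => hX h.1]
  · exact fun u v huv => ⟨hDW u v huv, hDW v u huv.symm, (hD u v huv).2.2⟩
  · rintro v ⟨hX, hv⟩
    by_contra hW
    have h1 := (hdeg v hv).2 hW
    have h2 := hd v hv
    have h3 := h23 v hv
    rw [Set.indicator_of_mem hX] at h2
    simp only [Pi.one_apply] at h2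
    omega
  · exact fun s hs hsX hsD => (M.deg_two s (H.mem_verts (hWK hs)) (htwo s hs hsX hsD)).1
  · exact fun s hs hsX hsD => (M.deg_two s (H.mem_verts (hWK hs)) (htwo s hs hsX hsD)).2
  · exact fun u v huv => ⟨fun hu => harc u hu (H.arc _ huv).1, fun hv => harc v hv (H.arc _ huv).2⟩

end Attachment

namespace Template

/-- The neighbours of `a` that belong to the graph. -/
def inner (t : Template) (a : ℕ) : List ℕ :=
  t.edges.filterMap fun e => if e.1 = a then some e.2 else if e.2 = a then some e.1 else none

/-- All vertices have degree two or three, and there are no parallel edges. -/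
structure Subcubic (t : Template) : Prop where
  wf : t.WellFormed
  nodup : ∀ a < t.n, (t.inner a).Nodup
  deg : ∀ a < t.n, (t.nbrs a).length = 2 ∨ (t.nbrs a).length = 3

theorem mem_inner {t : Template} {a b : ℕ} : b ∈ t.inner a ↔
    (a, b) ∈ t.edges ∨ (b, a) ∈ t.edges := by
  simp only [inner, List.mem_filterMap, Prod.exists]
  constructor
  · rintro ⟨x, y, hxy, h⟩
    split_ifs at h with h1 h2
    · rw [Option.some_inj] at h
      subst h1 h
      exact Or.inl hxy
    · rw [Option.some_inj] at h
      subst h2 h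
      exact Or.inr hxy
  · rintro (h | h)
    · exact ⟨a, b, h, by simp⟩
    · refine ⟨b, a, h, ?_⟩
      by_cases hab : b = a <;> simp [hab]

variable {t : Template} {K : PGraph V} {ι : ℕ → V}

theorem Shaped.deg (hs : t.Shaped K ι) (ht : t.Subcubic) {a : ℕ} (ha : a < t.n) :
    K.deg (ι a) = (t.inner a).length := by
  classical
  have hlt : ∀ b ∈ t.inner a, b < t.n := by
    intro b hb
    rcases mem_inner.1 hb with h | h
    · exact (ht.wf.edges _ h).2
    · exact (ht.wf.edges _ h).1
  have hN : K.neighborSet (ι a) = ι '' {b | b ∈ (t.inner a).toFinset} := by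
    ext w
    constructor
    · intro hw
      have hw' : K.Adj (ι a) w := hw
      obtain ⟨b, hb, rfl⟩ := (hs.verts w).1 (K.edge_vert hw'.symm)
      exact ⟨b, by simpa using mem_inner.2 ((hs.adj a ha b hb).1 hw'), rfl⟩
    · rintro ⟨b, hb, rfl⟩
      have hb : b ∈ t.inner a := by simpa using hb
      exact (hs.adj a ha b (hlt b hb)).2 (mem_inner.1 hb)
  rw [PGraph.deg, hN, Set.InjOn.ncard_image]
  · have : ({b | b ∈ (t.inner a).toFinset} : Set ℕ) = ((t.inner a).toFinset : Set ℕ) := rfl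
    rw [this, Set.ncard_coe_finset, List.toFinset_card_of_nodup (ht.nodup a ha)]
  · intro b hb c hc hbc
    exact hs.inj b (hlt b (by simpa using hb)) c (hlt c (by simpa using hc)) hbc

theorem length_nbrs (ht : t.WellFormed) (a : ℕ) :
    (t.nbrs a).length = (t.inner a).length + if a ∈ t.halves then 1 else 0 := by
  have h1 : ∀ (l : List ℕ) (k : ℕ), ((l.zipIdx k).filterMap fun h =>
      if h.1 = a then some (t.n + h.2) else none).length = l.count a := by
    intro l
    induction l with
    | nil => simp
    | cons b l ih =>
      intro k
      rw [List.zipIdx_cons, List.filterMap_cons]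
      by_cases hb : b = a
      · simp [hb, ih]
      · simp [hb, ih]
  rw [nbrs, List.length_append, h1]
  congr 1
  split_ifs with h2
  · exact List.count_eq_one_of_mem ht.nodup h2
  · exact List.count_eq_zero.2 h2

theorem Shaped.deg_add (hs : t.Shaped K ι) (ht : t.Subcubic) {C : Set V}
    (hC : ∀ v, v ∈ C ↔ ∃ a ∈ t.halves, v = ι a) {a : ℕ} (ha : a < t.n) :
    K.deg (ι a) + C.indicator 1 (ι a) = (t.nbrs a).length := by
  rw [hs.deg ht ha, length_nbrs ht.wf]
  congr 1
  split_ifs with h1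
  · rw [Set.indicator_of_mem ((hC _).2 ⟨a, h1, rfl⟩)]
    rfl
  · rw [Set.indicator_of_notMem]
    rintro h2
    obtain ⟨b, hb, hab⟩ := (hC _).1 h2
    exact h1 (hs.inj a ha b (ht.wf.halves b hb) hab ▸ hb)

theorem Shaped.deg_slot (hs : t.Shaped K ι) (ht : t.Subcubic) {C W : Set V}
    (hC : ∀ v, v ∈ C ↔ ∃ a ∈ t.halves, v = ι a) (hW : ∀ v, v ∈ W ↔ ∃ s ∈ t.slots, v = ι s) :
    ∀ v ∈ K.verts, (v ∈ W → K.deg v + C.indicator 1 v = 2) ∧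
      (v ∉ W → K.deg v + C.indicator 1 v = 3) := by
  intro v hv
  obtain ⟨a, ha, rfl⟩ := (hs.verts v).1 hv
  rw [hs.deg_add ht hC ha]
  constructor
  · intro h
    obtain ⟨s, hsl, h1⟩ := (hW _).1 h
    rw [hs.inj a ha s (t.slots_lt hsl) h1]
    simpa using (List.mem_filter.1 hsl).2
  · intro h
    refine (ht.deg a ha).resolve_left fun h1 => h ((hW _).2 ⟨a, ?_, rfl⟩)
    rw [slots, List.mem_filter]
    exact ⟨List.mem_range.2 ha, by simpa using h1⟩

end Template

/-- The vertices of the template at which there are half-edges. -/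
def Template.connecting (t : Template) (ι : ℕ → V) : Set V := {v | ∃ a ∈ t.halves, v = ι a}

namespace Attachment
variable {M : MixedGraph V} {G K B : PGraph V} {h : V → ℕ} {J : Set (V × V)}

/-- A bold without additional edges is reducible if the test of its template succeeds. -/
theorem reducible_of_check (H : Attachment M G K K h J) {t : Template} {ι : ℕ → V}
    (ht : t.Subcubic) (hs : t.Shaped K ι)
    (hh : ∀ v ∈ K.verts, h v = (t.connecting ι).indicator 1 v)
    {need : List (ℕ × Option ℕ) → Bool} {goal : List (ℕ × Option ℕ) → List (List ℕ) → Bool}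
    {rots : List ℕ} (hc : t.check need goal rots = true)
    (hneed : ∀ σ, t.Outgoing (fun a b => (a, b) ∈ M.arcs) K.verts ι σ →
      need (t.slots.map fun s => (s, σ s)).reverse = true) :
    Reducible M.E.Adj (fun a b => (a, b) ∈ M.arcs) K.verts := by
  set C := t.connecting ι with hC
  set W : Set V := {v | ∃ s ∈ t.slots, v = ι s} with hW
  have hsub : ∀ a < t.n, ι a ∈ K.verts := fun a ha => (hs.verts _).2 ⟨a, ha, rfl⟩
  have hb : BoldHost M K C W (∅ ∩ K.verts) ⊥ J := by
    refine H.boldHost ?_ ?_ (hs.deg_slot ht (fun v => Iff.rfl) fun v => Iff.rfl) (by simp) (by simp)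
      (by simp) (by simp) fun v hv => by rw [hh v hv]; simp
    · rintro v ⟨a, ha, rfl⟩
      exact hsub a (ht.wf.halves a ha)
    · rintro v ⟨a, ha, rfl⟩
      exact hsub a (t.slots_lt ha)
  obtain ⟨τ, h1, h2, h3⟩ := hb.exists_choice
  have hh' := hb.host h1 h2
  have hA : (fun a b => (a, b) ∈ M.arcs ∨ extraEdges C (∅ ∩ K.verts) ⊥ J τ a b) =
      fun a b => (a, b) ∈ M.arcs := by
    funext a b
    simp [extraEdges, extraHalf]
  refine hb.reducible_of_plain h1 h3 ?_
  rw [hA] at hh' ⊢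
  exact hh'.reducible ht.wf hs (fun v => Iff.rfl) (fun v => Iff.rfl) hc hneed

end Attachment

end Additions

/-! ### Cut-obstacles -/

section CutObstacle
variable {V : Type*}

/-- If all arcs at a big fork leave it, and all its half-edges are at its connecting set, then
it is a cut-obstacle: the two arcs at each vertex in `W` would have to be paired with edges in the
cut, two for each such edge. There is one edge for each vertex of `C`, and `W` has more
elements than `C`. -/
theorem BoldHost.isCutObstacle {M : MixedGraph V} {K : PGraph V} {C W : Set V} {D : SimpleGraph V}
    {J : Set (V × V)} (h : BoldHost M K C W ∅ D J) (hK : K.verts.Finite)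
    (hcard : C.ncard < W.ncard) (hD : ∀ u v, ¬ D.Adj u v)
    (harc : ∀ s ∈ K.verts, ∀ t ∈ K.verts, (s, t) ∉ M.arcs) : M.IsCutObstacle K.verts := by
  classical
  rintro ⟨P, hP1, hP2, hP3, hP4⟩
  have hedge : ∀ e ∈ M.cutEdges K.verts, ∃ c v, (c, v) ∈ J ∧ e = s(c, v) := by
    rintro e ⟨he, u, hu, v, hv, rfl⟩
    refine ⟨u, v, ?_, rfl⟩
    rcases (h.adj u v hu).1 he with h1 | h1 | h1
    · exact absurd (K.edge_vert h1.symm) hv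
    · exact absurd h1 (hD u v)
    · exact h1
  have hJC : ∀ c v, (c, v) ∈ J → c ∈ C ∧ ∀ v', (c, v') ∈ J → v' = v := by
    intro c v hcv
    have h1 := h.joint_card c (h.joint_mem c v hcv).1
    by_cases hc : c ∈ C
    · refine ⟨hc, fun v' hv' => ?_⟩
      rw [Set.indicator_of_mem hc] at h1
      obtain ⟨a, ha⟩ := Set.encard_eq_one.1 (h1.trans (by simp))
      have h2 : ∀ t, (c, t) ∈ J → t = a := fun t ht => by
        have : t ∈ {t | (c, t) ∈ J} := ht
        rwa [ha] at this
      rw [h2 v' hv', h2 v hcv]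
    · rw [Set.indicator_of_notMem hc] at h1
      have h4 : {t | (c, t) ∈ J} = ∅ := Set.encard_eq_zero.1 (by simpa using h1)
      have h5 : v ∈ {t | (c, t) ∈ J} := hcv
      rw [h4] at h5
      exact absurd h5 (Set.notMem_empty v)
  -- the pair of an arc `a` consists of `a` and an edge `s(c, v)` of the cut
  have hpair : ∀ a, ∃ c v, a ∈ M.cutArcs K.verts →
      (c, v) ∈ J ∧ s(c, v) ∈ M.cutEdges K.verts ∧ s(Sum.inr a, Sum.inl s(c, v)) ∈ P := by
    intro a
    by_cases ha : a ∈ M.cutArcs K.verts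
    · obtain ⟨p, hp⟩ := Set.encard_eq_one.1 (hP3 a ha)
      have hp' : p ∈ P ∧ Sum.inr a ∈ p := by
        have : p ∈ {p ∈ P | Sum.inr a ∈ p} := by
          rw [hp]
          rfl
        exact this
      obtain ⟨y, rfl⟩ := Sym2.mem_iff_exists.1 hp'.2
      rcases (hP1 _ hp'.1).2 y (by simp) with ⟨e, he, rfl⟩ | ⟨b, -, rfl⟩
      · obtain ⟨c, v, hcv, rfl⟩ := hedge e he
        exact ⟨c, v, fun _ => ⟨hcv, he, hp'.1⟩⟩
      · exact absurd hp'.1 (hP4 a b)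
    · exact ⟨a.1, a.1, fun h => absurd h ha⟩
  choose c v hcv using hpair
  -- each `w` in `W` has the arcs `α w true`, which leaves it, and `α w false`, which enters it
  have harcs : ∀ w b, ∃ a : V × V, w ∈ W → a ∈ M.cutArcs K.verts ∧
      (if b = true then a.1 else a.2) = w := by
    intro w b
    by_cases hw : w ∈ W
    · have hwK := h.subW hw
      cases b
      · obtain ⟨x, hx, -⟩ := h.inn w hw (by simp) (hD w)
        exact ⟨(x, w), fun _ => ⟨⟨hx, Or.inr ⟨fun hxK => harc x hxK w hwK hx, hwK⟩⟩, rfl⟩⟩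
      · obtain ⟨x, hx, -⟩ := h.out w hw (by simp) (hD w)
        exact ⟨(w, x), fun _ => ⟨⟨hx, Or.inl ⟨hwK, fun hxK => harc w hwK x hxK hx⟩⟩, rfl⟩⟩
    · exact ⟨(w, w), fun h => absurd h hw⟩
  choose α hα using harcs
  have hαinj : ∀ w ∈ W, ∀ w' ∈ W, ∀ b b', α w b = α w' b' → (w, b) = (w', b') := by
    intro w hw w' hw' b b' hbb
    obtain ⟨h1, h2⟩ := hα w b hw
    obtain ⟨h3, h4⟩ := hα w' b' hw'
    have hwK := h.subW hw
    have hwK' := h.subW hw'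
    cases b <;> cases b' <;> simp only [if_true, if_false, Bool.false_eq_true] at h2 h4
    · rw [← h2, ← h4, hbb]
    · rcases h1.2 with h5 | h5
      · exact absurd (h2.symm ▸ hwK) h5.2
      · exact absurd (h4.symm ▸ hwK') (hbb ▸ h5.1)
    · rcases h1.2 with h5 | h5
      · exact absurd (h4.symm ▸ hwK') (hbb ▸ h5.2)
      · exact absurd (h2.symm ▸ hwK) h5.1
    · rw [← h2, ← h4, hbb]
  have hWf := hK.subset h.subW
  have hCf := hK.subset h.subC
  -- at most two of these arcs are paired with the edge at a given vertex of `C`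
  have key := Finset.card_le_mul_card_image_of_maps_to (s := hWf.toFinset ×ˢ (Finset.univ : Finset Bool))
    (t := hCf.toFinset) (f := fun q => c (α q.1 q.2)) (by
      intro q hq
      have hqW : q.1 ∈ W := by simpa using hq
      rw [Set.Finite.mem_toFinset]
      exact (hJC _ _ (hcv _ (hα q.1 q.2 hqW).1).1).1) 2 (by
      intro d hd
      by_cases hne : ((hWf.toFinset ×ˢ (Finset.univ : Finset Bool)).filter
          fun q => c (α q.1 q.2) = d).Nonempty
      swap
      · rw [Finset.not_nonempty_iff_eq_empty.1 hne]
        simp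
      obtain ⟨q₀, hq₀⟩ := hne
      have hmem : ∀ q, q ∈ (hWf.toFinset ×ˢ (Finset.univ : Finset Bool)).filter
          (fun q => c (α q.1 q.2) = d) → q.1 ∈ W ∧ c (α q.1 q.2) = d := by
        intro q hq
        simpa using hq
      have h0 := hmem q₀ hq₀
      have hv : ∀ q : V × Bool, q.1 ∈ W ∧ c (α q.1 q.2) = d → v (α q.1 q.2) = v (α q₀.1 q₀.2) := by
        intro q hq
        have h1 := (hcv _ (hα q.1 q.2 hq.1).1).1
        have h2 := (hcv _ (hα q₀.1 q₀.2 h0.1).1).1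
        rw [hq.2] at h1
        rw [h0.2] at h2
        exact (hJC _ _ h2).2 _ h1
      have he := (hcv _ (hα q₀.1 q₀.2 h0.1).1).2.1
      have h2 := hP2 _ he
      have h3 := Set.encard_le_encard_of_injOn
        (s := (((hWf.toFinset ×ˢ (Finset.univ : Finset Bool)).filter
          (fun q => c (α q.1 q.2) = d) : Finset (V × Bool)) : Set (V × Bool)))
        (t := {p ∈ P | Sum.inl s(c (α q₀.1 q₀.2), v (α q₀.1 q₀.2)) ∈ p})
        (f := fun q => s(Sum.inr (α q.1 q.2), Sum.inl s(c (α q₀.1 q₀.2), v (α q₀.1 q₀.2)))) (by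
          intro q hq
          have hq := hmem q hq
          have h4 := (hcv _ (hα q.1 q.2 hq.1).1).2.2
          rw [hv q hq, hq.2, ← h0.2] at h4
          exact ⟨h4, by simp⟩) (by
          intro q hq q' hq' hqq
          have hq := hmem q hq
          have hq' := hmem q' hq'
          have h5 : α q.1 q.2 = α q'.1 q'.2 := by simpa using hqq
          exact hαinj q.1 hq.1 q'.1 hq'.1 _ _ h5)
      rw [h2, Set.encard_coe_eq_coe_finsetCard] at h3
      exact_mod_cast h3)
  rw [Finset.card_product, Finset.card_univ, Fintype.card_bool, ← Set.ncard_eq_toFinset_card _ hWf,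
    ← Set.ncard_eq_toFinset_card _ hCf] at key
  omega

end CutObstacle

/-! ### Vertices of degree two -/

section Twos
variable {V : Type*}

/-- The vertices of degree two. -/
def PGraph.twos (G : PGraph V) : Set V := {v | v ∈ G.verts ∧ G.deg v = 2}

theorem PGraph.IsTwoConnected.finite {G : PGraph V} (h : G.IsTwoConnected) : G.verts.Finite :=
  Set.finite_of_ncard_ne_zero (by have := h.1; omega)

theorem PGraph.IsTwoConnected.finite_neighborSet {G : PGraph V} (h : G.IsTwoConnected) (v : V) :
    (G.neighborSet v).Finite := h.finite.subset (G.neighborSet_subset_verts v)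

/-- The minimum degree is at least two: a vertex has a neighbour `u`, and another one that keeps it
connected to the rest when `u` is deleted. -/
theorem PGraph.IsTwoConnected.two_le_deg {G : PGraph V} (h : G.IsTwoConnected) {v : V}
    (hv : v ∈ G.verts) : 2 ≤ G.deg v := by
  have hfin := h.finite
  have hex : ∀ u, ∃ w ∈ G.verts, w ≠ v ∧ w ≠ u := by
    intro u
    by_contra hcon
    push Not at hcon
    have h1 : G.verts ⊆ {v, u} := fun w hw => by
      by_cases hwv : w = v
      · exact Or.inl hwv
      · exact Or.inr (hcon w hw hwv)
    have h2 := (Set.ncard_le_ncard h1 (by simp)).trans (Set.ncard_insert_le _ _)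
    rw [Set.ncard_singleton] at h2
    have := h.1
    omega
  have hadj : ∀ H : PGraph V, H.Connected → v ∈ H.verts → (∃ w ∈ H.verts, w ≠ v) →
      ∃ u, H.Adj v u := by
    rintro H hH hvH ⟨w, hw, hwv⟩
    have : Nontrivial H.verts := ⟨⟨w, hw⟩, ⟨v, hvH⟩, fun h1 => hwv (congrArg Subtype.val h1)⟩
    obtain ⟨u, hu⟩ := hH.preconnected.exists_adj_of_nontrivial ⟨v, hvH⟩
    exact ⟨u, hu⟩
  obtain ⟨w, hw, hwv, -⟩ := hex v
  obtain ⟨u, hu⟩ := hadj G h.2.1 hv ⟨w, hw, hwv⟩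
  have huG := G.edge_vert hu.symm
  have hvu : v ≠ u := hu.ne
  obtain ⟨w', hw', hwv', hwu'⟩ := hex u
  obtain ⟨u', hu'⟩ := hadj _ (h.2.2 u huG) ⟨hv, hvu⟩ ⟨w', ⟨hw', hwu'⟩, hwv'⟩
  rw [SimpleGraph.Subgraph.deleteVerts_adj] at hu'
  have hne : u ≠ u' := fun h1 => hu'.2.2.2.1 h1.symm
  have hsub : ({u, u'} : Set V) ⊆ G.neighborSet v := by
    rintro t (rfl | rfl)
    · exact hu
    · exact hu'.2.2.2.2
  rw [PGraph.deg, ← Set.ncard_pair hne]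
  exact Set.ncard_le_ncard hsub (h.finite_neighborSet v)

theorem Template.Shaped.ncard_connecting {t : Template} {K : PGraph V} {ι : ℕ → V}
    (hs : t.Shaped K ι) (ht : t.Subcubic) : (t.connecting ι).ncard = t.halves.length := by
  classical
  have e : t.connecting ι = ι '' (t.halves.toFinset : Set ℕ) := by
    ext v
    simp only [Template.connecting, Set.mem_image, List.coe_toFinset, Set.mem_ofPred_eq]
    exact ⟨fun ⟨s, hs, e⟩ => ⟨s, hs, e.symm⟩, fun ⟨s, hs, e⟩ => ⟨s, hs, e.symm⟩⟩
  rw [e, Set.InjOn.ncard_image, Set.ncard_coe_finset, List.toFinset_card_of_nodup ht.wf.nodup]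
  intro a ha b hb hab
  exact hs.inj a (ht.wf.halves a (by simpa using ha)) b (ht.wf.halves b (by simpa using hb)) hab

theorem Template.Shaped.one_le_half {t : Template} {K : PGraph V} {ι : ℕ → V} {h : V → ℕ}
    (hs : t.Shaped K ι) (ht : t.Subcubic)
    (hh : ∀ v ∈ K.verts, h v = (t.connecting ι).indicator 1 v) :
    ∀ c ∈ t.connecting ι, c ∈ K.verts ∧ 1 ≤ h c := by
  rintro c ⟨a, ha, rfl⟩
  have hc := (hs.verts _).2 ⟨a, ht.wf.halves a ha, rfl⟩
  refine ⟨hc, ?_⟩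
  rw [hh _ hc, Set.indicator_of_mem (show ι a ∈ t.connecting ι from ⟨a, ha, rfl⟩)]
  rfl

namespace BoldAddition
variable {G' G K B : PGraph V} {h : V → ℕ} {J : Set (V × V)}

theorem targets_subset (H : BoldAddition G' G K B h J) : Prod.snd '' J ⊆ G.twos := by
  rintro v ⟨p, hp, rfl⟩
  exact (H.joint p hp).2

/-- There are at least as many joined vertices of `G` as vertices of `K` with half-edges. -/
theorem ncard_le_targets (H : BoldAddition G' G K B h J) (hG : G.verts.Finite) {C : Set V}
    (hC : ∀ c ∈ C, c ∈ K.verts ∧ 1 ≤ h c) : C.ncard ≤ (Prod.snd '' J).ncard := by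
  have h1 : ∀ c, ∃ t, c ∈ C → (c, t) ∈ J := by
    intro c
    by_cases hc : c ∈ C
    · obtain ⟨hcK, hc1⟩ := hC c hc
      have h2 : {t | (c, t) ∈ J}.Nonempty := by
        refine Set.encard_ne_zero.1 ?_
        rw [H.card c hcK]
        exact_mod_cast (by omega : h c ≠ 0)
      obtain ⟨t, ht⟩ := h2
      exact ⟨t, fun _ => ht⟩
    · exact ⟨c, fun h => absurd h hc⟩
  choose τ hτ using h1
  refine Set.ncard_le_ncard_of_injOn τ (fun c hc => ⟨_, hτ c hc, rfl⟩) ?_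
    ((hG.subset fun v hv => hv.1).subset H.targets_subset)
  intro c hc c' hc' hcc
  exact (Prod.mk.inj (H.inj _ (hτ c hc) _ (hτ c' hc') hcc)).1

/-- The joined vertices of `G` get degree three. -/
theorem twos_subset (H : BoldAddition G' G K B h J) :
    G'.twos ⊆ (G.twos \ (Prod.snd '' J)) ∪ {v | v ∈ K.verts ∧ B.deg v + h v = 2} := by
  rintro v ⟨hv, hd⟩
  rw [H.verts] at hv
  rcases hv with hv | hv
  · left
    have hJ : ∀ u, (u, v) ∉ J := fun u hu => by
      have := H.deg_joint hu
      omega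
    refine ⟨⟨hv, (H.deg_old hv hJ).symm.trans hd⟩, ?_⟩
    rintro ⟨⟨u, v'⟩, hp, rfl⟩
    exact hJ u hp
  · right
    exact ⟨hv, (H.deg_eq hv).symm.trans hd⟩

/-- An addition does not increase the number of vertices of degree two if it uses at least as many
half-edges as it brings vertices of degree two. -/
theorem ncard_twos_le (H : BoldAddition G' G K B h J) (hG : G.verts.Finite) (hK : K.verts.Finite)
    {C : Set V} (hC : ∀ c ∈ C, c ∈ K.verts ∧ 1 ≤ h c)
    (hle : {v | v ∈ K.verts ∧ B.deg v + h v = 2}.ncard ≤ C.ncard) :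
    G'.twos.ncard ≤ G.twos.ncard := by
  have h1 := H.ncard_le_targets hG hC
  have hf : G.twos.Finite := hG.subset fun v hv => hv.1
  have h2 := Set.ncard_le_ncard H.twos_subset
    ((hf.subset Set.sdiff_subset).union (hK.subset fun v hv => hv.1))
  have h3 := Set.ncard_union_le (G.twos \ (Prod.snd '' J)) {v | v ∈ K.verts ∧ B.deg v + h v = 2}
  have h4 := Set.ncard_sdiff_add_ncard_of_subset H.targets_subset hf
  omega

/-- The same for a bold that is given by a template. -/
theorem ncard_twos_le_of_template (H : BoldAddition G' G K K h J) (hG : G.verts.Finite)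
    {t : Template} {ι : ℕ → V} (ht : t.Subcubic) (hs : t.Shaped K ι)
    (hh : ∀ v ∈ K.verts, h v = (t.connecting ι).indicator 1 v)
    (hle : t.slots.length ≤ t.halves.length) : G'.twos.ncard ≤ G.twos.ncard := by
  classical
  have hK : K.verts.Finite := by
    have : K.verts = ι '' {a | a < t.n} := by
      ext v
      rw [hs.verts]
      constructor
      · rintro ⟨a, ha, rfl⟩
        exact ⟨a, ha, rfl⟩
      · rintro ⟨a, ha, rfl⟩
        exact ⟨a, ha, rfl⟩
    rw [this]
    exact (Set.finite_lt_nat t.n).image ι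
  refine H.ncard_twos_le hG hK (hs.one_le_half ht hh) ?_
  · have e1 : {v | v ∈ K.verts ∧ K.deg v + h v = 2} ⊆ ι '' (t.slots.toFinset : Set ℕ) := by
      rintro v ⟨hv, h2⟩
      rw [hh v hv] at h2
      by_contra hcon
      have h3 := (hs.deg_slot ht (C := t.connecting ι) (fun v => Iff.rfl) (W := ι '' (t.slots.toFinset : Set ℕ))
        (fun v => ?_) v hv).2 hcon
      · omega
      · simp only [Set.mem_image, List.coe_toFinset, Set.mem_ofPred_eq]
        exact ⟨fun ⟨s, hs, e⟩ => ⟨s, hs, e.symm⟩, fun ⟨s, hs, e⟩ => ⟨s, hs, e.symm⟩⟩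
    have h3 := hs.ncard_connecting ht
    have h4 := (Set.ncard_le_ncard e1 ((Finset.finite_toSet _).image ι)).trans
      (Set.ncard_image_le (Finset.finite_toSet _))
    rw [Set.ncard_coe_finset, List.toFinset_card_of_nodup t.nodup_slots] at h4
    omega

end BoldAddition

section YDelta
variable {G G' : PGraph V}

/-- The degree of a neighbour `u` of `v` stays the same if `v` is replaced by the new vertex `f u`. -/
theorem PGraph.deg_of_redirect {v : V} {f : V → V} {N : Set V} {u : V} (hu : G.Adj v u)
    (hfin : (G.neighborSet u).Finite) (hfu : f u ∉ G.verts)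
    (hN : N = insert (f u) (G.neighborSet u \ {v})) : N.ncard = G.deg u := by
  have h1 : f u ∉ G.neighborSet u \ {v} := fun h => hfu (G.edge_vert (G.adj_symm h.1))
  have h2 : v ∈ G.neighborSet u := hu.symm
  rw [hN, Set.ncard_insert_of_notMem h1 (hfin.subset Set.sdiff_subset),
    Set.ncard_sdiff_singleton_add_one h2 hfin]
  rfl

/-- Neither a Y-Δ transformation at a vertex of degree at least two nor the inverse of a Y-Δ
transformation increases the number of vertices of degree two: a vertex of degree two turns into a
triangle with one vertex of degree two, a vertex of degree three into one without such vertices. -/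
theorem PGraph.IsYDelta.ncard_twos (h : G.IsYDelta G') (hG : G.verts.Finite)
    (hG' : G'.verts.Finite) :
    ((∀ v ∈ G.verts, 2 ≤ G.deg v) → G'.twos.ncard ≤ G.twos.ncard) ∧
      G.twos.ncard ≤ G'.twos.ncard := by
  obtain ⟨v, a, b, c, f, hv, hnd, hnew, hf, hfi, hverts, hadj⟩ := h
  set Δ : Set V := {t | t ∈ [a, b, c]} with hΔ
  have hΔ3 : Δ.ncard = 3 := by
    simp only [List.nodup_cons, List.mem_cons, List.not_mem_nil, or_false, not_or,
      not_false_eq_true, List.nodup_nil, and_true] at hnd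
    refine Set.ncard_eq_three.2 ⟨a, b, c, by tauto, by tauto, by tauto, ?_⟩
    ext t
    simp [hΔ]
  have hΔf : Δ.Finite := List.finite_toSet _
  have hvG : ∀ s t, G.Adj s t → s ∈ G.verts ∧ t ∈ G.verts := fun s t hst =>
    ⟨G.edge_vert hst, G.edge_vert hst.symm⟩
  have hnbr : ∀ u, (G.neighborSet u).Finite := fun u => hG.subset (G.neighborSet_subset_verts u)
  have hnbr' : ∀ u, (G'.neighborSet u).Finite := fun u =>
    hG'.subset (G'.neighborSet_subset_verts u)
  -- the degrees of the old vertices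
  have hold : ∀ u ∈ G.verts, u ≠ v → G'.deg u = G.deg u := by
    intro u hu huv
    have huΔ : u ∉ Δ := fun h => hnew u h hu
    have hadju : ∀ t, G'.Adj u t ↔ (G.Adj u t ∧ t ≠ v) ∨ (G.Adj v u ∧ t = f u) := by
      intro t
      rw [hadj]
      have h1 : ¬ (G.Adj v t ∧ u = f t) := fun h1 => huΔ (h1.2 ▸ hf t h1.1)
      have h2 : u ∉ [a, b, c] := huΔ
      tauto
    by_cases hvu : G.Adj v u
    · refine PGraph.deg_of_redirect hvu (hnbr u) (hnew _ (hf u hvu)) ?_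
      ext t
      refine (hadju t).trans ?_
      simp only [Set.mem_insert_iff, Set.mem_sdiff, Set.mem_singleton_iff,
        SimpleGraph.Subgraph.mem_neighborSet]
      tauto
    · have hN : G'.neighborSet u = G.neighborSet u := by
        ext t
        refine (hadju t).trans ?_
        have h3 : G.Adj u t → t ≠ v := by
          rintro h3 rfl
          exact hvu h3.symm
        simp only [SimpleGraph.Subgraph.mem_neighborSet]
        tauto
      rw [PGraph.deg, hN, PGraph.deg]
  -- the degrees of the vertices of the triangle
  have htri : ∀ t ∈ Δ, (t ∈ f '' G.neighborSet v → G'.deg t ≠ 2) ∧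
      (t ∉ f '' G.neighborSet v → G'.deg t = 2) := by
    intro t ht
    have htG := hnew t ht
    have hadjt : ∀ s, G'.Adj t s ↔ (s ∈ Δ \ {t}) ∨ (G.Adj v s ∧ t = f s) := by
      intro s
      rw [hadj]
      have h1 : ¬ G.Adj t s := fun h => htG (hvG _ _ h).1
      have h2 : ¬ G.Adj v t := fun h => htG (hvG _ _ h).2
      have h3 : t ∈ [a, b, c] := ht
      have h4 : s ∈ Δ ↔ s ∈ [a, b, c] := Iff.rfl
      rw [Set.mem_sdiff, Set.mem_singleton_iff, h4]
      have h5 : t ≠ s ↔ ¬ s = t := ne_comm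
      tauto
    have hΔt : (Δ \ {t}).ncard = 2 := by
      rw [Set.ncard_sdiff_singleton_of_mem ht, hΔ3]
    constructor
    · rintro ⟨s, hs, rfl⟩ h2
      have h3 : insert s (Δ \ {f s}) ⊆ G'.neighborSet (f s) := by
        rintro r (rfl | hr)
        · exact (hadjt r).2 (Or.inr ⟨hs, rfl⟩)
        · exact (hadjt r).2 (Or.inl hr)
      have h4 := Set.ncard_le_ncard h3 (hnbr' _)
      rw [Set.ncard_insert_of_notMem (fun h => hnew s h.1 (hvG _ _ hs).2)
        (hΔf.subset Set.sdiff_subset), hΔt] at h4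
      rw [PGraph.deg] at h2
      omega
    · intro h2
      have : G'.neighborSet t = Δ \ {t} := by
        ext s
        refine (hadjt s).trans ⟨fun h3 => h3.resolve_right fun h4 => h2 ⟨s, h4.1, h4.2.symm⟩, Or.inl⟩
      rw [PGraph.deg, this, hΔt]
  have hfΔ : f '' G.neighborSet v ⊆ Δ := by
    rintro t ⟨s, hs, rfl⟩
    exact hf s hs
  have hfcard : (f '' G.neighborSet v).ncard = G.deg v := by
    exact Set.InjOn.ncard_image fun s hs t ht hst => hfi s t hs ht hst
  have hrest : (Δ \ f '' G.neighborSet v).ncard = 3 - G.deg v := by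
    rw [Set.ncard_sdiff hfΔ (hΔf.subset hfΔ), hΔ3, hfcard]
  have h2f : G.twos.Finite := hG.subset fun v hv => hv.1
  have h2f' : G'.twos.Finite := hG'.subset fun v hv => hv.1
  constructor
  · intro hmin
    have hsub : G'.twos ⊆ (G.twos \ {v}) ∪ (Δ \ f '' G.neighborSet v) := by
      rintro u ⟨hu, hd⟩
      rw [hverts] at hu
      rcases hu with hu | hu
      · exact Or.inl ⟨⟨hu.1, (hold u hu.1 hu.2).symm.trans hd⟩, hu.2⟩
      · exact Or.inr ⟨hu, fun h => (htri u hu).1 h hd⟩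
    have h1 := (Set.ncard_le_ncard hsub ((h2f.subset Set.sdiff_subset).union
      (hΔf.subset Set.sdiff_subset))).trans (Set.ncard_union_le _ _)
    have h2 := hmin v hv
    by_cases hv2 : G.deg v = 2
    · have h3 := Set.ncard_sdiff_singleton_add_one (show v ∈ G.twos from ⟨hv, hv2⟩) h2f
      omega
    · have h3 := Set.ncard_sdiff_singleton_le G.twos v
      omega
  · have hsub : G.twos \ {v} ⊆ G'.twos \ Δ := by
      rintro u ⟨⟨hu, hd⟩, huv⟩
      refine ⟨⟨?_, (hold u hu huv).trans hd⟩, fun h => hnew u h hu⟩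
      rw [hverts]
      exact Or.inl ⟨hu, huv⟩
    have h1 := Set.ncard_le_ncard hsub (h2f'.subset Set.sdiff_subset)
    by_cases hv2 : v ∈ G.twos
    · have h3 := Set.ncard_sdiff_singleton_add_one hv2 h2f
      have h4 : (Δ \ f '' G.neighborSet v).Nonempty := by
        refine Set.nonempty_of_ncard_ne_zero ?_
        rw [hrest, hv2.2]
        omega
      obtain ⟨t, htΔ, ht⟩ := h4
      have h5 : t ∈ G'.twos := by
        refine ⟨?_, (htri t htΔ).2 ht⟩
        rw [hverts]
        exact Or.inr htΔ
      have h6 : (G'.twos \ Δ).ncard < G'.twos.ncard :=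
        Set.ncard_lt_ncard ⟨Set.sdiff_subset, fun h => (h h5).2 htΔ⟩ h2f'
      omega
    · have h3 : G.twos \ {v} = G.twos := Set.sdiff_singleton_eq_self hv2
      rw [h3] at h1
      exact h1.trans (Set.ncard_le_ncard Set.sdiff_subset h2f')

end YDelta

end Twos

/-! ### The reductions of bold graphs -/

section Shapes
variable {V : Type*}

theorem MixedGraph.isSafePath_iff (M : MixedGraph V) (S : Set V) (u : V) (l : List (Piece V))
    (v : V) : M.IsSafePath S u l v ↔
      SafePath (piecesOf M.E.Adj (fun a b => (a, b) ∈ M.arcs) S) S u l v :=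
  ⟨fun h => ⟨h.1, h.2, h.3, h.4, h.5, h.6, h.7, h.8⟩,
    fun h => ⟨h.1, h.2, h.3, h.4, h.5, h.6, h.7, h.8⟩⟩

namespace Template

theorem subfork_subcubic : subfork.Subcubic :=
  ⟨⟨by decide, by decide, by decide⟩, by decide, by decide⟩

theorem starFork_subcubic : starFork.Subcubic :=
  ⟨⟨by decide, by decide, by decide⟩, by decide, by decide⟩

theorem fork_subcubic : fork.Subcubic :=
  ⟨⟨by decide, by decide, by decide⟩, by decide, by decide⟩

theorem pFork_subcubic : pFork.Subcubic :=
  ⟨⟨by decide, by decide, by decide⟩, by decide, by decide⟩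

theorem Shaped.leaves_eq {t : Template} {K : PGraph V} {ι : ℕ → V} (hs : t.Shaped K ι)
    (ht : t.Subcubic) (hl : ∀ a < t.n, (t.inner a).length = 1 ↔ a ∈ t.halves) :
    K.leaves = t.connecting ι := by
  ext v
  constructor
  · rintro ⟨hv, hd⟩
    obtain ⟨a, ha, rfl⟩ := (hs.verts v).1 hv
    rw [hs.deg ht ha] at hd
    exact ⟨a, (hl a ha).1 hd, rfl⟩
  · rintro ⟨a, ha, rfl⟩
    have han := ht.wf.halves a ha
    refine ⟨(hs.verts _).2 ⟨a, han, rfl⟩, ?_⟩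
    rw [hs.deg ht han]
    exact (hl a han).2 ha

end Template

theorem PGraph.IsSubfork.shaped {K : PGraph V} (hK : K.IsSubfork) :
    ∃ ι, Template.subfork.Shaped K ι := by
  obtain ⟨u, v, h⟩ := hK
  exact ⟨_, PGraph.HasShape.shaped u h rfl Template.subfork_subcubic.wf⟩

theorem PGraph.IsStarFork.shaped {K : PGraph V} (hK : K.IsStarFork) :
    ∃ ι, Template.starFork.Shaped K ι := by
  obtain ⟨z, x, y, b, h⟩ := hK
  exact ⟨_, PGraph.HasShape.shaped z h rfl Template.starFork_subcubic.wf⟩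

theorem PGraph.IsFork.shaped {K : PGraph V} (hK : K.IsFork) :
    ∃ ι, Template.fork.Shaped K ι := by
  obtain ⟨x, y, z, a, b, h⟩ := hK
  exact ⟨_, PGraph.HasShape.shaped x h rfl Template.fork_subcubic.wf⟩

theorem PGraph.IsPForkOn.shaped {K : PGraph V} {l x y : V} (hK : K.IsPForkOn l x y) :
    ∃ ι, Template.pFork.Shaped K ι ∧ Template.pFork.connecting ι = {l, x, y} := by
  obtain ⟨a, b, p, q, z, h⟩ := hK
  refine ⟨_, PGraph.HasShape.shaped l h rfl Template.pFork_subcubic.wf, ?_⟩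
  ext v
  simp [Template.connecting, Template.pFork]

theorem Template.Shaped.leaves_subfork {K : PGraph V} {ι : ℕ → V}
    (h : Template.subfork.Shaped K ι) :
    K.leaves = Template.subfork.connecting ι :=
  h.leaves_eq Template.subfork_subcubic (by decide)

theorem Template.Shaped.leaves_starFork {K : PGraph V} {ι : ℕ → V}
    (h : Template.starFork.Shaped K ι) :
    K.leaves = Template.starFork.connecting ι :=
  h.leaves_eq Template.starFork_subcubic (by decide)

theorem Template.Shaped.leaves_fork {K : PGraph V} {ι : ℕ → V}
    (h : Template.fork.Shaped K ι) :
    K.leaves = Template.fork.connecting ι :=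
  h.leaves_eq Template.fork_subcubic (by decide)

theorem PGraph.IsBold.verts_eq {K B : PGraph V} {h : V → ℕ} (hb : K.IsBold B h) :
    B.verts = K.verts := by
  cases hb with
  | dot _ hB => rw [hB]
  | tree _ hB => rw [hB]
  | pfork _ _ _ _ hB => rw [hB]
  | bigFork _ _ _ _ _ _ _ _ hBv => exact hBv

theorem PGraph.IsBigForkWith.one_le {j : ℕ} {K : PGraph V} {C : Set V}
    (h : PGraph.IsBigForkWith j K C) : 1 ≤ j := by
  cases h <;> omega

/-- A big fork has at least four half-edges. -/
theorem BigForkData.four_le {j : ℕ} {B : PGraph V} {C W : Set V} (h : BigForkData j B C W)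
    (hj : 1 ≤ j) : 4 ≤ C.ncard := by
  cases h with
  | fork => omega
  | attach j B' T B C W z x y c u w h att hu hw =>
    obtain ⟨-, -, -, hc⟩ := att.notMem_B'
    rw [Set.ncard_insert_of_notMem (fun h' => hc (h.connecting_subset h'))
      (h.finite_verts.subset h.connecting_subset)]
    have := h.ncard_free.2
    omega

namespace Attachment
variable {M : MixedGraph V} {G K B : PGraph V} {h : V → ℕ} {J : Set (V × V)}

/-- The dot as a template: the vertex `0` with half-edges only. -/
theorem reducible_of_dot_list (H : Attachment M G K K h J) {v : V} (hK : K.HasShape [v] [])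
    {t : Template} {ps : List V} (hn : t.n = 1) (hsize : t.size = ps.length + 1)
    (hnb : ∀ b, b ∈ t.nbrs 0 ↔ 1 ≤ b ∧ b < t.size)
    (hslots : ∀ s ∈ t.slots, s = 0 ∧ M.E.deg v = 2) (hslots' : M.E.deg v = 2 → 0 ∈ t.slots)
    (hps : ps.Nodup) (hJ : ∀ w, (v, w) ∈ J ↔ w ∈ ps)
    (hc : t.check (fun _ => true) (fun _ _ => true) [0] = true) :
    Reducible M.E.Adj (fun a b => (a, b) ∈ M.arcs) K.verts := by
  have hvK : v ∈ K.verts := by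
    rw [hK.2.1]
    simp
  have hmem : ∀ w, w ∈ K.verts ↔ w = v := by
    intro w
    rw [hK.2.1]
    simp
  have hadj : ∀ w, M.E.Adj v w ↔ w ∈ ps := by
    intro w
    rw [H.adj_left hvK, hK.2.2, ← hJ]
    simp
  have hvps : v ∉ ps := fun h1 => M.E.loopless.irrefl v ((hadj v).2 h1)
  set ι : ℕ → V := fun k => (v :: ps).getD k v with hι
  have h0 : ι 0 = v := rfl
  have hlen : t.size = (v :: ps).length := by simp [hsize]
  have hget : ∀ k (hk : k < (v :: ps).length), ι k = (v :: ps)[k] := fun k hk =>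
    List.getD_eq_getElem _ _ hk
  have hlt : ∀ a, a < t.n → a = 0 := fun a ha => by omega
  have hsucc : ∀ b, 1 ≤ b → b < t.size → ι b ∈ ps := by
    intro b hb hbs
    obtain ⟨k, rfl⟩ := Nat.exists_eq_add_of_le' hb
    have hk : k < ps.length := by omega
    rw [hι]
    simp only [List.getD_cons_succ, List.getD_eq_getElem _ _ hk]
    exact List.getElem_mem hk
  have hR : t.Realized M.E.Adj (fun a b => (a, b) ∈ M.arcs) K.verts ι := by
    refine ⟨?_, ?_, fun a b hab => hab.symm, ?_, ?_, ?_, ?_, fun a ha => M.arcs_ne _ ha rfl, ?_⟩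
    · intro a ha b hb hab
      rw [hlen] at ha hb
      rw [hget a ha, hget b hb] at hab
      exact (List.nodup_cons.2 ⟨hvps, hps⟩).getElem_inj_iff.1 hab
    · intro w
      rw [hmem]
      constructor
      · rintro rfl
        exact ⟨0, by omega, rfl⟩
      · rintro ⟨a, ha, rfl⟩
        rw [hlt a ha]
        exact h0
    · intro a ha w
      rw [hlt a ha, h0, hadj]
      constructor
      · intro hw
        obtain ⟨k, hk, rfl⟩ := List.mem_iff_getElem.1 hw
        refine ⟨k + 1, (hnb _).2 ⟨by omega, by omega⟩, ?_⟩
        rw [hι]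
        simp [hk]
      · rintro ⟨b, hb, rfl⟩
        obtain ⟨hb1, hb2⟩ := (hnb b).1 hb
        exact hsucc b hb1 hb2
    · intro a b hab
      have h1 := H.arc _ hab
      constructor
      · intro ha
        have := (hmem a).1 ha
        subst this
        exact ⟨0, hslots' h1.1, rfl⟩
      · intro hb
        have := (hmem b).1 hb
        subst this
        exact ⟨0, hslots' h1.2, rfl⟩
    · intro s hs
      obtain ⟨rfl, hd⟩ := hslots s hs
      exact (M.deg_two v (H.mem_verts hvK) hd).1
    · intro s hs
      obtain ⟨rfl, hd⟩ := hslots s hs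
      exact (M.deg_two v (H.mem_verts hvK) hd).2
    · intro a b hab k _ b' hb' hnb'
      have h1 := (hJ _).2 (hsucc b' (by omega) hb')
      constructor
      · rintro - rfl
        exact (H.joint_arc h1 a).2 hab
      · rintro - rfl
        exact (H.joint_arc h1 b).1 hab
  obtain ⟨σ, hσ⟩ := hR.exists_outgoing
  obtain ⟨-, P, C, -, hP, -⟩ := hR.exists_safePartition hc hσ rfl
  exact ⟨P, C, hP⟩

theorem reducible_of_dot (H : Attachment M G K K h J) (hK : K.IsDot)
    (hh : ∀ v ∈ K.verts, h v = 2 ∨ h v = 3) :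
    Reducible M.E.Adj (fun a b => (a, b) ∈ M.arcs) K.verts := by
  obtain ⟨v, hK⟩ := hK
  have hvK : v ∈ K.verts := by
    rw [hK.2.1]
    simp
  have hd := H.deg_eq hvK
  have hd0 : K.deg v = 0 := by
    have : K.neighborSet v = ∅ := by
      refine Set.eq_empty_of_forall_notMem fun w hw => ?_
      have hw' : K.Adj v w := hw
      rw [hK.2.2] at hw'
      simp at hw'
    rw [PGraph.deg, this, Set.ncard_empty]
  have hc := H.card v hvK
  rcases hh v hvK with h2 | h3
  · rw [h2] at hc
    obtain ⟨p, q, hpq, hJ⟩ := Set.encard_eq_two.1 hc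
    refine H.reducible_of_dot_list hK (t := ⟨1, [], [0, 0]⟩) (ps := [p, q]) rfl rfl ?_ ?_ ?_
      (by simpa using hpq) (fun w => ?_) (by decide)
    · intro b
      rw [show (Template.mk 1 [] [0, 0]).nbrs 0 = [1, 2] from by decide,
        show (Template.mk 1 [] [0, 0]).size = 3 from rfl]
      simp only [List.mem_cons, List.not_mem_nil, or_false]
      omega
    · intro s hs
      rw [show (Template.mk 1 [] [0, 0]).slots = [0] from by decide, List.mem_singleton] at hs
      exact ⟨hs, by omega⟩
    · intro _
      decide
    · have := Set.ext_iff.1 hJ w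
      simpa using this
  · rw [h3] at hc
    obtain ⟨p, q, r, hpq, hpr, hqr, hJ⟩ := Set.encard_eq_three.1 hc
    refine H.reducible_of_dot_list hK (t := ⟨1, [], [0, 0, 0]⟩) (ps := [p, q, r]) rfl rfl ?_ ?_ ?_
      (by simp [hpq, hpr, hqr]) (fun w => ?_) (by decide)
    · intro b
      rw [show (Template.mk 1 [] [0, 0, 0]).nbrs 0 = [1, 2, 3] from by decide,
        show (Template.mk 1 [] [0, 0, 0]).size = 4 from rfl]
      simp only [List.mem_cons, List.not_mem_nil, or_false]
      omega
    · intro s hs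
      rw [show (Template.mk 1 [] [0, 0, 0]).slots = [] from by decide] at hs
      exact absurd hs (by simp)
    · intro h
      omega
    · have := Set.ext_iff.1 hJ w
      simpa using this

theorem reducible_of_fork (H : Attachment M G K K h J) (hK : K.IsFork)
    (hh : ∀ v ∈ K.verts, h v = K.leaves.indicator 1 v)
    (harc : ∀ a ∈ M.arcs, a.1 ∈ K.verts → a.2 ∈ K.verts) :
    Reducible M.E.Adj (fun a b => (a, b) ∈ M.arcs) K.verts := by
  obtain ⟨ι, hs⟩ := hK.shaped
  rw [Template.Shaped.leaves_fork hs] at hh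
  refine H.reducible_of_check Template.fork_subcubic hs hh Template.fork_check fun σ hσ => ?_
  rw [List.all_eq_true]
  intro q hq
  rw [List.mem_reverse, List.mem_map] at hq
  obtain ⟨s, hsl, rfl⟩ := hq
  by_contra hcon
  have hnone : σ s = none := by simpa using hcon
  have hsK : ι s ∈ K.verts := (hs.verts _).2 ⟨s, Template.slots_lt _ hsl, rfl⟩
  have hd : M.E.deg (ι s) = 2 := by
    rw [H.deg_eq hsK, hh _ hsK]
    exact (hs.deg_slot Template.fork_subcubic (fun v => Iff.rfl) (fun v => Iff.rfl) _ hsK).1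
      ⟨s, hsl, rfl⟩
  obtain ⟨o, ho, -⟩ := (M.deg_two _ (H.mem_verts hsK) hd).1
  exact ((hσ s hsl).2.1 hnone) o ho (harc _ ho hsK)

/-- A bold member of the fork-collection is reducible unless it is a big fork that is a
cut-obstacle, or a fork with arcs that leave it. -/
theorem reducible (H : Attachment M G K B h J) (hb : K.IsBold B h)
    (hfork : K.IsFork → (∀ v ∈ K.verts, h v = K.leaves.indicator 1 v) →
      ∀ a ∈ M.arcs, a.1 ∈ K.verts → a.2 ∈ K.verts)
    (hbig : (∃ j, 1 ≤ j ∧ PGraph.IsBigFork j K) → ¬ M.IsCutObstacle K.verts) :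
    Reducible M.E.Adj (fun a b => (a, b) ∈ M.arcs) K.verts := by
  cases hb with
  | dot hL hB hh =>
    subst hB
    exact H.reducible_of_dot hL hh
  | tree hL hB hh =>
    subst hB
    rcases hL with hL | hL | hL
    · obtain ⟨ι, hs⟩ := hL.shaped
      rw [Template.Shaped.leaves_subfork hs] at hh
      exact H.reducible_of_check Template.subfork_subcubic hs hh Template.subfork_check
        fun _ _ => rfl
    · obtain ⟨ι, hs⟩ := hL.shaped
      rw [Template.Shaped.leaves_starFork hs] at hh
      exact H.reducible_of_check Template.starFork_subcubic hs hh Template.starFork_check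
        fun _ _ => rfl
    · exact H.reducible_of_fork hL hh (hfork hL hh)
  | pfork l x y hL hB hh =>
    subst hB
    obtain ⟨ι, hs, hC⟩ := hL.shaped
    rw [← hC] at hh
    exact H.reducible_of_check Template.pFork_subcubic hs hh Template.pFork_check fun _ _ => rfl
  | bigFork j C hL D X hD hDD hDX hBv hBa hh hdeg =>
    obtain ⟨W, hK⟩ := BigForkData.of_isBigForkWith hL
    have hj := hL.one_le
    have hbh := H.boldHost hK.connecting_subset hK.free_subset hK.deg_add hD hDD hDX hBa hh
    by_cases hex : (∃ s ∈ K.verts, ∃ t ∈ K.verts, (s, t) ∈ M.arcs) ∨ (∃ s t, D.Adj s t) ∨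
        (X ∩ K.verts).Nonempty
    · exact hbh.reducible_of_bigFork hK hj hex
    · push Not at hex
      obtain ⟨h1, h2, h3⟩ := hex
      rw [h3] at hbh
      refine absurd (hbh.isCutObstacle hK.finite_verts ?_ h2 h1) (hbig ⟨j, hj, C, hL⟩)
      have := hK.ncard_free.1
      omega

/-- A reduction of `K` leads to a mixed graph on `G`. -/
theorem canBeSafelyReduced (H : Attachment M G K B h J)
    (hr : Reducible M.E.Adj (fun a b => (a, b) ∈ M.arcs) K.verts) :
    M.CanBeSafelyReduced K.verts := by
  obtain ⟨P, C, hP⟩ := hr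
  set Q := piecesOf M.E.Adj (fun a b => (a, b) ∈ M.arcs) K.verts with hQ
  have hpath : ∀ u l v, M.IsSafePath K.verts u l v ↔ SafePath Q K.verts u l v :=
    M.isSafePath_iff K.verts
  have hGK : ∀ v ∈ G.verts, v ∉ K.verts := fun v hv hv' => Set.disjoint_left.1 H.disj hv hv'
  have hGM : ∀ v, v ∈ G.verts ↔ v ∈ M.E.verts ∧ v ∉ K.verts := by
    intro v
    rw [H.verts]
    exact ⟨fun hv => ⟨Or.inl hv, hGK v hv⟩, fun hv => hv.1.resolve_right hv.2⟩
  have hE : G = M.E.deleteVerts K.verts := by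
    refine SimpleGraph.Subgraph.ext ?_ ?_
    · ext v
      rw [SimpleGraph.Subgraph.deleteVerts_verts, Set.mem_sdiff]
      exact hGM v
    · funext a b
      rw [SimpleGraph.Subgraph.deleteVerts_adj]
      refine propext ⟨fun hab => ?_, fun hab => ?_⟩
      · have ha := G.edge_vert hab
        have hb := G.edge_vert hab.symm
        exact ⟨((hGM a).1 ha).1, hGK a ha, ((hGM b).1 hb).1, hGK b hb,
          (H.adj_right ha b).2 (Or.inl hab)⟩
      · obtain ⟨ha, haK, hb, hbK, hab⟩ := hab
        exact ((H.adj_right ((hGM a).2 ⟨ha, haK⟩) b).1 hab).resolve_right fun h1 =>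
          hbK (H.joint_mem h1).1
  have hQM : ∀ p ∈ Q, p.src ∈ M.E.verts ∧ p.tgt ∈ M.E.verts := by
    rintro p ⟨-, ⟨-, h1⟩ | ⟨-, h1⟩⟩
    · exact M.arcs_mem _ h1
    · exact ⟨M.E.edge_vert h1, M.E.edge_vert h1.symm⟩
  set A : Set (V × V) := {a | a ∈ M.arcs ∧ a.1 ∉ K.verts ∧ a.2 ∉ K.verts} ∪
    {a | ∃ l ∈ P, M.IsSafePath K.verts a.1 l a.2} with hA
  -- each vertex of degree two of `G` has just one arc or edge to `K` in either direction
  have hone : ∀ v ∈ G.verts, G.deg v = 2 →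
      (∃ q : Piece V, q.src = v ∧ ((q.isArc = true ∧ (v, q.tgt) ∈ M.arcs) ∨ q ∈ Q) ∧
        ∀ r : Piece V, r.src = v → ((r.isArc = true ∧ (v, r.tgt) ∈ M.arcs) ∨ r ∈ Q) → r = q) ∧
      (∃ q : Piece V, q.tgt = v ∧ ((q.isArc = true ∧ (q.src, v) ∈ M.arcs) ∨ q ∈ Q) ∧
        ∀ r : Piece V, r.tgt = v → ((r.isArc = true ∧ (r.src, v) ∈ M.arcs) ∨ r ∈ Q) → r = q) := by
    intro v hv hd
    have hvK := hGK v hv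
    by_cases hJ : ∃ u, (u, v) ∈ J
    · obtain ⟨u, hu⟩ := hJ
      have huK := (H.joint_mem hu).1
      have harc := H.joint_arc hu
      have hadj : ∀ t ∈ K.verts, M.E.Adj v t → t = u := by
        intro t ht h1
        rcases (H.adj_right hv t).1 h1 with h2 | h2
        · exact absurd ht (hGK t (G.edge_vert h2.symm))
        · exact (Prod.mk.inj (H.inj _ h2 _ hu rfl)).1
      have hvu : M.E.Adj v u := (H.adj_right hv u).2 (Or.inr hu)
      constructor
      · refine ⟨⟨v, u, false⟩, rfl, Or.inr ⟨Or.inr huK, Or.inr ⟨rfl, hvu⟩⟩, ?_⟩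
        rintro ⟨_, t, f⟩ rfl (⟨-, h1⟩ | ⟨h1, ⟨-, h2⟩ | ⟨h2, h3⟩⟩)
        · exact absurd h1 (harc t).1
        · exact absurd h2 (harc t).1
        · rw [Piece.mk.injEq]
          exact ⟨rfl, hadj t (h1.resolve_left hvK) h3, h2⟩
      · refine ⟨⟨u, v, false⟩, rfl, Or.inr ⟨Or.inl huK, Or.inr ⟨rfl, hvu.symm⟩⟩, ?_⟩
        rintro ⟨t, _, f⟩ rfl (⟨-, h1⟩ | ⟨h1, ⟨-, h2⟩ | ⟨h2, h3⟩⟩)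
        · exact absurd h1 (harc t).2
        · exact absurd h2 (harc t).2
        · rw [Piece.mk.injEq]
          exact ⟨hadj t (h1.resolve_right hvK) (M.E.adj_symm h3), rfl, h2⟩
    · push Not at hJ
      have hd2 : M.E.deg v = 2 := (H.deg_old hv hJ).trans hd
      obtain ⟨⟨o, ho, ho'⟩, i, hi, hi'⟩ := M.deg_two v ((hGM v).1 hv).1 hd2
      have hadj : ∀ t ∈ K.verts, ¬ M.E.Adj v t := by
        intro t ht h1
        rcases (H.adj_right hv t).1 h1 with h2 | h2
        · exact hGK t (G.edge_vert h2.symm) ht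
        · exact hJ t h2
      constructor
      · refine ⟨⟨v, o, true⟩, rfl, Or.inl ⟨rfl, ho⟩, ?_⟩
        rintro ⟨_, t, f⟩ rfl (⟨h2, h1⟩ | ⟨h1, ⟨h2, h3⟩ | ⟨h2, h3⟩⟩)
        · rw [Piece.mk.injEq]
          exact ⟨rfl, ho' t h1, h2⟩
        · rw [Piece.mk.injEq]
          exact ⟨rfl, ho' t h3, h2⟩
        · exact absurd h3 (hadj t (h1.resolve_left hvK))
      · refine ⟨⟨i, v, true⟩, rfl, Or.inl ⟨rfl, hi⟩, ?_⟩
        rintro ⟨t, _, f⟩ rfl (⟨h2, h1⟩ | ⟨h1, ⟨h2, h3⟩ | ⟨h2, h3⟩⟩)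
        · rw [Piece.mk.injEq]
          exact ⟨hi' t h1, rfl, h2⟩
        · rw [Piece.mk.injEq]
          exact ⟨hi' t h3, rfl, h2⟩
        · exact absurd (M.E.adj_symm h3) (hadj t (h1.resolve_right hvK))
  have hpp : ∀ l ∈ P, ∀ l' ∈ P, ∀ p ∈ l, p ∈ l' → l = l' := fun l hl l' hl' p hp hp' =>
    hP.unique p l (Or.inl hl) l' (Or.inl hl') hp hp'
  refine ⟨⟨G, A, ?_, ?_, ?_, ?_⟩, fun v hv => H.mem_verts hv, P, C, ?_, ?_, ?_, hE, rfl⟩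
  · rintro a (⟨h1, h2, h3⟩ | ⟨l, hl, h1⟩)
    · have := M.arcs_mem a h1
      exact ⟨(hGM _).2 ⟨this.1, h2⟩, (hGM _).2 ⟨this.2, h3⟩⟩
    · rw [hpath] at h1
      obtain ⟨p, hp, hpa⟩ := h1.exists_first
      obtain ⟨q, hq, hqa⟩ := h1.exists_last
      exact ⟨(hGM _).2 ⟨hpa ▸ (hQM p (h1.mem p hp)).1, h1.left⟩,
        (hGM _).2 ⟨hqa ▸ (hQM q (h1.mem q hq)).2, h1.right⟩⟩
  · rintro a (⟨h1, -⟩ | ⟨l, hl, h1⟩)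
    · exact M.arcs_ne a h1
    · exact ((hpath _ _ _).1 h1).ne
  · intro v hv
    by_cases hJ : ∃ u, (u, v) ∈ J
    · obtain ⟨u, hu⟩ := hJ
      exact Or.inl (H.joint _ hu).2.2
    · push Not at hJ
      rw [← H.deg_old hv hJ]
      exact M.deg_two_or_three v ((hGM v).1 hv).1
  · intro v hv hd
    have hvK := hGK v hv
    obtain ⟨⟨q, rfl, hq, hq'⟩, hin⟩ := hone v hv hd
    refine ⟨?_, ?_⟩
    · have hqQ : q.tgt ∈ K.verts → q ∈ Q := fun h1 =>
        hq.elim (fun h2 => ⟨Or.inr h1, Or.inl h2⟩) id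
      by_cases hqK : q.tgt ∈ K.verts
      · obtain ⟨l, hl, hql, w, hw⟩ := hP.exists_path_src (hqQ hqK) hvK
        refine ⟨w, Or.inr ⟨l, hl, (hpath _ _ _).2 hw⟩, ?_⟩
        rintro w' (⟨h1, h2, h3⟩ | ⟨l', hl', h1⟩)
        · have := hq' ⟨q.src, w', true⟩ rfl (Or.inl ⟨rfl, h1⟩)
          exact absurd (this ▸ hqK) h3
        · rw [hpath] at h1
          obtain ⟨p, hp, hpa⟩ := h1.exists_first
          have := hq' p hpa (Or.inr (h1.mem p hp))
          subst this
          have := hpp l hl l' hl' p hql hp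
          subst this
          exact (h1.end_unique hw).2
      · have hqa : q.isArc = true ∧ (q.src, q.tgt) ∈ M.arcs := by
          refine hq.resolve_right fun h1 => ?_
          exact h1.1.elim hvK hqK
        refine ⟨q.tgt, Or.inl ⟨hqa.2, hvK, hqK⟩, ?_⟩
        rintro w' (⟨h1, h2, h3⟩ | ⟨l', hl', h1⟩)
        · exact congrArg Piece.tgt (hq' ⟨q.src, w', true⟩ rfl (Or.inl ⟨rfl, h1⟩))
        · rw [hpath] at h1
          obtain ⟨p, hp, hpa⟩ := h1.exists_first
          have hpQ := h1.mem p hp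
          have := hq' p hpa (Or.inr hpQ)
          subst this
          exact absurd hqK (not_not.2 (hpQ.1.resolve_left hvK))
    · clear hq hq'
      obtain ⟨r, hr, hq, hq'⟩ := hin
      rw [← hr] at hq hq' hvK ⊢
      have hqQ : r.src ∈ K.verts → r ∈ Q := fun h1 =>
        hq.elim (fun h2 => ⟨Or.inl h1, Or.inl h2⟩) id
      by_cases hqK : r.src ∈ K.verts
      · obtain ⟨l, hl, hql, w, hw⟩ := hP.exists_path_tgt (hqQ hqK) hvK
        refine ⟨w, Or.inr ⟨l, hl, (hpath _ _ _).2 hw⟩, ?_⟩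
        rintro w' (⟨h1, h2, h3⟩ | ⟨l', hl', h1⟩)
        · have := hq' ⟨w', r.tgt, true⟩ rfl (Or.inl ⟨rfl, h1⟩)
          exact absurd (this ▸ hqK) h2
        · rw [hpath] at h1
          obtain ⟨p, hp, hpa⟩ := h1.exists_last
          have := hq' p hpa (Or.inr (h1.mem p hp))
          subst this
          have := hpp l hl l' hl' p hql hp
          subst this
          exact (h1.end_unique hw).1
      · have hqa : r.isArc = true ∧ (r.src, r.tgt) ∈ M.arcs := by
          refine hq.resolve_right fun h1 => ?_
          exact h1.1.elim hqK hvK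
        refine ⟨r.src, Or.inl ⟨hqa.2, hqK, hvK⟩, ?_⟩
        rintro w' (⟨h1, h2, h3⟩ | ⟨l', hl', h1⟩)
        · exact congrArg Piece.src (hq' ⟨w', r.tgt, true⟩ rfl (Or.inl ⟨rfl, h1⟩))
        · rw [hpath] at h1
          obtain ⟨p, hp, hpa⟩ := h1.exists_last
          have hpQ := h1.mem p hp
          have := hq' p hpa (Or.inr hpQ)
          subst this
          exact absurd hqK (not_not.2 (hpQ.1.resolve_right hvK))
  · intro l hl
    obtain ⟨u, v, h1⟩ := hP.path l hl
    exact ⟨u, v, (hpath _ _ _).2 h1⟩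
  · intro l hl
    have h1 := hP.cycle l hl
    exact ⟨h1.1, h1.2, h1.3, h1.4, h1.5, h1.6, h1.7⟩
  · intro p hp
    obtain ⟨l, hl, hpl⟩ := hP.cover p hp
    exact ⟨l, ⟨hl, hpl⟩, fun l' hl' => hP.unique p l' hl'.1 l hl hl'.2 hpl⟩

end Attachment

end Shapes

/-! ### Building sequences -/

section Sequences
variable {V : Type*}

theorem PGraph.IsTriangle.ncard_twos {G : PGraph V} (h : G.IsTriangle) : G.twos.ncard ≤ 3 := by
  classical
  obtain ⟨a, b, c, -, hv, -⟩ := h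
  have h1 : G.twos ⊆ (({a, b, c} : Finset V) : Set V) := by
    rintro v ⟨h1, -⟩
    rw [hv] at h1
    simpa using h1
  have h2 := Set.ncard_le_ncard h1 (Finset.finite_toSet _)
  rw [Set.ncard_coe_finset] at h2
  exact h2.trans Finset.card_le_three

theorem PGraph.IsAddition.exists_boldAddition {G K G' : PGraph V} (h : G.IsAddition K G')
    (hG' : G'.verts.Finite) :
    ∃ B h J, K.IsBold B h ∧ BoldAddition G' G K B h J := by
  obtain ⟨B, h, J, hb, hdisj, hJ, hcard, hinj, hverts, hadj⟩ := h
  exact ⟨B, h, J, hb, hb.verts_eq, hdisj, hJ, hcard, hinj, hverts, hadj,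
    fun v _ => hG'.subset (G'.neighborSet_subset_verts v)⟩

/-- Adding a big fork takes more than three vertices of degree two, and every other member of the
fork-collection except the fork has as many half-edges as vertices that end up with degree two. -/
theorem BoldAddition.ncard_twos_le_three {G' G K B : PGraph V} {h : V → ℕ} {J : Set (V × V)}
    (H : BoldAddition G' G K B h J) (hb : K.IsBold B h) (hfork : ¬ K.IsFork)
    (hG : G.verts.Finite) (h3 : G.twos.ncard ≤ 3) : G'.twos.ncard ≤ 3 := by
  cases hb with
  | dot hL hB hh =>
    obtain ⟨v, -, hv, -⟩ := hL
    have hv' : K.verts = {v} := by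
      rw [hv]
      ext t
      simp
    refine (H.ncard_twos_le hG (hv' ▸ Set.finite_singleton v) (C := {v}) ?_ ?_).trans h3
    · rintro c rfl
      have hc : c ∈ K.verts := hv' ▸ rfl
      refine ⟨hc, ?_⟩
      have := hh c hc
      omega
    · refine Set.ncard_le_ncard ?_ (Set.finite_singleton v)
      rintro t ⟨ht, -⟩
      exact hv' ▸ ht
  | tree hL hB hh =>
    subst hB
    rcases hL with hL | hL | hL
    · obtain ⟨ι, hs⟩ := hL.shaped
      rw [Template.Shaped.leaves_subfork hs] at hh
      exact (H.ncard_twos_le_of_template hG Template.subfork_subcubic hs hh (by decide)).trans h3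
    · obtain ⟨ι, hs⟩ := hL.shaped
      rw [Template.Shaped.leaves_starFork hs] at hh
      exact (H.ncard_twos_le_of_template hG Template.starFork_subcubic hs hh (by decide)).trans h3
    · exact absurd hL hfork
  | pfork l x y hL hB hh =>
    subst hB
    obtain ⟨ι, hs, hC⟩ := hL.shaped
    rw [← hC] at hh
    exact (H.ncard_twos_le_of_template hG Template.pFork_subcubic hs hh (by decide)).trans h3
  | bigFork j C hL D X hD hDD hDX hBv hBa hh hdeg =>
    obtain ⟨W, hK⟩ := BigForkData.of_isBigForkWith hL
    have h4 := hK.four_le hL.one_le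
    have h5 := H.ncard_le_targets hG (C := C) fun c hc => by
      have hcK := hK.connecting_subset hc
      refine ⟨hcK, ?_⟩
      rw [hh c hcK, Set.indicator_of_mem hc]
      exact Nat.le_add_right _ _
    have h6 := Set.ncard_le_ncard H.targets_subset (hG.subset fun v hv => hv.1)
    omega

/-- As long as no fork has been added, there are at most three vertices of degree two. -/
theorem IsBuildingSequence.ncard_twos {n : ℕ} {G : ℕ → PGraph V} {L : ℕ → Option (PGraph V)}
    (hG : IsBuildingSequence n G L) (k : ℕ) (hk : k ≤ n)
    (hfork : ∀ j, 1 ≤ j → j ≤ k → ∀ K, L j = some K → ¬ K.IsFork) : (G k).twos.ncard ≤ 3 := by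
  induction k with
  | zero => exact hG.start.ncard_twos
  | succ k ih =>
    have h3 := ih (by omega) fun j hj hjk => hfork j hj (by omega)
    have h1 := hG.twoConnected k (by omega)
    have h2 := hG.twoConnected (k + 1) hk
    cases hL : L (k + 1) with
    | none =>
      rcases hG.transformation k (by omega) hL with h | h
      · exact ((h.ncard_twos h1.finite h2.finite).1 fun v hv => h1.two_le_deg hv).trans h3
      · exact (h.ncard_twos h2.finite h1.finite).2.trans h3
    | some K =>
      obtain ⟨B, h, J, hb, H⟩ :=
        (hG.addition k (by omega) K hL).exists_boldAddition h2.finite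
      exact H.ncard_twos_le_three hb (hfork (k + 1) (by omega) le_rfl K hL) h1.finite h3

/-- A fork uses up all of at most three vertices of degree two, so that no arc leaves it. -/
theorem Attachment.arc_mem_of_isFork {M : MixedGraph V} {G K B : PGraph V} {h : V → ℕ}
    {J : Set (V × V)} (H : Attachment M G K B h J) (hG : G.verts.Finite)
    (h3 : G.twos.ncard ≤ 3) (hK : K.IsFork)
    (hh : ∀ v ∈ K.verts, h v = K.leaves.indicator 1 v) :
    ∀ a ∈ M.arcs, a.1 ∈ K.verts → a.2 ∈ K.verts := by
  intro a ha _
  obtain ⟨ι, hs⟩ := hK.shaped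
  rw [Template.Shaped.leaves_fork hs] at hh
  have h1 := H.ncard_le_targets hG (hs.one_le_half Template.fork_subcubic hh)
  have h2 : (Template.fork.connecting ι).ncard = 3 :=
    hs.ncard_connecting Template.fork_subcubic
  have h4 : Prod.snd '' J = G.twos :=
    Set.eq_of_subset_of_ncard_le H.targets_subset (by omega) (hG.subset fun v hv => hv.1)
  have h5 := (M.arcs_mem a ha).2
  rw [H.verts] at h5
  refine h5.resolve_left fun h6 => ?_
  have hJ : ∀ u, (u, a.2) ∉ J := fun u hu => by
    have := H.deg_joint hu
    have := (H.arc a ha).2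
    omega
  have h7 : a.2 ∈ G.twos := ⟨h6, (H.deg_old h6 hJ).symm.trans (H.arc a ha).2⟩
  rw [← h4] at h7
  obtain ⟨⟨u, v⟩, hp, hv⟩ := h7
  exact hJ u (hv ▸ hp)

section Reduced
variable {G H : PGraph V} {hG : G.IsCubic} {M' : MixedGraph V}

theorem PGraph.IsInducedIn.deleteVerts_eq (hH : H.IsInducedIn G) :
    G.deleteVerts (G.verts \ H.verts) = H := by
  refine SimpleGraph.Subgraph.ext ?_ ?_
  · rw [SimpleGraph.Subgraph.deleteVerts_verts, Set.sdiff_sdiff_cancel_left hH.1]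
  · funext a b
    rw [SimpleGraph.Subgraph.deleteVerts_adj]
    refine propext ⟨fun ⟨ha, ha', hb, hb', hab⟩ => ?_, fun hab => ?_⟩
    · have h1 : a ∈ H.verts := by
        by_contra h
        exact ha' ⟨ha, h⟩
      have h2 : b ∈ H.verts := by
        by_contra h
        exact hb' ⟨hb, h⟩
      exact (hH.2 a h1 b h2).2 hab
    · have ha := H.edge_vert hab
      have hb := H.edge_vert hab.symm
      exact ⟨hH.1 ha, fun h => h.2 ha, hH.1 hb, fun h => h.2 hb, (hH.2 a ha b hb).1 hab⟩

/-- After a reduction of the complement of an induced subgraph of a cubic graph, the ends of arcs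
have degree two, because they have lost an edge. -/
theorem MixedGraph.IsSafeReduction.deg_of_arc (hH : H.IsInducedIn G)
    (hM : (MixedGraph.ofCubic G hG).IsSafeReduction (G.verts \ H.verts) M') :
    M'.E = H ∧ ∀ a ∈ M'.arcs, M'.E.deg a.1 = 2 ∧ M'.E.deg a.2 = 2 := by
  obtain ⟨-, P, C, hP, hC, -, hE, harcs⟩ := hM
  have hEH : M'.E = H := hE.trans hH.deleteVerts_eq
  refine ⟨hEH, ?_⟩
  -- a vertex with an edge to the reduced set
  have key : ∀ v ∈ M'.E.verts, ∀ w, w ∉ H.verts → G.Adj v w → M'.E.deg v = 2 := by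
    intro v hv w hw hvw
    have hvG : v ∈ G.verts := G.edge_vert hvw
    have hd := hG v hvG
    have hfin : (G.neighborSet v).Finite := by
      refine Set.finite_of_ncard_ne_zero ?_
      rw [PGraph.deg] at hd
      omega
    have hvH : v ∈ H.verts := hEH ▸ hv
    have hlt : (M'.E.neighborSet v).ncard < (G.neighborSet v).ncard := by
      refine Set.ncard_lt_ncard ⟨fun t ht => ?_, fun h => ?_⟩ hfin
      · rw [hEH] at ht
        exact (hH.2 v hvH t (H.edge_vert (H.adj_symm ht))).1 ht
      · have h1 : M'.E.Adj v w := h hvw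
        rw [hEH] at h1
        exact hw (H.edge_vert h1.symm)
    rcases M'.deg_two_or_three v hv with h | h
    · exact h
    · rw [PGraph.deg] at hd h
      omega
  intro a ha
  have hmem := M'.arcs_mem a ha
  rw [harcs] at ha
  rcases ha with ⟨h1, -⟩ | ⟨l, hl, h1⟩
  · exact h1.elim
  · have hends : ∀ p ∈ l, (p.src ∈ H.verts → M'.E.deg p.src = 2) ∧
        (p.tgt ∈ H.verts → M'.E.deg p.tgt = 2) := by
      intro p hp
      obtain ⟨h2, ⟨-, h3⟩ | ⟨-, h3⟩⟩ := h1.mem p hp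
      · exact h3.elim
      · constructor
        · intro h4
          have h5 := h2.resolve_left fun h => h.2 h4
          exact key _ (hEH ▸ h4) _ h5.2 h3
        · intro h4
          have h5 := h2.resolve_right fun h => h.2 h4
          exact key _ (hEH ▸ h4) _ h5.2 (G.adj_symm h3)
    rw [MixedGraph.isSafePath_iff] at h1
    obtain ⟨p, hp, hpa⟩ := h1.exists_first
    obtain ⟨q, hq, hqa⟩ := h1.exists_last
    rw [hEH] at hmem
    exact ⟨hpa ▸ (hends p hp).1 (hpa ▸ hmem.1), hqa ▸ (hends q hq).2 (hqa ▸ hmem.2)⟩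

end Reduced

end Sequences

theorem theorem2p1 {V : Type*} (n : ℕ) (G : ℕ → PGraph V) (L : ℕ → Option (PGraph V))
    (hG : IsBuildingSequence n G L) (hcubic : (G n).IsCubic)
    (i : ℕ) (hi : 1 ≤ i) (hin : i ≤ n) (K : PGraph V) (hK : L i = some K)
    (hsub : (G i).IsInducedIn (G n))
    (M' : MixedGraph V)
    (hM' : (MixedGraph.ofCubic (G n) hcubic).IsSafeReduction ((G n).verts \ (G i).verts) M') :
    ((∀ j, 1 ≤ j → ¬ PGraph.IsBigFork j K) → M'.CanBeSafelyReduced K.verts) ∧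
    ((∃ j, 1 ≤ j ∧ PGraph.IsBigFork j K) → ¬ M'.IsCutObstacle K.verts →
      M'.CanBeSafelyReduced K.verts) := by
  obtain ⟨k, rfl⟩ := Nat.exists_eq_add_of_le' hi
  obtain ⟨hE, harc⟩ := hM'.deg_of_arc hsub
  have hfin := (hG.twoConnected k (by omega)).finite
  obtain ⟨B, h, J, hb, H⟩ := (hG.addition k (by omega) K hK).exists_boldAddition
    (hG.twoConnected (k + 1) hin).finite
  rw [← hE] at H
  have HA : Attachment M' (G k) K B h J := ⟨H, harc⟩
  have main : ((∃ j, 1 ≤ j ∧ PGraph.IsBigFork j K) → ¬ M'.IsCutObstacle K.verts) →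
      M'.CanBeSafelyReduced K.verts := by
    refine fun hbig => HA.canBeSafelyReduced (HA.reducible hb (fun hfork hh => ?_) hbig)
    refine HA.arc_mem_of_isFork hfin (hG.ncard_twos k (by omega) ?_) hfork hh
    intro j hj hjk K' hK' hfork'
    have := hG.fork_once j (k + 1) hj (by omega) hi hin K' K hK' hK hfork' hfork
    omega
  exact ⟨fun h1 => main fun ⟨j, hj, h2⟩ => absurd h2 (h1 j hj), fun _ h1 => main fun _ => h1⟩
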